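/- Let $\tau:\mathbb N=\{0,1,2,\dots\}\to[0,\infty)$ be non-decreasing with at most polynomial growth, $\tau(0)=0$ and $\tau(k)>0$ for $k\ge1$. For $a>0$ let $Z_a=\sum_{j\ge0}a^j/\prod_{i=1}^j\tau(i)$, $a^*=\sup\{a>0: Z_a<\infty\}$, and for $a\in(0,a^*)$ let $\nu_a(k)=Z_a^{-1}a^k/\prod_{i=1}^k\tau(i)$, $R(a)=\sum_k k\,\nu_a(k)$, $R^*=\lim_{a\uparrow a^*}R(a)$, and let $\Phi:(0,R^*)\to(0,a^*)$ be the inverse function of $R$. Fix $\bar n\in(0,R^*)$, put $a=\Phi(\bar n)$ and $$\bar\tau=\mathbb E_{\nu_a}[\tau(n)],\quad \rho=\mathrm{Cov}_{\nu_a}(n,\tau(n)),\quad \alpha=\mathrm{Var}_{\nu_a}(n),\quad c=\frac{\rho}{2\alpha},\quad \sigma=\sqrt{\bar\tau}.$$ Let $\Omega_{N,\bar n}$ be the set of configurations $n:\{1,\dots,N\}\to\mathbb N$ with $\sum_i n(i)=\lfloor N\bar n\rfloor$, and consider on it the zero-range process in which, at rate $N^2\tau(n(i))/2$ for each ordered pair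 $(i,j)$ of nearest neighbours in $\{1,\dots,N\}$, a particle jumps from $i$ to $j$. Let $\pi_{N,\bar n}(n)\propto\prod_{i=1}^N\prod_{j=1}^{n(i)}\tau(j)^{-1}$ be its invariant probability measure on $\Omega_{N,\bar n}$. To a configuration $n$ associate the height function $$u(x)=\frac1{\sqrt N}\sum_{k=1}^{\lfloor xN\rfloor}(n(k)-\bar n),\qquad x\in[0,1],$$ an element of $E=L^1([0,1],dx)$; the map $n\mapsto u$ is injective on $\Omega_{N,\bar n}$. Let $\mathcal L_N$ be the generator of the process of height functions and $m_N$ the image of $\pi_{N,\bar n}$ on $E$. Let $m=m_{c,\sigma}$ be the law on $E$ of $\sqrt{\sigma^2/(2c)}\,Y$, with $Y$ a standard Brownian bridge on $[0,1]$. Let $\varphi$ be a real $C^2$ function with compact support in $(0,1)$, let $\langle u,\varphi\rangle=\int_0^1u(x)\varphi(x)\,dx$ and $\psi_\varphi(u)=\exp(i\langle u,\varphi\rangle)$, and define the finite complex measures $\Sigma_N^{\psi_\varphi}$ and $\Sigma^{\psi_\varphi}$ on $E$ by $$\psi_\varphi(u)\,\Sigma_N^{\psi_\varphi}(du)=\mathcal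 L_N\psi_\varphi(u)\,m_N(du),\qquad \Sigma^{\psi_\varphi}(du)=\Big(ic\,\langle u,\varphi''\rangle-\frac{\sigma^2}{2}\|\varphi\|_{L^2}^2\Big)m(du).$$ Then $\Sigma_N^{\psi_\varphi}$ converges weakly to $\Sigma^{\psi_\varphi}$ as $N\to\infty$ in the set of finite complex measures on $E$: both densities above are integrable with respect to $m_N$ and $m$ respectively, and $\int_E F\,d\Sigma_N^{\psi_\varphi}\to\int_E F\,d\Sigma^{\psi_\varphi}$ for every bounded continuous $F:E\to\mathbb R$. -/

import Mathlib

open MeasureTheory ProbabilityTheory Filter Topology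

namespace ZeroRange

noncomputable section

/-! ### The state space and the test functions -/

/-- The Banach space `E = L¹([0,1], dx)`. -/
abbrev E : Type := Lp ℝ 1 (volume : Measure unitInterval)

instance : MeasurableSpace E := borel E

instance : BorelSpace E := ⟨rfl⟩

open Classical in
/-- The class in `L¹([0,1])` of an integrable function on `[0,1]`. It is only used for step functions
and for continuous functions (see `memLp_height` and `memLp_of_continuous`). -/
def toE (f : unitInterval → ℝ) : E :=
  if h : MemLp f 1 (volume : Measure unitInterval) then h.toLp f else 0

theorem memLp_of_continuous {f : unitInterval → ℝ} (hf : Continuous f) :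
    MemLp f 1 (volume : Measure unitInterval) := by
  rw [memLp_one_iff_integrable]
  exact hf.integrable_of_hasCompactSupport (HasCompactSupport.of_compactSpace f)

/-- The pairing `⟨u, φ⟩ = ∫₀¹ u(x) φ(x) dx`. -/
def pairing (u : E) (φ : ℝ → ℝ) : ℝ := ∫ x : unitInterval, u x * φ x

/-- The function `ψ_φ(u) = exp(i ⟨u, φ⟩)` on `E`. -/
def psi (φ : ℝ → ℝ) (u : E) : ℂ := Complex.exp (Complex.I * (pairing u φ : ℂ))

/-! ### Rates and parameters -/

/-- Assumptions on the rate function: `τ(0) = 0`, `τ` non-decreasing with at most polynomial growth,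
and `τ(k) > 0` for `k ≥ 1` (so that one can divide by `∏ τ(i)`). In particular `τ ≥ 0`. -/
structure IsRate (τ : ℕ → ℝ) : Prop where
  zero : τ 0 = 0
  pos : ∀ k, 1 ≤ k → 0 < τ k
  mono : Monotone τ
  growth : ∃ (C : ℝ) (p : ℕ), ∀ k : ℕ, τ k ≤ C * (1 + (k : ℝ)) ^ p

/-- The weight `a^k / ∏_{i=1}^k τ(i)`. -/
def weight (τ : ℕ → ℝ) (a : ℝ) (k : ℕ) : ℝ := a ^ k / ∏ i ∈ Finset.Icc 1 k, τ i

/-- The normalization `Z_a`. -/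
def Z (τ : ℕ → ℝ) (a : ℝ) : ℝ := ∑' k, weight τ a k

/-- The point masses of the probability measure `ν_a` on `ℕ`. -/
def nu (τ : ℕ → ℝ) (a : ℝ) (k : ℕ) : ℝ := weight τ a k / Z τ a

/-- `a* = sup {a > 0 : Z_a < ∞} ∈ (0, ∞]`. -/
def aStar (τ : ℕ → ℝ) : EReal :=
  sSup ((fun a : ℝ => (a : EReal)) '' {a | 0 < a ∧ Summable (weight τ a)})

/-- `R(a)`, the mean of `ν_a`. -/
def R (τ : ℕ → ℝ) (a : ℝ) : ℝ := ∑' k : ℕ, (k : ℝ) * nu τ a k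

/-- `R* = lim_{a ↑ a*} R(a) ∈ (0, ∞]` (the limit exists because `R` is increasing). -/
def RStar (τ : ℕ → ℝ) : EReal :=
  limsup (fun x : EReal => (R τ x.toReal : EReal)) (𝓝[<] (aStar τ))

/-- `Φ : (0, R*) → (0, a*)`, the inverse function of `R : (0, a*) → (0, R*)`. -/
def Phi (τ : ℕ → ℝ) (nbar : ℝ) : ℝ :=
  Function.invFunOn (R τ) {a : ℝ | 0 < a ∧ (a : EReal) < aStar τ} nbar

/-- `τ̄ = E_{ν_a}[τ(n)]` with `a = Φ(n̄)`. -/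
def tauBar (τ : ℕ → ℝ) (nbar : ℝ) : ℝ := ∑' k : ℕ, τ k * nu τ (Phi τ nbar) k

/-- `ρ = Cov_{ν_a}(n, τ(n))` with `a = Φ(n̄)`. -/
def rho (τ : ℕ → ℝ) (nbar : ℝ) : ℝ :=
  ∑' k : ℕ, ((k : ℝ) - nbar) * (τ k - tauBar τ nbar) * nu τ (Phi τ nbar) k

/-- `α = Var_{ν_a}(n)` with `a = Φ(n̄)`. -/
def alpha (τ : ℕ → ℝ) (nbar : ℝ) : ℝ := ∑' k : ℕ, ((k : ℝ) - nbar) ^ 2 * nu τ (Phi τ nbar) k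

/-! ### The zero-range process: configurations, invariant measure, heights, generator -/

/-- The set of configurations on `N` sites with `⌊N n̄⌋` particles.
The site `i ∈ {1, …, N}` is represented by the index `i - 1 : Fin N`. -/
def Omega (N : ℕ) (nbar : ℝ) : Finset (Fin N → ℕ) :=
  Finset.piAntidiag Finset.univ ⌊(N : ℝ) * nbar⌋₊

/-- The unnormalized invariant weight `1 / ∏_i ∏_{j=1}^{n(i)} τ(j)`. -/
def configWeight (τ : ℕ → ℝ) {N : ℕ} (n : Fin N → ℕ) : ℝ :=
  1 / ∏ i, ∏ j ∈ Finset.Icc 1 (n i), τ j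

/-- The invariant probability `π_{N,n̄}(n)` of a configuration `n ∈ Ω_{N,n̄}`. -/
def configProb (τ : ℕ → ℝ) (N : ℕ) (nbar : ℝ) (n : Fin N → ℕ) : ℝ :=
  configWeight τ n / ∑ n' ∈ Omega N nbar, configWeight τ n'

/-- The rescaled height function `x ↦ N^{-1/2} ∑_{k=1}^{⌊xN⌋} (n(k) - n̄)`. -/
def height (N : ℕ) (nbar : ℝ) (n : Fin N → ℕ) (x : unitInterval) : ℝ :=
  1 / √(N : ℝ) * ∑ k : Fin N, if (k : ℕ) + 1 ≤ ⌊(x : ℝ) * N⌋₊ then (n k : ℝ) - nbar else 0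

theorem memLp_height (N : ℕ) (nbar : ℝ) (n : Fin N → ℕ) :
    MemLp (height N nbar n) 1 (volume : Measure unitInterval) := by
  have hm : Measurable (fun x : unitInterval => ⌊(x : ℝ) * N⌋₊) :=
    Nat.measurable_floor.comp (measurable_subtype_coe.mul_const _)
  have h (k : Fin N) : MemLp (fun x : unitInterval =>
      if (k : ℕ) + 1 ≤ ⌊(x : ℝ) * N⌋₊ then (n k : ℝ) - nbar else 0) 1 volume := by
    refine MemLp.of_bound (C := |(n k : ℝ) - nbar|) ?_ (ae_of_all _ fun x => ?_)
    · exact (Measurable.ite (hm (measurableSet_Ici (a := (k : ℕ) + 1))) measurable_const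
        measurable_const).aestronglyMeasurable
    · split_ifs <;> simp
  exact (memLp_finsetSum Finset.univ fun k _ => h k).const_mul (1 / √(N : ℝ))

/-- The height function of a configuration as an element of `E`. It is injective on `Ω_{N,n̄}`. -/
def heightE (N : ℕ) (nbar : ℝ) (n : Fin N → ℕ) : E := toE (height N nbar n)

/-- `m_N`: the law on `E` of the height function under the invariant measure `π_{N,n̄}`. -/
def mN (τ : ℕ → ℝ) (nbar : ℝ) (N : ℕ) : Measure E :=
  ∑ n ∈ Omega N nbar, ENNReal.ofReal (configProb τ N nbar n) • Measure.dirac (heightE N nbar n)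

/-- The configuration after one particle has moved from `i` to `j` (used for `i ≠ j`, `n i ≥ 1`). -/
def move {N : ℕ} (n : Fin N → ℕ) (i j : Fin N) : Fin N → ℕ :=
  Function.update (Function.update n i (n i - 1)) j (n j + 1)

/-- The generator of the particle dynamics: a particle jumps from `i` to each
nearest neighbour `j ∈ {1, …, N}` of `i` at rate `N² τ(n(i)) / 2`
(this rate vanishes if `n(i) = 0`). -/
def configGenerator (τ : ℕ → ℝ) (N : ℕ) (f : (Fin N → ℕ) → ℂ) (n : Fin N → ℕ) : ℂ :=
  ∑ i : Fin N, ∑ j : Fin N,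
    if (i : ℕ) + 1 = j ∨ (j : ℕ) + 1 = i then
      (((N : ℝ) ^ 2 * τ (n i) / 2 : ℝ) : ℂ) * (f (move n i j) - f n) else 0

/-- The generator `𝓛_N` of the Markov process of height functions: for `u` in the finite set
`E_N = heightE '' Ω_{N,n̄}`, it acts through the unique configuration of `Ω_{N,n̄}` whose height
function is `u`. (Its value outside `E_N`, which is `m_N`-null, is irrelevant.) -/
def generator (τ : ℕ → ℝ) (nbar : ℝ) (N : ℕ) (f : E → ℂ) (u : E) : ℂ :=
  configGenerator τ N (fun n => f (heightE N nbar n))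
    (Function.invFunOn (heightE N nbar) (Omega N nbar : Set (Fin N → ℕ)) u)

/-! ### The Brownian bridge and the measures `Σ` -/

/-- `Y` is a standard Brownian bridge on `[0,1]`: a centered Gaussian process with almost surely
continuous paths and covariance `min(s,t) (1 - max(s,t))`. -/
structure IsBrownianBridge {Ω : Type*} [MeasurableSpace Ω] (Y : unitInterval → Ω → ℝ) (P : Measure Ω) :
    Prop where
  gaussian : IsGaussianProcess Y P
  centered : ∀ t, P[Y t] = 0
  covariance : ∀ s t : unitInterval, cov[Y s, Y t; P] = min (s : ℝ) t * (1 - max (s : ℝ) t)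
  continuous : ∀ᵐ ω ∂P, Continuous fun t => Y t ω

/-- `m_{c,σ}`: the law on `E` of `√(σ² / (2c)) Y`, for `Y` a standard Brownian bridge under `P`. -/
def bridgeLaw {Ω : Type*} [MeasurableSpace Ω] (Y : unitInterval → Ω → ℝ) (P : Measure Ω) (c σ : ℝ) :
    Measure E :=
  P.map fun ω => toE fun t => √(σ ^ 2 / (2 * c)) * Y t ω

/-- The density `i c ⟨u, φ''⟩ - (σ²/2) ‖φ‖²_{L²}`. -/
def limitDensity (c σ : ℝ) (φ : ℝ → ℝ) (u : E) : ℂ :=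
  Complex.I * (c : ℂ) * (pairing u (deriv (deriv φ)) : ℂ)
    - ((σ ^ 2 / 2 * ∫ x : unitInterval, φ x ^ 2 : ℝ) : ℂ)

/-- The density of `Σ_N` with respect to `m_N`: since `ψ_φ · Σ_N = 𝓛_N ψ_φ · m_N` and `ψ_φ`
does not vanish, it is `𝓛_N ψ_φ / ψ_φ`. -/
def discreteDensity (τ : ℕ → ℝ) (nbar : ℝ) (N : ℕ) (φ : ℝ → ℝ) (u : E) : ℂ :=
  generator τ nbar N (psi φ) u / psi φ u

/-- The complex measure `Σ_N^{ψ_φ}` on `E`. -/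
def SigmaN (τ : ℕ → ℝ) (nbar : ℝ) (φ : ℝ → ℝ) (N : ℕ) : ComplexMeasure E :=
  (mN τ nbar N).withDensityᵥ (discreteDensity τ nbar N φ)

/-- The complex measure `Σ^{ψ_φ} = (i c ⟨u, φ''⟩ - (σ²/2) ‖φ‖²) m` on `E`. -/
def SigmaLimit (m : Measure E) (c σ : ℝ) (φ : ℝ → ℝ) : ComplexMeasure E :=
  m.withDensityᵥ (limitDensity c σ φ)

/-- Weak convergence of finite complex measures on `E`: convergence of the integrals of all
bounded continuous functions `F : E → ℝ`. -/
def WeakConv (μ : ℕ → ComplexMeasure E) (ν : ComplexMeasure E) : Prop :=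
  ∀ F : BoundedContinuousFunction E ℝ,
    Tendsto (fun N => (μ N).integral F (ContinuousLinearMap.lsmul ℝ ℝ)) atTop
      (𝓝 (ν.integral F (ContinuousLinearMap.lsmul ℝ ℝ)))

end

end ZeroRange

open MeasureTheory ProbabilityTheory Filter Topology

namespace ZeroRange

noncomputable section

section


/-! ### Laws on `ℕ` with a finite variance -/

/-! Write `p = ν_a` and `M = ⌊N n̄⌋`. The factor `a^M / Z_a^N` is constant on configurations with
`M` particles, so the invariant measure is the product law of `p` conditioned on the total being
`M`. Two features of this conditioned law carry the proof.

First, the constraint can be written as a Fourier integral over a dual variable. A local limit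
theorem (`local_limit`, `tendsto_integral_chr`) then shows that the character of `N^{-1/2} ∑ θ_j
(n_j - n̄)` has mean tending to `χ = exp(-(α/2)(B - A²))`, where `A` and `B` are the limits of the
averages of `θ` and `θ²`. The term `-A²` is the effect of conditioning; it turns Brownian motion
into a bridge, and the heights converge in law to `√α Y`.

Second, `τ(k+1) p(k+1) = a p(k)`: a factor `τ(n_i)` amounts to removing a particle from site `i`.
Hence `τ̄ = ρ = a`, so that `σ² = a`, `c = a/(2α)` and `σ²/(2c) = α`. Moreover the mean of `τ(n_i)`
times a character reduces exactly to the mean of that character with one particle fewer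
(`integral_rate_mul_chr`). This identity does the work of a Boltzmann–Gibbs principle.

Since `ψ_φ` is the exponential of a linear functional, `𝓛_N ψ_φ / ψ_φ = ∑ τ(n_i) z_i` with
deterministic `z_i = -(i/2) φ'(x_i)/√N - φ(x_i)²/(2N) + O(N^{-3/2})`. Against a character, the phase
`exp(iθ_i/√N)` left by the removed particle multiplies the first term of `z_i`, and the limit is `a
(L/2 - ½∫φ²) χ` with `L` the limit of the average of `θ φ'`. In the limit density, `⟨u, φ''⟩` is
minus the linear statistic with coefficients `φ'(x_i)/√N`; differentiating the characteristic
function yields the same value. So the difference `G_N` of the two densities vanishes in the limit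
against every character of finitely many values of the height
(`tendsto_integral_char_density_diff`).

A uniform `L²` bound on `G_N` enlarges the class of test functions: from characters to bounded
continuous functions of finitely many values, then to Lipschitz functions on `E` by step-function
approximation, then to every bounded continuous `F` by Lipschitz minorants
(`tendsto_integral_bounded_mul`). It remains to integrate `F` times the limit density against `m_N`;
this converges by the weak convergence of the heights and uniform second moments of `⟨u, φ''⟩`. -/

/-- A probability mass function on `ℕ` charging every integer, with mean `m` and variance `α`. -/
structure IsLaw (p : ℕ → ℝ) (m α : ℝ) : Prop where
  pos : ∀ k, 0 < p k
  hasSum_one : HasSum p 1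
  hasSum_mean : HasSum (fun k : ℕ => (k : ℝ) * p k) m
  hasSum_var : HasSum (fun k : ℕ => ((k : ℝ) - m) ^ 2 * p k) α

/-- The measure on `ℕ` with point masses `p`. -/
def law (p : ℕ → ℝ) : Measure ℕ := Measure.count.withDensity fun k => ENNReal.ofReal (p k)

theorem law_singleton (p : ℕ → ℝ) (k : ℕ) : law p {k} = ENNReal.ofReal (p k) := by
  rw [law, withDensity_apply _ (measurableSet_singleton k)]
  simp

theorem integrable_law {p : ℕ → ℝ} (hp : ∀ k, 0 ≤ p k) {F : Type*} [NormedAddCommGroup F]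
    [NormedSpace ℝ F] {f : ℕ → F} :
    Integrable f (law p) ↔ Summable fun k => ‖f k‖ * p k := by
  rw [law, integrable_withDensity_iff_integrable_smul' (by fun_prop) (by simp),
    integrable_count_iff]
  refine summable_congr fun k => ?_
  rw [norm_smul, ENNReal.toReal_ofReal (hp k), Real.norm_of_nonneg (hp k), mul_comm]

theorem integral_law {p : ℕ → ℝ} (hp : ∀ k, 0 ≤ p k) {F : Type*} [NormedAddCommGroup F]
    [NormedSpace ℝ F] [CompleteSpace F] {f : ℕ → F} (hf : Integrable f (law p)) :
    ∫ k, f k ∂(law p) = ∑' k, p k • f k := by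
  rw [integral_countable hf]
  refine tsum_congr fun k => ?_
  rw [measureReal_def, law_singleton, ENNReal.toReal_ofReal (hp k)]

namespace IsLaw

variable {p : ℕ → ℝ} {m α : ℝ} (h : IsLaw p m α)
include h

theorem nonneg (k : ℕ) : 0 ≤ p k := (h.pos k).le

theorem isProbabilityMeasure : IsProbabilityMeasure (law p) := by
  have hi : Integrable (fun _ : ℕ => (1 : ℝ)) (law p) := by
    rw [integrable_law h.nonneg]; simpa using h.hasSum_one.summable
  have h1 := integral_law h.nonneg hi
  have hf : IsFiniteMeasure (law p) := by
    rcases integrable_const_iff.1 hi with h0 | h0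
    · exact absurd h0 one_ne_zero
    · exact h0
  simp only [integral_const, smul_eq_mul, mul_one, h.hasSum_one.tsum_eq] at h1
  constructor
  rw [measureReal_def, ENNReal.toReal_eq_one_iff] at h1
  exact h1

theorem integrable_id : Integrable (fun k : ℕ => (k : ℝ)) (law p) := by
  rw [integrable_law h.nonneg]; simpa using h.hasSum_mean.summable

theorem integrable_sq : Integrable (fun k : ℕ => ((k : ℝ) - m) ^ 2) (law p) := by
  rw [integrable_law h.nonneg]; simpa using h.hasSum_var.summable

theorem integral_id : ∫ k, (k : ℝ) ∂(law p) = m := by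
  rw [integral_law h.nonneg h.integrable_id, ← h.hasSum_mean.tsum_eq]
  simp [mul_comm]

theorem integral_sq : ∫ k, ((k : ℝ) - m) ^ 2 ∂(law p) = α := by
  rw [integral_law h.nonneg h.integrable_sq, ← h.hasSum_var.tsum_eq]
  simp [mul_comm]

/-- One atom away from the mean is enough: 0 if `m ≠ 0`, and 1 if `m = 0`. -/
theorem var_pos : 0 < α := by
  rw [← h.hasSum_var.tsum_eq]
  have hnn : ∀ k : ℕ, 0 ≤ ((k : ℝ) - m) ^ 2 * p k := fun k => mul_nonneg (sq_nonneg _) (h.nonneg k)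
  by_cases hm : m = 0
  · refine h.hasSum_var.summable.tsum_pos hnn 1 ?_
    have := h.pos 1
    simp [hm, this]
  · refine h.hasSum_var.summable.tsum_pos hnn 0 ?_
    have := h.pos 0
    have hm2 : 0 < m ^ 2 := by positivity
    simpa using mul_pos hm2 this

end IsLaw

/-- The characteristic function of the centered law. -/
def cchar (p : ℕ → ℝ) (m t : ℝ) : ℂ :=
  ∫ k, Complex.exp (Complex.I * ((t * ((k : ℝ) - m) : ℝ) : ℂ)) ∂(law p)

theorem cchar_eq_charFun (p : ℕ → ℝ) (m t : ℝ) :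
    cchar p m t = charFun ((law p).map fun k : ℕ => (k : ℝ) - m) t := by
  rw [charFun_apply_real, integral_map (by fun_prop) (by fun_prop)]
  unfold cchar
  congr 1; ext k; congr 1; push_cast; ring

namespace IsLaw
variable {p : ℕ → ℝ} {m α : ℝ} (h : IsLaw p m α)
include h

theorem continuous_cchar : Continuous (cchar p m) := by
  have := h.isProbabilityMeasure
  have hp : IsProbabilityMeasure ((law p).map fun k : ℕ => (k : ℝ) - m) :=
    Measure.isProbabilityMeasure_map (by fun_prop)
  rw [funext (cchar_eq_charFun p m)]
  exact continuous_charFun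

/-- A finite second moment gives a second-order Taylor expansion; centring removes the linear term.
-/
theorem cchar_taylor :
    (fun t => cchar p m t - (1 - α * t ^ 2 / 2)) =o[𝓝 0] fun t : ℝ => t ^ 2 := by
  have := h.isProbabilityMeasure
  have hX : AEMeasurable (fun k : ℕ => (k : ℝ) - m) (law p) := by fun_prop
  have hp : IsProbabilityMeasure ((law p).map fun k : ℕ => (k : ℝ) - m) :=
    Measure.isProbabilityMeasure_map hX
  have hint : MemLp id 2 ((law p).map fun k : ℕ => (k : ℝ) - m) := by
    rw [memLp_two_iff_integrable_sq (by fun_prop),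
      integrable_map_measure (by fun_prop) hX]
    exact h.integrable_sq
  have h0 : ∫ k, ((k : ℝ) - m) ∂(law p) = 0 := by
    rw [integral_sub h.integrable_id (integrable_const _), h.integral_id]; simp
  have h1 : ∫ k, ((fun k : ℕ => (k : ℝ) - m) ^ 2) k ∂(law p) = α := h.integral_sq
  have key := taylor_isLittleO_univ (n := 2) (x₀ := 0) (contDiff_charFun hint)
  simp_rw [taylorWithinEval_charFun_two_zero hX hint, h0, h1, sub_zero] at key
  simp_rw [cchar_eq_charFun]
  simpa using key

/-- The atoms 0 and 1 already interfere: `|p 0 + p 1 e^{it}|² = (p 0 + p 1)² - 2 p 0 p 1 (1 - cos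
t)`, while the other atoms contribute at most their mass. This is aperiodicity in quantitative form,
and the source of all Gaussian domination below. -/
theorem norm_cchar_le (t : ℝ) :
    ‖cchar p m t‖ ≤ Real.exp (-(p 0 * p 1 * (1 - Real.cos t))) := by
  have hsum := h.hasSum_one
  have hint : Integrable (fun k : ℕ => Complex.exp (Complex.I * ((t * ((k : ℝ) - m) : ℝ) : ℂ)))
      (law p) := by
    rw [integrable_law h.nonneg]
    simpa only [Complex.norm_exp_I_mul_ofReal, one_mul] using hsum.summable
  have hs : Summable fun k => p k • Complex.exp (Complex.I * ((t * ((k : ℝ) - m) : ℝ) : ℂ)) := by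
    refine Summable.of_norm ?_
    simpa only [norm_smul, Complex.norm_exp_I_mul_ofReal, mul_one, Real.norm_of_nonneg (h.nonneg _)]
      using hsum.summable
  rw [cchar, integral_law h.nonneg hint, ← hs.sum_add_tsum_nat_add 2]
  have htail : ‖∑' i, p (i + 2) • Complex.exp (Complex.I * ((t * (((i + 2 : ℕ) : ℝ) - m) : ℝ) : ℂ))‖
      ≤ 1 - (p 0 + p 1) := by
    have h2 : HasSum (fun i => p (i + 2)) (1 - (p 0 + p 1)) := by
      have := (hasSum_nat_add_iff' (f := p) 2).2 hsum
      simpa [Finset.sum_range_succ] using this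
    rw [← h2.tsum_eq]
    refine tsum_of_norm_bounded h2.summable.hasSum fun i => ?_
    rw [norm_smul, Complex.norm_exp_I_mul_ofReal, mul_one, Real.norm_of_nonneg (h.nonneg _)]
  have h0 := h.pos 0
  have h1 := h.pos 1
  have hle : p 0 + p 1 ≤ 1 := by
    have := hsum.summable.sum_le_tsum (Finset.range 2) fun i _ => h.nonneg i
    rw [hsum.tsum_eq] at this
    simpa [Finset.sum_range_succ] using this
  have hcos : 0 ≤ 1 - Real.cos t := by linarith [Real.cos_le_one t]
  have hcos2 : 1 - Real.cos t ≤ 2 := by linarith [Real.neg_one_le_cos t]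
  have hhead : ‖∑ i ∈ Finset.range 2,
      p i • Complex.exp (Complex.I * ((t * ((i : ℝ) - m) : ℝ) : ℂ))‖
      ≤ (p 0 + p 1) - p 0 * p 1 * (1 - Real.cos t) := by
    have e : ∑ i ∈ Finset.range 2, p i • Complex.exp (Complex.I * ((t * ((i : ℝ) - m) : ℝ) : ℂ))
        = Complex.exp (Complex.I * ((-(t * m) : ℝ) : ℂ)) *
          ((p 0 + p 1 * Real.cos t : ℝ) + (p 1 * Real.sin t : ℝ) * Complex.I) := by
      have e1 : Complex.exp (Complex.I * ((t * (1 - m) : ℝ) : ℂ)) =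
          Complex.exp (Complex.I * ((-(t * m) : ℝ) : ℂ)) * Complex.exp (t * Complex.I) := by
        rw [← Complex.exp_add]; congr 1; push_cast; ring
      simp only [Finset.sum_range_succ, Finset.range_zero, Finset.sum_empty, zero_add,
        Nat.cast_zero, Nat.cast_one, e1, zero_sub, mul_neg, Complex.real_smul]
      rw [Complex.exp_mul_I]
      push_cast
      ring
    rw [e, norm_mul, Complex.norm_exp_I_mul_ofReal, one_mul, Complex.norm_add_mul_I]
    refine Real.sqrt_le_iff.2 ⟨?_, ?_⟩
    · nlinarith [mul_pos h0 h1, mul_nonneg (mul_pos h0 h1).le hcos]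
    · have hs := Real.sin_sq_add_cos_sq t
      have e2 : (p 0 + p 1 * Real.cos t) ^ 2 + (p 1 * Real.sin t) ^ 2
          = (p 0 + p 1) ^ 2 - 2 * (p 0 * p 1 * (1 - Real.cos t)) := by
        linear_combination (p 1) ^ 2 * hs
      have h3 : 0 ≤ p 0 * p 1 * (1 - Real.cos t) := by positivity
      rw [e2]
      nlinarith [mul_nonneg h3 (sub_nonneg.2 hle), sq_nonneg (p 0 * p 1 * (1 - Real.cos t))]
  calc _ ≤ ((p 0 + p 1) - p 0 * p 1 * (1 - Real.cos t)) + (1 - (p 0 + p 1)) :=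
        (norm_add_le _ _).trans (add_le_add hhead htail)
    _ = -(p 0 * p 1 * (1 - Real.cos t)) + 1 := by ring
    _ ≤ _ := Real.add_one_le_exp _

end IsLaw

/-! ### Fourier inversion on the simplex of configurations -/

theorem integral_exp_int_mul (k : ℤ) :
    ∫ t in (-Real.pi)..Real.pi, Complex.exp (Complex.I * ((t * k : ℝ) : ℂ))
      = (if k = 0 then 2 * (Real.pi : ℂ) else 0 : ℂ) := by
  split_ifs with hk
  · simp [hk]; ring
  · have hne : Complex.I * (k : ℂ) ≠ 0 := by simp [hk]
    have := integral_exp_mul_complex (a := -Real.pi) (b := Real.pi) hne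
    have e : ∀ t : ℝ, Complex.exp (Complex.I * ((t * k : ℝ) : ℂ)) =
        Complex.exp (Complex.I * (k : ℂ) * t) := fun t => by congr 1; push_cast; ring
    simp_rw [e]
    rw [this, div_eq_zero_iff, sub_eq_zero]
    left
    rw [Complex.exp_eq_exp_iff_exists_int]
    exact ⟨k, by push_cast; ring⟩

/-- The integral of `exp(it(∑ n_j - M))` over a period detects the constraint `∑ n_j = M`; under the
product law the remaining expectation factorizes over sites. -/
theorem fourier_piAntidiag {p : ℕ → ℝ} {m α : ℝ} (h : IsLaw p m α) {N : ℕ} (M : ℕ)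
    (f : Fin N → ℕ → ℂ) (hf : ∀ j, Integrable (f j) (law p)) :
    ∫ t in (-Real.pi)..Real.pi, (∏ j, ∫ k, f j k * Complex.exp (Complex.I * ((t * k : ℝ) : ℂ))
        ∂(law p)) * Complex.exp (-(Complex.I * ((t * M : ℝ) : ℂ)))
      = 2 * Real.pi * ∑ n ∈ Finset.piAntidiag (Finset.univ : Finset (Fin N)) M,
          ∏ j, (p (n j) * f j (n j)) := by
  have := h.isProbabilityMeasure
  set μ := Measure.pi fun _ : Fin N => law p
  have e1 (t : ℝ) : (∏ j, ∫ k, f j k * Complex.exp (Complex.I * ((t * k : ℝ) : ℂ)) ∂(law p)) *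
      Complex.exp (-(Complex.I * ((t * M : ℝ) : ℂ))) =
      ∫ n, (∏ j, f j (n j)) * Complex.exp (Complex.I * ((t * ((∑ j, (n j : ℤ) - M : ℤ)) : ℝ) : ℂ))
        ∂μ := by
    rw [← integral_fintype_prod_eq_prod, ← integral_mul_const]
    congr 1; ext n
    rw [Finset.prod_mul_distrib, ← Complex.exp_sum, mul_assoc, ← Complex.exp_add]
    congr 2
    push_cast
    rw [mul_sub, mul_sub, Finset.mul_sum, Finset.mul_sum]
    ring
  simp_rw [e1]
  have hprod : Integrable (fun n : Fin N → ℕ => ∏ j, f j (n j)) μ := Integrable.fintype_prod hf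
  rw [intervalIntegral_integral_swap]
  swap
  · have : IsFiniteMeasure (volume.restrict (Set.uIoc (-Real.pi) Real.pi)) := by
      unfold Set.uIoc; infer_instance
    -- The phases have modulus one, so the product of the `f j` alone justifies Fubini.
    have hb : Integrable (Function.uncurry fun (t : ℝ) (n : Fin N → ℕ) => ∏ j, f j (n j))
        ((volume.restrict (Set.uIoc (-Real.pi) Real.pi)).prod μ) :=
      hprod.comp_snd _
    refine hb.mono ?_ ?_
    · refine AEStronglyMeasurable.mul hb.aestronglyMeasurable ?_
      refine Measurable.aestronglyMeasurable ?_
      refine Complex.measurable_exp.comp (measurable_const.mul (Complex.measurable_ofReal.comp ?_))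
      exact measurable_fst.mul ((measurable_from_top (f := fun z : ℤ => (z : ℝ))).comp
        ((measurable_of_countable fun n : Fin N → ℕ => (∑ j, (n j : ℤ) - M : ℤ)).comp
          measurable_snd))
    · refine ae_of_all _ fun x => ?_
      simp only [Function.uncurry, norm_mul, Complex.norm_exp_I_mul_ofReal, mul_one, le_refl]
  have e2 (n : Fin N → ℕ) : ∫ t in (-Real.pi)..Real.pi,
      (∏ j, f j (n j)) * Complex.exp (Complex.I * ((t * ((∑ j, (n j : ℤ) - M : ℤ)) : ℝ) : ℂ))
      = Set.indicator (Finset.piAntidiag (Finset.univ : Finset (Fin N)) M : Set (Fin N → ℕ))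
        (fun n => (∏ j, f j (n j)) * (2 * Real.pi)) n := by
    rw [intervalIntegral.integral_const_mul, integral_exp_int_mul]
    by_cases hn : ∑ j, n j = M
    · have hz : (∑ j, (n j : ℤ) - M : ℤ) = 0 := by rw [← hn]; push_cast; ring
      rw [if_pos hz, Set.indicator_of_mem (by simp [hn])]
    · have hz : (∑ j, (n j : ℤ) - M : ℤ) ≠ 0 := by
        intro hz; apply hn; zify; linarith
      rw [if_neg hz, Set.indicator_of_notMem (by simp [hn]), mul_zero]
  simp_rw [e2]
  rw [integral_indicator (Finset.measurableSet _), setIntegral_finset _ ?_, Finset.mul_sum]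
  refine Finset.sum_congr rfl fun n _ => ?_
  rw [measureReal_def, Measure.pi_singleton, Finset.prod_mul_distrib]
  simp only [law_singleton, ENNReal.toReal_prod, ENNReal.toReal_ofReal (h.nonneg _),
    Complex.real_smul, Complex.ofReal_prod]
  · ring
  · exact IntegrableOn.finset

end

section


/-! ### The local limit theorem -/

/-- From `1 - cos x = 2 sin²(x/2)` and subadditivity of `|sin|`. It lets decay in `t` survive a
shift of the frequency by a small `δ`, at the price of an additive `δ²`. -/
theorem one_sub_cos_add_ge (t δ : ℝ) :
    (1 - Real.cos t) / 2 - δ ^ 2 / 2 ≤ 1 - Real.cos (t + δ) := by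
  have h1 (x : ℝ) : 1 - Real.cos x = 2 * Real.sin (x / 2) ^ 2 := by
    have h2 := Real.sin_sq_add_cos_sq (x / 2)
    have h3 := Real.cos_two_mul (x / 2)
    rw [mul_div_cancel₀ x two_ne_zero] at h3
    linarith
  have h2 : |Real.sin (t / 2)| ≤ |Real.sin ((t + δ) / 2)| + |Real.sin (δ / 2)| := by
    have e : t / 2 = (t + δ) / 2 - δ / 2 := by ring
    rw [e, Real.sin_sub]
    refine (abs_sub _ _).trans ?_
    rw [abs_mul, abs_mul]
    exact add_le_add (mul_le_of_le_one_right (abs_nonneg _) (Real.abs_cos_le_one _))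
      (mul_le_of_le_one_left (abs_nonneg _) (Real.abs_cos_le_one _))
  have h3 : Real.sin (δ / 2) ^ 2 ≤ (δ / 2) ^ 2 := sq_le_sq.2 Real.abs_sin_le_abs
  have h4 : Real.sin (t / 2) ^ 2 ≤ 2 * Real.sin ((t + δ) / 2) ^ 2 + 2 * Real.sin (δ / 2) ^ 2 := by
    rw [← sq_abs (Real.sin (t / 2)), ← sq_abs (Real.sin ((t + δ) / 2)),
      ← sq_abs (Real.sin (δ / 2))]
    nlinarith [sq_nonneg (|Real.sin ((t + δ) / 2)| - |Real.sin (δ / 2)|),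
      abs_nonneg (Real.sin (t / 2))]
  rw [h1, h1]
  nlinarith

/-- Telescoping: the factors are exchanged one at a time, the others having modulus at most one. -/
theorem norm_prod_sub_prod_le {ι : Type*} (s : Finset ι) (z w : ι → ℂ) (hz : ∀ i ∈ s, ‖z i‖ ≤ 1)
    (hw : ∀ i ∈ s, ‖w i‖ ≤ 1) : ‖∏ i ∈ s, z i - ∏ i ∈ s, w i‖ ≤ ∑ i ∈ s, ‖z i - w i‖ := by
  classical
  induction s using Finset.induction_on with
  | empty => simp
  | insert i s hi ih =>
    rw [Finset.prod_insert hi, Finset.prod_insert hi, Finset.sum_insert hi]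
    have e : z i * ∏ i ∈ s, z i - w i * ∏ i ∈ s, w i
        = (z i - w i) * ∏ i ∈ s, z i + w i * (∏ i ∈ s, z i - ∏ i ∈ s, w i) := by ring
    have hp : ‖∏ i ∈ s, z i‖ ≤ 1 := by
      rw [norm_prod]
      exact Finset.prod_le_one (fun _ _ => norm_nonneg _)
        fun j hj => hz j (Finset.mem_insert_of_mem hj)
    rw [e]
    refine (norm_add_le _ _).trans (add_le_add ?_ ?_)
    · rw [norm_mul]; exact mul_le_of_le_one_right (norm_nonneg _) hp
    · rw [norm_mul]
      refine (mul_le_of_le_one_left (norm_nonneg _) (hw i (Finset.mem_insert_self _ _))).trans ?_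
      exact ih (fun j hj => hz j (Finset.mem_insert_of_mem hj))
        fun j hj => hw j (Finset.mem_insert_of_mem hj)

namespace IsLaw
variable {p : ℕ → ℝ} {m α : ℝ} (h : IsLaw p m α)
include h

theorem norm_cchar_le_one (t : ℝ) : ‖cchar p m t‖ ≤ 1 := by
  refine (h.norm_cchar_le t).trans (Real.exp_le_one_iff.2 ?_)
  have := mul_pos (h.pos 0) (h.pos 1)
  have := mul_nonneg this.le (sub_nonneg.2 (Real.cos_le_one t))
  linarith

/-- A domination uniform in the shifts: they enter only through `∑ δ j ^ 2`, which stays bounded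
when `δ j` is of order `1/√N`. A general finite set of sites is allowed so that one site can be set
apart. -/
theorem norm_prod_cchar_le {ι : Type*} (s : Finset ι) (δ : ι → ℝ) {D : ℝ}
    (hD : ∑ j ∈ s, δ j ^ 2 ≤ D) {t : ℝ} (ht : |t| ≤ Real.pi) :
    ‖∏ j ∈ s, cchar p m (t + δ j)‖ ≤
      Real.exp (p 0 * p 1 * D / 2) * Real.exp (-(p 0 * p 1 / Real.pi ^ 2 * s.card * t ^ 2)) := by
  have hκ := mul_pos (h.pos 0) (h.pos 1)
  set κ := p 0 * p 1
  rw [norm_prod, ← Real.exp_add]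
  calc ∏ j ∈ s, ‖cchar p m (t + δ j)‖ ≤ ∏ j ∈ s, Real.exp (-(κ * (1 - Real.cos (t + δ j)))) :=
        Finset.prod_le_prod (fun _ _ => norm_nonneg _) fun j _ => h.norm_cchar_le _
    _ = Real.exp (∑ j ∈ s, -(κ * (1 - Real.cos (t + δ j)))) := (Real.exp_sum _ _).symm
    _ ≤ _ := by
      refine Real.exp_le_exp.2 ?_
      have h1 : ∑ j ∈ s, -(κ * (1 - Real.cos (t + δ j)))
          ≤ ∑ j ∈ s, (κ / 2 * δ j ^ 2 + -(κ / Real.pi ^ 2 * t ^ 2)) := by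
        refine Finset.sum_le_sum fun j _ => ?_
        have h2 := one_sub_cos_add_ge t (δ j)
        have h3 := Real.cos_le_one_sub_mul_cos_sq ht
        have h4 : 1 / Real.pi ^ 2 * t ^ 2 - δ j ^ 2 / 2 ≤ 1 - Real.cos (t + δ j) := by
          have : 2 / Real.pi ^ 2 * t ^ 2 = 2 * (1 / Real.pi ^ 2 * t ^ 2) := by ring
          linarith
        have h5 := mul_le_mul_of_nonneg_left h4 hκ.le
        have e : κ * (1 / Real.pi ^ 2 * t ^ 2 - δ j ^ 2 / 2)
          = κ / Real.pi ^ 2 * t ^ 2 - κ / 2 * δ j ^ 2 := by ring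
        linarith
      refine h1.trans ?_
      rw [Finset.sum_add_distrib, ← Finset.mul_sum, Finset.sum_const, nsmul_eq_mul]
      have := mul_le_mul_of_nonneg_left hD (half_pos hκ).le
      have e : (s.card : ℝ) * -(κ / Real.pi ^ 2 * t ^ 2) = -(κ / Real.pi ^ 2 * s.card * t ^ 2) := by
        ring
      rw [e]
      linarith

/-- Each factor is replaced by the Gaussian factor `exp(-(α/2) x²/N)` with an error `o(1/N)`, and
the errors add up over `N` sites. The product of the Gaussian factors is explicit. -/
theorem tendsto_prod_cchar (x : ∀ N : ℕ, Fin N → ℝ) {C S : ℝ} (hx : ∀ N j, |x N j| ≤ C)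
    (hS : Tendsto (fun N : ℕ => (∑ j, x N j ^ 2) / N) atTop (𝓝 S)) :
    Tendsto (fun N : ℕ => ∏ j, cchar p m (x N j / √N)) atTop
      (𝓝 (Real.exp (-(α / 2 * S)) : ℝ)) := by
  have hα := h.var_pos
  have hC (N : ℕ) (j : Fin N) : 0 ≤ C := (abs_nonneg _).trans (hx N j)
  set w : ∀ N : ℕ, Fin N → ℂ := fun N j => (Real.exp (-(α / 2 * (x N j ^ 2 / N))) : ℝ)
  have hw : Tendsto (fun N : ℕ => ∏ j, w N j) atTop (𝓝 (Real.exp (-(α / 2 * S)) : ℝ)) := by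
    have e (N : ℕ) : ∏ j, w N j = (Real.exp (-(α / 2 * ((∑ j, x N j ^ 2) / N))) : ℝ) := by
      simp only [w]
      rw [← Complex.ofReal_prod, ← Real.exp_sum]
      congr 2
      rw [Finset.sum_neg_distrib, ← Finset.mul_sum, Finset.sum_div]
    simp_rw [e]
    exact (Complex.continuous_ofReal.tendsto _).comp
      ((Real.continuous_exp.tendsto _).comp ((hS.const_mul (α / 2)).neg))
  rw [← sub_zero ((Real.exp (-(α / 2 * S)) : ℝ) : ℂ)] at hw ⊢
  suffices hd : Tendsto (fun N : ℕ => ∏ j, cchar p m (x N j / √N) - ∏ j, w N j) atTop (𝓝 0) by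
    have := hd.add hw
    simpa using this
  refine Metric.tendsto_atTop.2 fun ε hε => ?_
  -- `η` is the tolerance in the Taylor expansion of `cchar`; summed over the `N` factors it costs
  -- `η C ^ 2`. The other half of `ε` pays for linearizing the exponential.
  obtain ⟨η, hη, hηC⟩ : ∃ η > 0, η * C ^ 2 < ε / 2 := by
    refine ⟨ε / 2 / (C ^ 2 + 1), by positivity, ?_⟩
    rw [div_mul_eq_mul_div, div_lt_iff₀ (by positivity)]
    nlinarith
  have ht := (Asymptotics.isLittleO_iff.1 h.cchar_taylor) hη
  obtain ⟨r, hr, hball⟩ := Metric.eventually_nhds_iff.1 ht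
  have hsq : Tendsto (fun N : ℕ => √(N : ℝ)) atTop atTop :=
    Real.tendsto_sqrt_atTop.comp tendsto_natCast_atTop_atTop
  have hlim : Tendsto (fun N : ℕ => (α / 2 * C ^ 2) ^ 2 / (N : ℝ)) atTop (𝓝 0) :=
    tendsto_const_div_atTop_nhds_zero_nat _
  have hlim2 : Tendsto (fun N : ℕ => α / 2 * C ^ 2 / (N : ℝ)) atTop (𝓝 0) :=
    tendsto_const_div_atTop_nhds_zero_nat _
  have hev : ∀ᶠ N : ℕ in atTop, C / √(N : ℝ) < r ∧ (α / 2 * C ^ 2) ^ 2 / (N : ℝ) < ε / 2 ∧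
      α / 2 * C ^ 2 / (N : ℝ) < 1 ∧ 0 < N :=
    ((hsq.const_div_atTop C).eventually_lt_const hr).and
      ((hlim.eventually_lt_const (half_pos hε)).and
        ((hlim2.eventually_lt_const one_pos).and (eventually_gt_atTop 0)))
  obtain ⟨N₀, hN₀⟩ := eventually_atTop.1 hev
  refine ⟨N₀, fun N hN => ?_⟩
  obtain ⟨h1, h2, h3, h4⟩ := hN₀ N hN
  have hNpos : (0 : ℝ) < N := by exact_mod_cast h4
  rw [dist_zero_right]
  have hterm (j : Fin N) : ‖cchar p m (x N j / √N) - w N j‖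
      ≤ (η * C ^ 2 + (α / 2 * C ^ 2) ^ 2 / N) / N := by
    have hxC : x N j ^ 2 ≤ C ^ 2 := sq_le_sq' (by linarith [neg_abs_le (x N j), hx N j])
      ((le_abs_self _).trans (hx N j))
    have hb := @hball (x N j / √N) (by
      rw [dist_zero_right, Real.norm_eq_abs, abs_div, abs_of_nonneg (Real.sqrt_nonneg _)]
      exact (div_le_div_of_nonneg_right (hx N j) (Real.sqrt_nonneg _)).trans_lt h1)
    have hdiv : (x N j / √N) ^ 2 = x N j ^ 2 / N := by
      rw [div_pow, Real.sq_sqrt hNpos.le]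
    set y := α / 2 * (x N j ^ 2 / N) with hy
    have hy0 : 0 ≤ y := by positivity
    have hyC : y ≤ α / 2 * C ^ 2 / N := by
      rw [hy, ← mul_div_assoc]; gcongr
    have hexp : |Real.exp (-y) - 1 - -y| ≤ (-y) ^ 2 :=
      Real.abs_exp_sub_one_sub_id_le (by rw [abs_neg, abs_of_nonneg hy0]; linarith)
    have hre : cchar p m (x N j / √N) - w N j =
        (cchar p m (x N j / √N) - (1 - α * ((x N j / √N : ℝ) : ℂ) ^ 2 / 2)) -
          ((Real.exp (-y) - 1 - -y : ℝ) : ℂ) := by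
      have : ((x N j / √N : ℝ) : ℂ) ^ 2 = ((x N j ^ 2 / N : ℝ) : ℂ) := by
        rw [← hdiv]; push_cast; ring
      rw [this]
      simp only [w, ← hy]
      rw [hy]
      push_cast
      ring
    rw [hre]
    refine (norm_sub_le _ _).trans ?_
    rw [add_div]
    refine add_le_add ?_ ?_
    · refine hb.trans ?_
      rw [Real.norm_of_nonneg (sq_nonneg _), hdiv, mul_div_assoc]
      gcongr
    · rw [Complex.norm_real, Real.norm_eq_abs]
      refine hexp.trans ?_
      rw [neg_sq]
      calc y ^ 2 ≤ (α / 2 * C ^ 2 / N) ^ 2 := by gcongr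
        _ = _ := by field_simp
  calc ‖∏ j, cchar p m (x N j / √N) - ∏ j, w N j‖ ≤ ∑ j, ‖cchar p m (x N j / √N) - w N j‖ :=
        norm_prod_sub_prod_le _ _ _ (fun j _ => h.norm_cchar_le_one _) fun j _ => by
          simp only [w, Complex.norm_real, Real.norm_eq_abs, Real.abs_exp]
          exact Real.exp_le_one_iff.2 (by have : 0 ≤ α / 2 * (x N j ^ 2 / N) := by positivity
                                          linarith)
    _ ≤ ∑ j : Fin N, (η * C ^ 2 + (α / 2 * C ^ 2) ^ 2 / N) / N :=
        Finset.sum_le_sum fun j _ => hterm j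
    _ = η * C ^ 2 + (α / 2 * C ^ 2) ^ 2 / N := by
        simp; field_simp
    _ < ε := by linarith

end IsLaw

/-- The sum of `f` over the configurations with `M` particles, with weights `∏ p (n j)`. -/
def wsum (p : ℕ → ℝ) {N : ℕ} (M : ℕ) (f : (Fin N → ℕ) → ℂ) : ℂ :=
  ∑ n ∈ Finset.piAntidiag (Finset.univ : Finset (Fin N)) M, ((∏ j, p (n j) : ℝ) : ℂ) * f n

/-- The character `n ↦ exp (i ∑ θ_j (n_j - m))`. -/
def chr (m : ℝ) {N : ℕ} (θ : Fin N → ℝ) (n : Fin N → ℕ) : ℂ :=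
  Complex.exp (Complex.I * ((∑ j, θ j * ((n j : ℝ) - m) : ℝ) : ℂ))

theorem norm_chr (m : ℝ) {N : ℕ} (θ : Fin N → ℝ) (n : Fin N → ℕ) : ‖chr m θ n‖ = 1 :=
  Complex.norm_exp_I_mul_ofReal _

theorem chr_eq_prod (m : ℝ) {N : ℕ} (θ : Fin N → ℝ) (n : Fin N → ℕ) :
    chr m θ n = ∏ j, Complex.exp (Complex.I * ((θ j * ((n j : ℝ) - m) : ℝ) : ℂ)) := by
  rw [chr, ← Complex.exp_sum, ← Finset.mul_sum, Complex.ofReal_sum]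

namespace IsLaw
variable {p : ℕ → ℝ} {m α : ℝ} (h : IsLaw p m α)
include h

/-- Centring each site produces a phase `exp(itm)`; the `N` phases combine with `exp(-itM)`, leaving
only the deviation `M - N m`. -/
theorem wsum_chr {N : ℕ} (M : ℕ) (θ : Fin N → ℝ) :
    2 * Real.pi * wsum p M (chr m θ) = ∫ t in (-Real.pi)..Real.pi,
      (∏ j, cchar p m (t + θ j)) * Complex.exp (-(Complex.I * ((t * (M - N * m) : ℝ) : ℂ))) := by
  have h1 := fourier_piAntidiag h M
    (fun (j : Fin N) (k : ℕ) => Complex.exp (Complex.I * ((θ j * ((k : ℝ) - m) : ℝ) : ℂ)))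
    (fun j => by
      rw [integrable_law h.nonneg]
      simpa only [Complex.norm_exp_I_mul_ofReal, one_mul] using h.hasSum_one.summable)
  have e : wsum p M (chr m θ) = ∑ n ∈ Finset.piAntidiag (Finset.univ : Finset (Fin N)) M,
      ∏ j, ((p (n j) : ℂ) * Complex.exp (Complex.I * ((θ j * ((n j : ℝ) - m) : ℝ) : ℂ))) := by
    refine Finset.sum_congr rfl fun n _ => ?_
    rw [chr_eq_prod, Finset.prod_mul_distrib, Complex.ofReal_prod]
  rw [e, ← h1]
  congr 1
  ext t
  have e2 (j : Fin N) : ∫ k, Complex.exp (Complex.I * ((θ j * ((k : ℝ) - m) : ℝ) : ℂ)) *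
      Complex.exp (Complex.I * ((t * k : ℝ) : ℂ)) ∂(law p)
      = Complex.exp (Complex.I * ((t * m : ℝ) : ℂ)) * cchar p m (t + θ j) := by
    rw [cchar, ← integral_const_mul]
    congr 1
    ext k
    rw [← Complex.exp_add, ← Complex.exp_add]
    congr 1
    push_cast
    ring
  simp_rw [e2]
  rw [Finset.prod_mul_distrib, Finset.prod_const, ← Complex.exp_nat_mul, mul_comm (Complex.exp _),
    mul_assoc, ← Complex.exp_add]
  congr 2
  simp
  ring

/-- After the substitution `t = s/√N` the integrand tends to `exp(-(α/2)(s² + 2As + B))`, the limit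
of the product at frequencies `s + θ_j`. Integrating over `s`, that is imposing the constraint,
completes the square and turns `B` into `B - A²`. -/
theorem local_limit (M : ℕ → ℕ)
    (hM : Tendsto (fun N : ℕ => ((M N : ℝ) - N * m) / √N) atTop (𝓝 0))
    (θ : ∀ N : ℕ, Fin N → ℝ) {C A B : ℝ} (hθ : ∀ N j, |θ N j| ≤ C)
    (hA : Tendsto (fun N : ℕ => (∑ j, θ N j) / N) atTop (𝓝 A))
    (hB : Tendsto (fun N : ℕ => (∑ j, θ N j ^ 2) / N) atTop (𝓝 B)) :
    Tendsto (fun N : ℕ => (√N : ℂ) * wsum p (M N) (chr m fun j => θ N j / √N)) atTop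
      (𝓝 (((2 * Real.pi)⁻¹ * √(2 * Real.pi / α) * Real.exp (-(α / 2 * (B - A ^ 2))) : ℝ) : ℂ)) := by
  have hα := h.var_pos
  have hκ := mul_pos (h.pos 0) (h.pos 1)
  set κ := p 0 * p 1 with hκdef
  -- The rescaled integrand extended by zero, so that dominated convergence takes place on the whole
  -- line.
  set G : ℕ → ℝ → ℂ := fun N => Set.indicator (Set.Ioc (-Real.pi * √N) (Real.pi * √N)) fun s =>
    (∏ j, cchar p m ((s + θ N j) / √N)) *
      Complex.exp (-(Complex.I * ((s * (((M N : ℝ) - N * m) / √N) : ℝ) : ℂ))) with hG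
  have hG1 : ∀ᶠ N : ℕ in atTop, (((2 * Real.pi)⁻¹ : ℝ) : ℂ) * ∫ s, G N s =
      (√N : ℂ) * wsum p (M N) (chr m fun j => θ N j / √N) := by
    filter_upwards [eventually_gt_atTop 0] with N hN
    have hNpos : (0 : ℝ) < N := by exact_mod_cast hN
    have hsq : 0 < √(N : ℝ) := Real.sqrt_pos.2 hNpos
    have h1 := h.wsum_chr (M N) fun j => θ N j / √N
    have h2 := intervalIntegral.integral_comp_div (a := -Real.pi * √N) (b := Real.pi * √N)
      (fun t : ℝ => (∏ j, cchar p m (t + θ N j / √N)) *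
        Complex.exp (-(Complex.I * ((t * (M N - N * m) : ℝ) : ℂ)))) hsq.ne'
    rw [mul_div_cancel_right₀ _ hsq.ne', mul_div_cancel_right₀ _ hsq.ne', ← h1] at h2
    rw [hG, integral_indicator measurableSet_Ioc, ← intervalIntegral.integral_of_le]
    · have e : (fun s : ℝ => (∏ j, cchar p m ((s + θ N j) / √N)) *
          Complex.exp (-(Complex.I * ((s * (((M N : ℝ) - N * m) / √N) : ℝ) : ℂ)))) =
          fun s : ℝ => (∏ j, cchar p m (s / √N + θ N j / √N)) *
          Complex.exp (-(Complex.I * ((s / √N * ((M N : ℝ) - N * m) : ℝ) : ℂ))) := by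
        ext s
        simp_rw [← add_div]
        rw [mul_div_assoc', div_mul_eq_mul_div]
      rw [e, h2, Complex.real_smul]
      have hpi : (Real.pi : ℂ) ≠ 0 := by simp [Real.pi_ne_zero]
      push_cast
      field_simp
    · nlinarith [Real.pi_pos]
  refine Tendsto.congr' hG1 ?_
  -- Completion of the square and translation by `A`.
  have hlimval : ((2 * Real.pi)⁻¹ * √(2 * Real.pi / α) * Real.exp (-(α / 2 * (B - A ^ 2))) : ℝ)
      = (2 * Real.pi)⁻¹ * ∫ s : ℝ, Real.exp (-(α / 2 * (s ^ 2 + 2 * A * s + B))) := by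
    have e : ∀ s : ℝ, Real.exp (-(α / 2 * (s ^ 2 + 2 * A * s + B))) =
        Real.exp (-(α / 2) * (s + A) ^ 2) * Real.exp (-(α / 2 * (B - A ^ 2))) := fun s => by
      rw [← Real.exp_add]; congr 1; ring
    simp_rw [e]
    rw [integral_mul_const, integral_add_right_eq_self (fun s : ℝ => Real.exp (-(α / 2) * s ^ 2)) A,
      integral_gaussian]
    have : Real.pi / (α / 2) = 2 * Real.pi / α := by field_simp
    rw [this]; ring
  rw [hlimval, Complex.ofReal_mul, ← integral_complex_ofReal]
  refine Tendsto.const_mul _ ?_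
  refine tendsto_integral_of_dominated_convergence
    (fun s => Real.exp (κ * C ^ 2 / 2) * Real.exp (-(κ / Real.pi ^ 2) * s ^ 2)) ?_ ?_ ?_ ?_
  · intro N
    refine AEStronglyMeasurable.indicator ?_ measurableSet_Ioc
    refine Continuous.aestronglyMeasurable ?_
    have := h.continuous_cchar
    refine Continuous.mul (continuous_finsetProd _ fun j _ => this.comp ?_) ?_
    · fun_prop
    · fun_prop
  · exact (integrable_exp_neg_mul_sq (by positivity)).const_mul _
  · intro N
    refine ae_of_all _ fun s => ?_
    by_cases hs : s ∈ Set.Ioc (-Real.pi * √N) (Real.pi * √N)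
    swap
    · simp only [hG, Set.indicator_of_notMem hs, norm_zero]
      positivity
    -- For `N = 0` the interval is empty and contains no `s`.
    have hsq : 0 < √(N : ℝ) := by
      by_contra hcon
      have h0 : √(N : ℝ) = 0 := le_antisymm (not_lt.1 hcon) (Real.sqrt_nonneg _)
      simp [h0] at hs
    have hNpos : (0 : ℝ) < N := Real.sqrt_pos.1 hsq
    simp only [hG, Set.indicator_of_mem hs, norm_mul]
    have e1 : ‖Complex.exp (-(Complex.I * ((s * (((M N : ℝ) - N * m) / √N) : ℝ) : ℂ)))‖ = 1 := by
      rw [← mul_neg, ← Complex.ofReal_neg, Complex.norm_exp_I_mul_ofReal]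
    rw [e1, mul_one]
    have ht : |s / √N| ≤ Real.pi := by
      rw [abs_div, abs_of_pos hsq, div_le_iff₀ hsq]
      exact abs_le.2 ⟨by linarith [hs.1], hs.2⟩
    have hD : ∑ j, (θ N j / √N) ^ 2 ≤ C ^ 2 := by
      calc ∑ j, (θ N j / √N) ^ 2 ≤ ∑ j : Fin N, C ^ 2 / N := by
            refine Finset.sum_le_sum fun j _ => ?_
            rw [div_pow, Real.sq_sqrt hNpos.le]
            have : θ N j ^ 2 ≤ C ^ 2 := sq_le_sq' (by linarith [neg_abs_le (θ N j), hθ N j])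
              ((le_abs_self _).trans (hθ N j))
            gcongr
        _ = C ^ 2 := by simp; field_simp
    have := h.norm_prod_cchar_le Finset.univ (fun j => θ N j / √N) hD ht
    simp_rw [← add_div] at this
    refine this.trans (le_of_eq ?_)
    rw [Finset.card_univ, Fintype.card_fin, div_pow, Real.sq_sqrt hNpos.le]
    congr 2
    rw [hκdef]
    field_simp
  · refine ae_of_all _ fun s => ?_
    have hev : ∀ᶠ N : ℕ in atTop, (∏ j, cchar p m ((s + θ N j) / √N)) *
        Complex.exp (-(Complex.I * ((s * (((M N : ℝ) - N * m) / √N) : ℝ) : ℂ))) = G N s := by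
      have hsq : Tendsto (fun N : ℕ => Real.pi * √(N : ℝ)) atTop atTop :=
        (Real.tendsto_sqrt_atTop.comp tendsto_natCast_atTop_atTop).const_mul_atTop Real.pi_pos
      filter_upwards [hsq.eventually_gt_atTop |s|] with N hN
      have hs : s ∈ Set.Ioc (-Real.pi * √N) (Real.pi * √N) :=
        ⟨by linarith [neg_abs_le s], ((le_abs_self s).trans_lt hN).le⟩
      simp only [hG, Set.indicator_of_mem hs]
    refine Tendsto.congr' hev ?_
    have h1 : Tendsto (fun N : ℕ => (∑ j, (s + θ N j) ^ 2) / N) atTop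
        (𝓝 (s ^ 2 + 2 * A * s + B)) := by
      have h2 := ((hA.const_mul (2 * s)).const_add (s ^ 2)).add hB
      have e : s ^ 2 + 2 * s * A + B = s ^ 2 + 2 * A * s + B := by ring
      rw [e] at h2
      refine h2.congr' ?_
      filter_upwards [eventually_gt_atTop 0] with N hN
      have hNpos : (N : ℝ) ≠ 0 := by positivity
      have e2 : ∑ j, (s + θ N j) ^ 2 = N * s ^ 2 + 2 * s * ∑ j, θ N j + ∑ j, θ N j ^ 2 := by
        simp_rw [add_sq]
        rw [Finset.sum_add_distrib, Finset.sum_add_distrib, Finset.mul_sum]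
        simp
      rw [e2]
      field_simp
    have h3 := h.tendsto_prod_cchar (fun N j => s + θ N j) (C := |s| + C)
      (fun N j => (abs_add_le _ _).trans (add_le_add le_rfl (hθ N j))) h1
    have h4 : Tendsto (fun N : ℕ =>
        Complex.exp (-(Complex.I * ((s * (((M N : ℝ) - N * m) / √N) : ℝ) : ℂ)))) atTop (𝓝 1) := by
      have hc : Continuous fun x : ℝ => Complex.exp (-(Complex.I * ((s * x : ℝ) : ℂ))) := by fun_prop
      simpa only [Function.comp_def, mul_zero, Complex.ofReal_zero, neg_zero, Complex.exp_zero]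
        using (hc.tendsto 0).comp hM
    simpa using h3.mul h4

/-- In the Fourier integral the factor of site `i` is bounded by `∑ g p`, and the `N - 1` others
give a Gaussian of width `1/√N`. Dividing by the total mass, also of order `1/√N`, will bound
one-site moments uniformly in `N`. -/
theorem wsum_coord_le {N : ℕ} (M : ℕ) (i : Fin N) {g : ℕ → ℝ} (hg : ∀ k, 0 ≤ g k)
    (hgs : Summable fun k => g k * p k) (hN : 2 ≤ N) :
    ∑ n ∈ Finset.piAntidiag (Finset.univ : Finset (Fin N)) M, (∏ j, p (n j)) * g (n i)
      ≤ √(Real.pi / (p 0 * p 1 / Real.pi ^ 2)) / √N * (∑' k, g k * p k) := by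
  classical
  have hκ := mul_pos (h.pos 0) (h.pos 1)
  set κ := p 0 * p 1
  have hNpos : (0 : ℝ) < N := by positivity
  have hgi : Integrable (fun k => (g k : ℂ)) (law p) := by
    rw [integrable_law h.nonneg]
    simpa [abs_of_nonneg (hg _)] using hgs
  have h1i : Integrable (fun _ : ℕ => (1 : ℂ)) (law p) := by
    rw [integrable_law h.nonneg]
    simpa using h.hasSum_one.summable
  have key := fourier_piAntidiag h M (fun (j : Fin N) (k : ℕ) => if j = i then (g k : ℂ) else 1)
    (fun j => by by_cases hj : j = i <;> simp [hj, hgi, h1i])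
  have hG : ∀ t : ℝ, ‖∫ k, (g k : ℂ) * Complex.exp (Complex.I * ((t * k : ℝ) : ℂ)) ∂(law p)‖
      ≤ ∑' k, g k * p k := by
    intro t
    refine (norm_integral_le_integral_norm _).trans (le_of_eq ?_)
    simp only [norm_mul, Complex.norm_exp_I_mul_ofReal, mul_one, Complex.norm_real,
      Real.norm_of_nonneg (hg _)]
    rw [integral_law h.nonneg (by rw [integrable_law h.nonneg]; simpa [abs_of_nonneg (hg _)] using hgs)]
    simp [mul_comm]
  have hchar : ∀ t : ℝ, ‖∫ k, (1 : ℂ) * Complex.exp (Complex.I * ((t * (k : ℕ) : ℝ) : ℂ)) ∂(law p)‖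
      = ‖cchar p m (t + 0)‖ := by
    intro t
    have e : ∀ k : ℕ, (1 : ℂ) * Complex.exp (Complex.I * ((t * k : ℝ) : ℂ)) =
      Complex.exp (Complex.I * ((t * m : ℝ) : ℂ)) *
        Complex.exp (Complex.I * ((t * (k - m) : ℝ) : ℂ)) := fun k => by
      rw [one_mul, ← Complex.exp_add]; congr 1; push_cast; ring
    simp_rw [e]
    rw [integral_const_mul, norm_mul, Complex.norm_exp_I_mul_ofReal, one_mul, add_zero, cchar]
  have e1 : ((∑ n ∈ Finset.piAntidiag (Finset.univ : Finset (Fin N)) M,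
      (∏ j, p (n j)) * g (n i) : ℝ) : ℂ) = ∑ n ∈ Finset.piAntidiag (Finset.univ : Finset (Fin N)) M,
          ∏ j, ((p (n j) : ℂ) * if j = i then (g (n j) : ℂ) else 1) := by
    rw [Complex.ofReal_sum]
    refine Finset.sum_congr rfl fun n _ => ?_
    rw [Finset.prod_mul_distrib, Finset.prod_ite_eq' Finset.univ i]
    simp
  rw [← e1] at key
  have hnn : 0 ≤ ∑ n ∈ Finset.piAntidiag (Finset.univ : Finset (Fin N)) M,
      (∏ j, p (n j)) * g (n i) :=
    Finset.sum_nonneg fun n _ => mul_nonneg (Finset.prod_nonneg fun _ _ => h.nonneg _) (hg _)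
  have hs0 : 0 ≤ ∑' k, g k * p k := tsum_nonneg fun k => mul_nonneg (hg k) (h.nonneg k)
  have hb : ‖∫ t in (-Real.pi)..Real.pi, (∏ j, ∫ k, (if j = i then (g k : ℂ) else 1) *
      Complex.exp (Complex.I * ((t * k : ℝ) : ℂ)) ∂(law p)) *
        Complex.exp (-(Complex.I * ((t * M : ℝ) : ℂ)))‖ ≤
      ∫ t in (-Real.pi)..Real.pi, (∑' k, g k * p k) *
        Real.exp (-(κ / Real.pi ^ 2 * ((N - 1 : ℕ) : ℝ)) * t ^ 2) := by
    refine intervalIntegral.norm_integral_le_of_norm_le (by linarith [Real.pi_pos]) ?_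
      (Continuous.intervalIntegrable (by fun_prop) _ _)
    refine ae_of_all _ fun t ht => ?_
    have e1 : ‖Complex.exp (-(Complex.I * ((t * M : ℝ) : ℂ)))‖ = 1 := by
      rw [← mul_neg, ← Complex.ofReal_neg, Complex.norm_exp_I_mul_ofReal]
    rw [norm_mul, e1, mul_one, ← Finset.mul_prod_erase _ _ (Finset.mem_univ i), norm_mul]
    refine mul_le_mul (by simpa using hG t) ?_ (norm_nonneg _) hs0
    have hp := h.norm_prod_cchar_le (Finset.univ.erase i) (fun _ => 0) (D := 0) (by simp)
      (t := t) (abs_le.2 ⟨ht.1.le, ht.2⟩)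
    have hc : (Finset.univ.erase i).card = N - 1 := by
      rw [Finset.card_erase_of_mem (Finset.mem_univ i)]; simp
    rw [hc] at hp
    calc _ = ‖∏ j ∈ Finset.univ.erase i, cchar p m (t + 0)‖ := by
          rw [norm_prod, norm_prod]
          refine Finset.prod_congr rfl fun j hj => ?_
          rw [← hchar]
          simp [Finset.ne_of_mem_erase hj]
      _ ≤ _ := hp
      _ = _ := by simp [κ]
  rw [key, intervalIntegral.integral_const_mul] at hb
  -- Replacing the `N - 1` remaining sites by `N/2` costs a factor at most 2 after the square root;
  -- it is absorbed at the end by the factor `2π` of the Fourier formula.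
  have hN1 : (N : ℝ) / 2 ≤ ((N - 1 : ℕ) : ℝ) := by
    rw [Nat.cast_sub (by omega)]
    have : (2 : ℝ) ≤ N := by exact_mod_cast hN
    push_cast; linarith
  have hcpos : 0 < κ / Real.pi ^ 2 * ((N - 1 : ℕ) : ℝ) := by
    have : (0 : ℝ) < ((N - 1 : ℕ) : ℝ) := by linarith [half_pos hNpos]
    positivity
  have hgauss : ∫ t in (-Real.pi)..Real.pi,
      Real.exp (-(κ / Real.pi ^ 2 * ((N - 1 : ℕ) : ℝ)) * t ^ 2) ≤
      √(Real.pi / (κ / Real.pi ^ 2 * ((N - 1 : ℕ) : ℝ))) := by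
    rw [← integral_gaussian, intervalIntegral.integral_of_le (by linarith [Real.pi_pos])]
    exact setIntegral_le_integral (integrable_exp_neg_mul_sq hcpos)
      (ae_of_all _ fun _ => (Real.exp_pos _).le)
  have hgauss2 : √(Real.pi / (κ / Real.pi ^ 2 * ((N - 1 : ℕ) : ℝ))) ≤
      2 * (√(Real.pi / (κ / Real.pi ^ 2)) / √N) := by
    have e4 : (2 : ℝ) = √4 := by
      rw [show (4 : ℝ) = 2 ^ 2 by norm_num, Real.sqrt_sq (by norm_num)]
    rw [← Real.sqrt_div (by positivity), e4, ← Real.sqrt_mul (by norm_num)]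
    refine Real.sqrt_le_sqrt ?_
    calc Real.pi / (κ / Real.pi ^ 2 * ((N - 1 : ℕ) : ℝ)) ≤ Real.pi / (κ / Real.pi ^ 2 * (N / 2)) := by
          gcongr
      _ = 2 * (Real.pi / (κ / Real.pi ^ 2) / N) := by field_simp
      _ ≤ _ := by gcongr; norm_num
  rw [norm_mul, Complex.norm_real, Real.norm_of_nonneg hnn] at hb
  have hpi : ‖(2 * (Real.pi : ℂ))‖ = 2 * Real.pi := by
    rw [norm_mul, Complex.norm_real, Real.norm_of_nonneg Real.pi_pos.le]; simp
  rw [hpi] at hb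
  have hfin := hb.trans (mul_le_mul_of_nonneg_left (hgauss.trans hgauss2) hs0)
  have hpi1 : 1 ≤ Real.pi := by linarith [Real.pi_gt_three]
  nlinarith [mul_le_mul_of_nonneg_right hpi1 hnn]

end IsLaw

end

section


/-! ### The canonical measures -/

/-- The total weight of the configurations on `N` sites with `M` particles. -/
def mass (p : ℕ → ℝ) (N M : ℕ) : ℝ :=
  ∑ n ∈ Finset.piAntidiag (Finset.univ : Finset (Fin N)) M, ∏ j, p (n j)

/-- The product law `∏ p` on configurations on `N` sites conditioned to have `M` particles. -/
def canon (p : ℕ → ℝ) (N M : ℕ) : Measure (Fin N → ℕ) :=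
  ∑ n ∈ Finset.piAntidiag (Finset.univ : Finset (Fin N)) M,
    ENNReal.ofReal ((∏ j, p (n j)) / mass p N M) • Measure.dirac n

theorem piAntidiag_nonempty {N : ℕ} (M : ℕ) (h : 0 < N ∨ M = 0) :
    (Finset.piAntidiag (Finset.univ : Finset (Fin N)) M).Nonempty := by
  rcases h with h | rfl
  · refine ⟨Pi.single ⟨0, h⟩ M, ?_⟩
    simp
  · exact ⟨0, by simp⟩

section
variable {p : ℕ → ℝ} (hp : ∀ k, 0 < p k)
include hp

theorem mass_pos {N M : ℕ} (h : 0 < N ∨ M = 0) : 0 < mass p N M :=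
  Finset.sum_pos (fun _ _ => Finset.prod_pos fun _ _ => hp _) (piAntidiag_nonempty M h)

theorem mass_nonneg (N M : ℕ) : 0 ≤ mass p N M :=
  Finset.sum_nonneg fun _ _ => Finset.prod_nonneg fun _ _ => (hp _).le

theorem weight_nonneg {N : ℕ} (M : ℕ) (n : Fin N → ℕ) : 0 ≤ (∏ j, p (n j)) / mass p N M :=
  div_nonneg (Finset.prod_nonneg fun _ _ => (hp _).le) (mass_nonneg hp N M)

omit hp in
theorem integrable_canon (p : ℕ → ℝ) {F : Type*} [NormedAddCommGroup F] (N M : ℕ)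
    (f : (Fin N → ℕ) → F) : Integrable f (canon p N M) := by
  refine integrable_finsetSum_measure.2 fun n _ => ?_
  exact (integrable_dirac (by simp)).smul_measure ENNReal.ofReal_ne_top

theorem integral_canon {F : Type*} [NormedAddCommGroup F] [NormedSpace ℝ F] [CompleteSpace F]
    (N M : ℕ) (f : (Fin N → ℕ) → F) :
    ∫ n, f n ∂(canon p N M) = ∑ n ∈ Finset.piAntidiag (Finset.univ : Finset (Fin N)) M,
      ((∏ j, p (n j)) / mass p N M) • f n := by
  rw [canon, integral_finsetSum_measure fun n _ =>
    (integrable_dirac (by simp)).smul_measure ENNReal.ofReal_ne_top]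
  refine Finset.sum_congr rfl fun n _ => ?_
  rw [integral_smul_measure, integral_dirac, ENNReal.toReal_ofReal (weight_nonneg hp M n)]

theorem isProbabilityMeasure_canon {N M : ℕ} (h : 0 < N ∨ M = 0) :
    IsProbabilityMeasure (canon p N M) := by
  constructor
  rw [canon]
  simp only [Measure.coe_finsetSum, Finset.sum_apply, Measure.smul_apply, measure_univ,
    smul_eq_mul, mul_one]
  rw [← ENNReal.ofReal_sum_of_nonneg fun n _ => weight_nonneg hp M n, ← Finset.sum_div]
  change ENNReal.ofReal (mass p N M / mass p N M) = 1
  rw [div_self (mass_pos hp h).ne', ENNReal.ofReal_one]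

omit hp in
theorem ae_canon {p : ℕ → ℝ} {N M : ℕ} : ∀ᵐ n ∂(canon p N M), ∑ j, n j = M := by
  rw [canon, ae_iff]
  simp only [Measure.coe_finsetSum, Finset.sum_apply, Measure.smul_apply, smul_eq_mul]
  refine Finset.sum_eq_zero fun n hn => ?_
  have : ∑ j, n j = M := by simpa using hn
  rw [Measure.dirac_apply]
  simp [this]

theorem integral_canon_eq_wsum (N M : ℕ) (f : (Fin N → ℕ) → ℂ) :
    ∫ n, f n ∂(canon p N M) = wsum p M f / mass p N M := by
  rw [integral_canon hp, wsum, Finset.sum_div]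
  refine Finset.sum_congr rfl fun n _ => ?_
  rw [Complex.real_smul]; push_cast; ring

theorem integral_canon_comp_perm {F : Type*} [NormedAddCommGroup F] [NormedSpace ℝ F]
    [CompleteSpace F] (N M : ℕ) (σ : Equiv.Perm (Fin N)) (f : (Fin N → ℕ) → F) :
    ∫ n, f (n ∘ σ) ∂(canon p N M) = ∫ n, f n ∂(canon p N M) := by
  rw [integral_canon hp, integral_canon hp]
  refine Finset.sum_equiv (Equiv.arrowCongr σ.symm (Equiv.refl ℕ)) (fun n => ?_) fun n _ => ?_
  · simp [Equiv.arrowCongr, Equiv.sum_comp σ n]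
  · have : (Equiv.arrowCongr σ.symm (Equiv.refl ℕ)) n = n ∘ σ := by ext; simp [Equiv.arrowCongr]
    rw [this]
    congr 2
    exact (Equiv.prod_comp σ fun j => p (n j)).symm

/-- By exchangeability, only one diagonal and one off-diagonal moment occur in the expansion of the
square. -/
theorem integral_sq_sum_canon {N M : ℕ} (g : ℕ → ℝ) (i₀ i₁ : Fin N) (hi : i₀ ≠ i₁)
    (z : Fin N → ℝ) :
    ∫ n, (∑ k, z k * g (n k)) ^ 2 ∂(canon p N M) =
      (∫ n, g (n i₀) * g (n i₁) ∂(canon p N M)) * (∑ k, z k) ^ 2 +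
      ((∫ n, g (n i₀) ^ 2 ∂(canon p N M)) - ∫ n, g (n i₀) * g (n i₁) ∂(canon p N M)) *
        ∑ k, z k ^ 2 := by
  set e₁ := ∫ n, g (n i₀) ^ 2 ∂(canon p N M)
  set e₂ := ∫ n, g (n i₀) * g (n i₁) ∂(canon p N M)
  have h1 (k : Fin N) : ∫ n, g (n k) * g (n k) ∂(canon p N M) = e₁ := by
    have := integral_canon_comp_perm hp N M (Equiv.swap i₀ k) fun n => g (n i₀) ^ 2
    simp only [Function.comp_apply, Equiv.swap_apply_left] at this
    simp only [e₁, ← this, sq]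
  have h2 (k l : Fin N) (hkl : k ≠ l) : ∫ n, g (n k) * g (n l) ∂(canon p N M) = e₂ := by
    obtain ⟨σ, h0, h1⟩ : ∃ σ : Equiv.Perm (Fin N), σ i₀ = k ∧ σ i₁ = l := by
      -- The first transposition sends `i₀` to `k`; the second carries the image of `i₁` to `l` and
      -- fixes `k`, which differs from both.
      refine ⟨(Equiv.swap i₀ k).trans (Equiv.swap (Equiv.swap i₀ k i₁) l), ?_, ?_⟩
      · simp only [Equiv.trans_apply, Equiv.swap_apply_left]
        refine Equiv.swap_apply_of_ne_of_ne (fun h => ?_) hkl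
        rw [← Equiv.swap_apply_left i₀ k] at h
        exact hi ((Equiv.injective _) (h.trans (by simp)))
      · simp
    have := integral_canon_comp_perm hp N M σ fun n => g (n i₀) * g (n i₁)
    simpa [h0, h1] using this
  have e : ∀ n : Fin N → ℕ, (∑ k, z k * g (n k)) ^ 2 =
      ∑ k, ∑ l, z k * z l * (g (n k) * g (n l)) := fun n => by
    rw [sq, Finset.sum_mul_sum]
    exact Finset.sum_congr rfl fun k _ => Finset.sum_congr rfl fun l _ => by ring
  simp_rw [e]
  rw [integral_finsetSum _ fun _ _ => integrable_canon p N M _]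
  have h3 (k : Fin N) : ∫ n, ∑ l, z k * z l * (g (n k) * g (n l)) ∂(canon p N M) =
      e₂ * (z k * ∑ l, z l) + (e₁ - e₂) * z k ^ 2 := by
    rw [integral_finsetSum _ fun _ _ => integrable_canon p N M _]
    have h4 (l : Fin N) : ∫ n, z k * z l * (g (n k) * g (n l)) ∂(canon p N M) =
        e₂ * (z k * z l) + if l = k then (e₁ - e₂) * z k ^ 2 else 0 := by
      rw [integral_const_mul]
      split_ifs with h
      · rw [h, h1]; ring
      · rw [h2 k l (Ne.symm h)]; ring
    simp_rw [h4]
    rw [Finset.sum_add_distrib, Finset.mul_sum, Finset.mul_sum]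
    simp
  simp_rw [h3]
  rw [Finset.sum_add_distrib, ← Finset.mul_sum, ← Finset.sum_mul, ← Finset.mul_sum, sq]

theorem abs_integral_mul_canon_le {N M : ℕ} (g : ℕ → ℝ) (i₀ i₁ : Fin N) :
    |∫ n, g (n i₀) * g (n i₁) ∂(canon p N M)| ≤ ∫ n, g (n i₀) ^ 2 ∂(canon p N M) := by
  have hsym : ∫ n, g (n i₁) ^ 2 ∂(canon p N M) = ∫ n, g (n i₀) ^ 2 ∂(canon p N M) := by
    have := integral_canon_comp_perm hp N M (Equiv.swap i₀ i₁) fun n => g (n i₀) ^ 2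
    simpa using this
  refine (abs_integral_le_integral_abs).trans ?_
  have : ∫ n, |g (n i₀) * g (n i₁)| ∂(canon p N M) ≤
      ∫ n, (g (n i₀) ^ 2 / 2 + g (n i₁) ^ 2 / 2) ∂(canon p N M) := by
    refine integral_mono (integrable_canon p N M _) (integrable_canon p N M _) fun n => ?_
    simp only [abs_mul]
    nlinarith [sq_nonneg (|g (n i₀)| - |g (n i₁)|), sq_abs (g (n i₀)), sq_abs (g (n i₁))]
  refine this.trans (le_of_eq ?_)
  rw [integral_add (integrable_canon p N M _) (integrable_canon p N M _), integral_div,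
    integral_div, hsym]
  ring

/-- Second moment of a linear statistic of an exchangeable family. -/
theorem integral_sq_sum_canon_le {N M : ℕ} (hN : 2 ≤ N) (g : ℕ → ℝ) {e : ℝ}
    (he : ∀ i, ∫ n, g (n i) ^ 2 ∂(canon p N M) ≤ e) (z : Fin N → ℝ) :
    ∫ n, (∑ k, z k * g (n k)) ^ 2 ∂(canon p N M) ≤ e * ((∑ k, z k) ^ 2 + 2 * ∑ k, z k ^ 2) := by
  have hi : (⟨0, by omega⟩ : Fin N) ≠ ⟨1, by omega⟩ := by simp
  set i₀ : Fin N := ⟨0, by omega⟩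
  set i₁ : Fin N := ⟨1, by omega⟩
  rw [integral_sq_sum_canon hp g i₀ i₁ hi]
  have h1 := abs_le.1 (abs_integral_mul_canon_le hp (M := M) g i₀ i₁)
  have h2 := he i₀
  have h3 : 0 ≤ ∑ k, z k ^ 2 := Finset.sum_nonneg fun _ _ => sq_nonneg _
  have h4 := sq_nonneg (∑ k, z k)
  nlinarith [mul_le_mul_of_nonneg_right (h1.2.trans h2) h4, mul_le_mul_of_nonneg_right h2 h3,
    mul_le_mul_of_nonneg_right h1.1 h3]

/-- Second moment of a linear statistic of the centered occupation numbers. -/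
theorem integral_sq_sum_centered_canon_le {N M : ℕ} (hN : 2 ≤ N) {m e : ℝ}
    (hM : |(M : ℝ) - N * m| ≤ 1)
    (he : ∀ i, ∫ n, ((n i : ℝ) - m) ^ 2 ∂(canon p N M) ≤ e) (z : Fin N → ℝ) :
    ∫ n, (∑ k, z k * ((n k : ℝ) - m)) ^ 2 ∂(canon p N M) ≤ (8 * e + 10) * ∑ k, z k ^ 2 := by
  have hprob := isProbabilityMeasure_canon hp (M := M) (Or.inl (by omega : 0 < N))
  have hNpos : (0 : ℝ) < N := by positivity
  have hN2 : (2 : ℝ) ≤ N := by exact_mod_cast hN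
  -- Centring at the exact density `M/N` makes the sum of the centred occupation numbers vanish
  -- identically; the price is a shift of at most `1/N`.
  set b : ℝ := M / N with hb
  have hi : (⟨0, by omega⟩ : Fin N) ≠ ⟨1, by omega⟩ := by simp
  set i₀ : Fin N := ⟨0, by omega⟩
  set i₁ : Fin N := ⟨1, by omega⟩
  have hbm : (b - m) ^ 2 ≤ 1 / N ^ 2 := by
    have : b - m = (M - N * m) / N := by rw [hb]; field_simp
    rw [this, div_pow]
    gcongr
    rw [← sq_abs]
    nlinarith [abs_nonneg ((M : ℝ) - N * m)]
  have hbm1 : (b - m) ^ 2 ≤ 1 := hbm.trans (by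
    rw [div_le_one (by positivity)]; nlinarith)
  have key := integral_sq_sum_canon hp (M := M) (fun k => (k : ℝ) - b) i₀ i₁ hi
  set e₁ := ∫ n, ((n i₀ : ℝ) - b) ^ 2 ∂(canon p N M)
  set e₂ := ∫ n, ((n i₀ : ℝ) - b) * ((n i₁ : ℝ) - b) ∂(canon p N M)
  have he1 : e₁ ≤ 2 * e + 2 := by
    calc e₁ ≤ ∫ n, (2 * ((n i₀ : ℝ) - m) ^ 2 + 2 * (b - m) ^ 2) ∂(canon p N M) := by
          refine integral_mono (integrable_canon p N M _) (integrable_canon p N M _) fun n => ?_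
          simp only
          nlinarith [sq_nonneg (((n i₀ : ℝ) - m) + (b - m))]
      _ ≤ _ := by
          rw [integral_add (integrable_canon p N M _) (integrable_canon p N M _),
            integral_const_mul, integral_const]
          have := he i₀
          simp only [probReal_univ, one_smul]
          linarith
  have he10 : 0 ≤ e₁ := integral_nonneg fun n => sq_nonneg _
  -- Constant coefficients give `N e₁ + N(N-1) e₂ = 0`: occupation numbers are negatively
  -- correlated. Hence the term in `(∑ z_k)²`, which may be `N` times larger than `∑ z_k²`, can be
  -- dropped.
  have he2 : e₂ ≤ 0 := by
    have h0 : ∫ n, (∑ k : Fin N, (1 : ℝ) * ((n k : ℝ) - b)) ^ 2 ∂(canon p N M) = 0 := by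
      rw [integral_eq_zero_iff_of_nonneg (fun n => sq_nonneg _) (integrable_canon p N M _)]
      filter_upwards [ae_canon (p := p) (N := N) (M := M)] with n hn
      have : ∑ k : Fin N, (1 : ℝ) * ((n k : ℝ) - b) = 0 := by
        simp only [one_mul, Finset.sum_sub_distrib]
        rw [← Nat.cast_sum, hn]
        simp only [Finset.sum_const, Finset.card_univ, Fintype.card_fin, nsmul_eq_mul, hb]
        field_simp
        simp
      simp only [this, Pi.zero_apply]
      norm_num
    rw [key fun _ => 1] at h0
    simp only [Finset.sum_const, Finset.card_univ, Fintype.card_fin, nsmul_eq_mul, mul_one,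
      one_pow] at h0
    have h1 : e₂ * (N * (N - 1)) = -(e₁ * N) := by linarith
    by_contra hcon
    have : 0 < e₂ * (N * ((N : ℝ) - 1)) :=
      mul_pos (not_le.1 hcon) (mul_pos hNpos (by linarith))
    nlinarith
  have he2' : -e₁ ≤ e₂ :=
    (abs_le.1 (abs_integral_mul_canon_le hp (M := M) (fun k => (k : ℝ) - b) i₀ i₁)).1
  have hz : 0 ≤ ∑ k, z k ^ 2 := Finset.sum_nonneg fun _ _ => sq_nonneg _
  have hcs : (∑ k, z k) ^ 2 ≤ N * ∑ k, z k ^ 2 := by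
    simpa using sq_sum_le_card_mul_sum_sq (s := (Finset.univ : Finset (Fin N))) (f := z)
  have h1 : ∫ n, (∑ k, z k * ((n k : ℝ) - b)) ^ 2 ∂(canon p N M) ≤ 2 * (2 * e + 2) * ∑ k, z k ^ 2 := by
    rw [key z]
    nlinarith [mul_nonpos_of_nonpos_of_nonneg he2 (sq_nonneg (∑ k, z k)),
      mul_le_mul_of_nonneg_right (show e₁ - e₂ ≤ 2 * (2 * e + 2) by linarith) hz]
  have h2 : ∫ n, (∑ k, z k * ((n k : ℝ) - m)) ^ 2 ∂(canon p N M) ≤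
      ∫ n, (2 * (∑ k, z k * ((n k : ℝ) - b)) ^ 2 + 2 * ((∑ k, z k) ^ 2 * (b - m) ^ 2))
        ∂(canon p N M) := by
    refine integral_mono (integrable_canon p N M _) (integrable_canon p N M _) fun n => ?_
    have e : ∑ k, z k * ((n k : ℝ) - m) = ∑ k, z k * ((n k : ℝ) - b) + (∑ k, z k) * (b - m) := by
      rw [Finset.sum_mul, ← Finset.sum_add_distrib]
      exact Finset.sum_congr rfl fun k _ => by ring
    simp only
    rw [e]
    nlinarith [sq_nonneg (∑ k, z k * ((n k : ℝ) - b) - (∑ k, z k) * (b - m))]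
  rw [integral_add (integrable_canon p N M _) (integrable_canon p N M _), integral_const_mul,
    integral_const] at h2
  simp only [probReal_univ, one_smul] at h2
  -- Cauchy–Schwarz loses a factor `N`, compensated by `(b - m)² ≤ 1/N²`.
  have h3 : (∑ k, z k) ^ 2 * (b - m) ^ 2 ≤ ∑ k, z k ^ 2 := by
    calc (∑ k, z k) ^ 2 * (b - m) ^ 2 ≤ (N * ∑ k, z k ^ 2) * (1 / N ^ 2) := by gcongr
      _ = (∑ k, z k ^ 2) / N := by field_simp
      _ ≤ _ := div_le_self hz (by linarith)
  nlinarith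

omit hp in
/-- Removing a particle: the rates `τ` change the number of particles by one. -/
theorem wsum_rate_mul {τ : ℕ → ℝ} {a : ℝ} (hτ0 : τ 0 = 0) (hτ : ∀ k, τ (k + 1) * p (k + 1) = a * p k)
    {N : ℕ} (M : ℕ) (i : Fin N) (f : (Fin N → ℕ) → ℂ) :
    wsum p (M + 1) (fun n => τ (n i) * f n) =
      a * wsum p M fun n => f (Function.update n i (n i + 1)) := by
  rw [wsum, wsum, Finset.mul_sum]
  symm
  -- Adding a particle at `i` maps the configurations with `M` particles injectively onto those with
  -- `M + 1` particles and `n i ≥ 1`; the missed ones have `n i = 0` and carry weight `τ 0 = 0`.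
  refine Finset.sum_of_injOn (fun n => Function.update n i (n i + 1)) ?_ ?_ ?_ ?_
  · intro n _ n' _ hnn
    ext j
    have := congrFun hnn j
    by_cases hj : j = i
    · subst hj; simpa using this
    · simpa [hj] using this
  · intro n hn
    have : ∑ j, n j = M := by simpa using hn
    rw [← Finset.add_sum_erase _ n (Finset.mem_univ i)] at this
    simp [Finset.sum_update_of_mem, Finset.sdiff_singleton_eq_erase]
    omega
  · intro n hn hn'
    have hM : ∑ j, n j = M + 1 := by simpa using hn
    have : n i = 0 := by
      by_contra h0
      refine hn' ⟨Function.update n i (n i - 1), ?_, ?_⟩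
      · rw [← Finset.add_sum_erase _ n (Finset.mem_univ i)] at hM
        simp [Finset.sum_update_of_mem, Finset.sdiff_singleton_eq_erase]
        omega
      · have : n i - 1 + 1 = n i := by omega
        simp [this]
    simp [this, hτ0]
  · intro n _
    have e : ∏ j, p (Function.update n i (n i + 1) j) =
        p (n i + 1) * ∏ j ∈ Finset.univ.erase i, p (n j) := by
      rw [← Finset.mul_prod_erase _ _ (Finset.mem_univ i), Function.update_self]
      congr 1
      refine Finset.prod_congr rfl fun j hj => ?_
      rw [Function.update_of_ne (Finset.ne_of_mem_erase hj)]
    simp only [Function.update_self]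
    rw [e, ← Finset.mul_prod_erase _ (fun j => p (n j)) (Finset.mem_univ i)]
    have := hτ (n i)
    have hc : (τ (n i + 1) : ℂ) * (p (n i + 1) : ℂ) = a * p (n i) := by exact_mod_cast this
    push_cast
    linear_combination (-(f (Function.update n i (n i + 1))) *
      (∏ j ∈ Finset.univ.erase i, (p (n j) : ℂ))) * hc

omit hp in
theorem chr_update (m : ℝ) {N : ℕ} (θ : Fin N → ℝ) (n : Fin N → ℕ) (i : Fin N) :
    chr m θ (Function.update n i (n i + 1)) = chr m θ n * Complex.exp (Complex.I * (θ i : ℝ)) := by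
  rw [chr, chr, ← Complex.exp_add, ← mul_add, ← Complex.ofReal_add]
  congr 3
  rw [← Finset.add_sum_erase _ _ (Finset.mem_univ i),
    ← Finset.add_sum_erase _ (fun j => θ j * ((n j : ℝ) - m)) (Finset.mem_univ i)]
  have : ∑ j ∈ Finset.univ.erase i, θ j * ((Function.update n i (n i + 1) j : ℝ) - m) =
      ∑ j ∈ Finset.univ.erase i, θ j * ((n j : ℝ) - m) :=
    Finset.sum_congr rfl fun j hj => by rw [Function.update_of_ne (Finset.ne_of_mem_erase hj)]
  rw [this]
  simp
  ring

/-- Absorbing `τ (n i)` removes a particle at `i`; in the character this leaves the phase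
`exp(iθ_i)`. The identity is exact, and the ratio of masses is the only trace of the change of
ensemble. -/
theorem integral_rate_mul_chr {τ : ℕ → ℝ} {a : ℝ} (hτ0 : τ 0 = 0)
    (hτ : ∀ k, τ (k + 1) * p (k + 1) = a * p k) {N : ℕ} (hN : 0 < N) (M : ℕ) (m : ℝ)
    (z : Fin N → ℂ) (θ : Fin N → ℝ) :
    ∫ n, (∑ i, τ (n i) * z i) * chr m θ n ∂(canon p N (M + 1)) =
      (a * mass p N M / mass p N (M + 1) : ℝ) *
        (∑ i, z i * Complex.exp (Complex.I * (θ i : ℝ))) * ∫ n, chr m θ n ∂(canon p N M) := by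
  simp_rw [Finset.sum_mul]
  rw [integral_finsetSum _ fun _ _ => integrable_canon p _ _ _, Finset.mul_sum, Finset.sum_mul]
  refine Finset.sum_congr rfl fun i _ => ?_
  have e : ∀ n : Fin N → ℕ, (τ (n i) : ℂ) * z i * chr m θ n = z i * (τ (n i) * chr m θ n) :=
    fun n => by ring
  simp_rw [e]
  rw [integral_const_mul, integral_canon_eq_wsum hp, integral_canon_eq_wsum hp,
    wsum_rate_mul hτ0 hτ]
  have e2 : (wsum p M fun n => chr m θ (Function.update n i (n i + 1))) =
      wsum p M (chr m θ) * Complex.exp (Complex.I * (θ i : ℝ)) := by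
    simp only [wsum, chr_update, Finset.sum_mul]
    exact Finset.sum_congr rfl fun n _ => by ring
  have h1 : (mass p N M : ℂ) ≠ 0 := by exact_mod_cast (mass_pos hp (Or.inl hN)).ne'
  rw [e2]
  push_cast
  field_simp

end

namespace IsLaw
variable {p : ℕ → ℝ} {m α : ℝ} (h : IsLaw p m α)
include h

theorem tendsto_sqrt_mul_mass (M : ℕ → ℕ)
    (hM : Tendsto (fun N : ℕ => ((M N : ℝ) - N * m) / √N) atTop (𝓝 0)) :
    Tendsto (fun N : ℕ => √N * mass p N (M N)) atTop
      (𝓝 ((2 * Real.pi)⁻¹ * √(2 * Real.pi / α))) := by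
  have h1 := h.local_limit M hM (fun N _ => 0) (C := 0) (A := 0) (B := 0) (by simp) (by simp)
    (by simp)
  have e : ∀ N : ℕ, wsum p (M N) (chr m fun _ : Fin N => 0 / √N) = (mass p N (M N) : ℝ) := by
    intro N
    simp [wsum, chr, mass]
  simp_rw [e] at h1
  have h2 := (Complex.continuous_re.tendsto _).comp h1
  refine (h2.congr fun N => ?_).trans (le_of_eq ?_)
  · rw [Function.comp_apply, ← Complex.ofReal_mul, Complex.ofReal_re]
  · rw [Complex.ofReal_re]; simp

/-- A quotient of two local limits, the denominator being the case `θ = 0`; the factors `√N` and the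
Gaussian normalization cancel. -/
theorem tendsto_integral_chr (M : ℕ → ℕ)
    (hM : Tendsto (fun N : ℕ => ((M N : ℝ) - N * m) / √N) atTop (𝓝 0))
    (θ : ∀ N : ℕ, Fin N → ℝ) {C A B : ℝ} (hθ : ∀ N j, |θ N j| ≤ C)
    (hA : Tendsto (fun N : ℕ => (∑ j, θ N j) / N) atTop (𝓝 A))
    (hB : Tendsto (fun N : ℕ => (∑ j, θ N j ^ 2) / N) atTop (𝓝 B)) :
    Tendsto (fun N : ℕ => ∫ n, chr m (fun j => θ N j / √N) n ∂(canon p N (M N))) atTop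
      (𝓝 (Real.exp (-(α / 2 * (B - A ^ 2))) : ℝ)) := by
  have h1 := h.local_limit M hM θ hθ hA hB
  have h2 := h.tendsto_sqrt_mul_mass M hM
  have hα := h.var_pos
  have hpos : 0 < (2 * Real.pi)⁻¹ * √(2 * Real.pi / α) := by
    have := Real.pi_pos
    positivity
  have h3 := h1.div ((Complex.continuous_ofReal.tendsto _).comp h2)
    (by exact_mod_cast hpos.ne')
  rw [Complex.ofReal_mul, mul_div_cancel_left₀ _ (by exact_mod_cast hpos.ne')] at h3
  refine h3.congr' ?_
  filter_upwards [eventually_gt_atTop 0] with N hN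
  have hs : (√(N : ℝ) : ℂ) ≠ 0 := by
    have : 0 < √(N : ℝ) := Real.sqrt_pos.2 (by exact_mod_cast hN)
    exact_mod_cast this.ne'
  rw [integral_canon_eq_wsum h.pos]
  simp only [Pi.div_apply, Function.comp_apply, Complex.ofReal_mul]
  rw [mul_div_mul_left _ _ hs]

/-- The local limit is insensitive to changes of the particle number that are `o(√N)`, in particular
to the removal of one particle. -/
theorem tendsto_mass_ratio (M M' : ℕ → ℕ)
    (hM : Tendsto (fun N : ℕ => ((M N : ℝ) - N * m) / √N) atTop (𝓝 0))
    (hM' : Tendsto (fun N : ℕ => ((M' N : ℝ) - N * m) / √N) atTop (𝓝 0)) :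
    Tendsto (fun N : ℕ => mass p N (M' N) / mass p N (M N)) atTop (𝓝 1) := by
  have hα := h.var_pos
  have hpos : 0 < (2 * Real.pi)⁻¹ * √(2 * Real.pi / α) := by
    have := Real.pi_pos
    positivity
  have h3 := (h.tendsto_sqrt_mul_mass M' hM').div (h.tendsto_sqrt_mul_mass M hM) hpos.ne'
  rw [div_self hpos.ne'] at h3
  refine h3.congr' ?_
  filter_upwards [eventually_gt_atTop 0] with N hN
  have : 0 < √(N : ℝ) := Real.sqrt_pos.2 (by exact_mod_cast hN)
  simp only [Pi.div_apply]
  rw [mul_div_mul_left _ _ this.ne']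

/-- One-site marginals of the canonical measures are dominated by `p`. -/
theorem exists_integral_coord_le (M : ℕ → ℕ)
    (hM : Tendsto (fun N : ℕ => ((M N : ℝ) - N * m) / √N) atTop (𝓝 0))
    {g : ℕ → ℝ} (hg : ∀ k, 0 ≤ g k) (hgs : Summable fun k => g k * p k) :
    ∃ e, ∀ᶠ N : ℕ in atTop, ∀ i : Fin N, ∫ n, g (n i) ∂(canon p N (M N)) ≤ e := by
  have hα := h.var_pos
  have hpos : 0 < (2 * Real.pi)⁻¹ * √(2 * Real.pi / α) := by
    have := Real.pi_pos
    positivity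
  set c := (2 * Real.pi)⁻¹ * √(2 * Real.pi / α)
  -- The numerator comes from `wsum_coord_le`; the denominator `c/2` is an eventual lower bound for
  -- `√N` times the mass.
  refine ⟨√(Real.pi / (p 0 * p 1 / Real.pi ^ 2)) * (∑' k, g k * p k) / (c / 2), ?_⟩
  have h1 := (h.tendsto_sqrt_mul_mass M hM).eventually_const_lt (half_lt_self hpos)
  filter_upwards [h1, eventually_ge_atTop 2] with N hN1 hN2 i
  have hm := mass_pos h.pos (M := M N) (Or.inl (by omega : 0 < N))
  have hsq : 0 < √(N : ℝ) := Real.sqrt_pos.2 (by positivity)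
  have h2 := h.wsum_coord_le (M N) i hg hgs hN2
  have hs0 : 0 ≤ ∑' k, g k * p k := tsum_nonneg fun k => mul_nonneg (hg k) (h.nonneg k)
  rw [integral_canon h.pos]
  simp only [smul_eq_mul, div_mul_eq_mul_div]
  rw [← Finset.sum_div, div_le_iff₀ hm]
  refine h2.trans ?_
  rw [div_mul_eq_mul_div, div_mul_eq_mul_div, div_le_div_iff₀ hsq (half_pos hpos)]
  have : 0 ≤ √(Real.pi / (p 0 * p 1 / Real.pi ^ 2)) * (∑' k, g k * p k) := by positivity
  nlinarith [mul_le_mul_of_nonneg_left hN1.le this]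

end IsLaw

end

section


/-! ### The grand canonical laws -/

namespace IsRate
variable {τ : ℕ → ℝ} (hτ : IsRate τ)
include hτ

theorem prod_pos (k : ℕ) : 0 < ∏ i ∈ Finset.Icc 1 k, τ i :=
  Finset.prod_pos fun i hi => hτ.pos i (Finset.mem_Icc.1 hi).1

theorem weight_pos {a : ℝ} (ha : 0 < a) (k : ℕ) : 0 < weight τ a k :=
  div_pos (pow_pos ha k) (hτ.prod_pos k)

theorem weight_nonneg {a : ℝ} (ha : 0 ≤ a) (k : ℕ) : 0 ≤ weight τ a k :=
  div_nonneg (pow_nonneg ha k) (hτ.prod_pos k).le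

theorem weight_mono {a b : ℝ} (ha : 0 ≤ a) (hab : a ≤ b) (k : ℕ) : weight τ a k ≤ weight τ b k :=
  div_le_div_of_nonneg_right (pow_le_pow_left₀ ha hab k) (hτ.prod_pos k).le

theorem weight_succ (a : ℝ) (k : ℕ) : τ (k + 1) * weight τ a (k + 1) = a * weight τ a k := by
  have h1 := (hτ.prod_pos k).ne'
  have h2 := (hτ.pos (k + 1) (by omega)).ne'
  rw [weight, weight, Finset.prod_Icc_succ_top (by omega), pow_succ]
  field_simp

/-- Below `a*` there is `b > a` with `Z_b` finite, and the weight at `a` is the bounded weight at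
`b` times `(a/b)^k`: geometric decay beats any power. -/
theorem summable_moment {a : ℝ} (ha : 0 < a) (ha' : (a : EReal) < aStar τ) (q : ℕ) :
    Summable fun k : ℕ => ((k : ℝ) + 1) ^ q * weight τ a k := by
  obtain ⟨b, hb, hs, hab'⟩ : ∃ b : ℝ, 0 < b ∧ Summable (weight τ b) ∧ a < b := by
    obtain ⟨_, ⟨b, hb, rfl⟩, hab⟩ := lt_sSup_iff.1 ha'
    exact ⟨b, hb.1, hb.2, EReal.coe_lt_coe_iff.1 hab⟩
  obtain ⟨C, hC'⟩ : ∃ C, ∀ k, weight τ b k ≤ C :=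
    ⟨_, fun k => hs.le_tsum k fun j _ => hτ.weight_nonneg hb.le j⟩
  obtain ⟨r, hr, hr1, hrb⟩ : ∃ r : ℝ, 0 < r ∧ ‖r‖ < 1 ∧ a = b * r := by
    have hr : 0 < a / b := div_pos ha hb
    refine ⟨a / b, hr, ?_, (mul_div_cancel₀ a hb.ne').symm⟩
    rw [Real.norm_of_nonneg hr.le]
    exact (div_lt_one hb).2 hab'
  have h0 : Summable fun n : ℕ => (n : ℝ) ^ q * r ^ n :=
    summable_pow_mul_geometric_of_norm_lt_one q hr1
  have h1 : Summable fun k : ℕ => C / r * (((k + 1 : ℕ) : ℝ) ^ q * r ^ (k + 1)) :=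
    ((summable_nat_add_iff 1).2 h0).mul_left (C / r)
  refine Summable.of_nonneg_of_le
    (fun k => mul_nonneg (by positivity) (hτ.weight_nonneg ha.le k)) (fun k => ?_) h1
  have e : weight τ a k = weight τ b k * r ^ k := by
    rw [weight, weight, hrb, mul_pow]
    ring
  have h2 : C / r * (((k + 1 : ℕ) : ℝ) ^ q * r ^ (k + 1)) = ((k : ℝ) + 1) ^ q * (C * r ^ k) := by
    have : C / r * r ^ (k + 1) = C * r ^ k := by
      rw [pow_succ, div_mul_eq_mul_div, div_eq_iff hr.ne', mul_assoc]
    rw [mul_left_comm, this]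
    push_cast
    rfl
  rw [h2, e]
  have h3 := hC' k
  gcongr

theorem summable_weight {a : ℝ} (ha : 0 < a) (ha' : (a : EReal) < aStar τ) :
    Summable (weight τ a) := by
  simpa using hτ.summable_moment ha ha' 0

theorem summable_mean {a : ℝ} (ha : 0 < a) (ha' : (a : EReal) < aStar τ) :
    Summable fun k : ℕ => (k : ℝ) * weight τ a k := by
  refine Summable.of_nonneg_of_le (fun k => mul_nonneg (by positivity) (hτ.weight_nonneg ha.le k))
    (fun k => ?_) (hτ.summable_moment ha ha' 1)
  have := hτ.weight_nonneg ha.le k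
  rw [pow_one]
  nlinarith

/-- Since `τ ≥ τ 1` on `k ≥ 1`, the weights at `τ 1 / 2` are at most `2^{-k}`. -/
theorem aStar_pos : 0 < aStar τ := by
  have h1 := hτ.pos 1 le_rfl
  refine lt_of_lt_of_le (b := ((τ 1 / 2 : ℝ) : EReal)) (by exact_mod_cast half_pos h1)
    (le_sSup ⟨_, ⟨half_pos h1, ?_⟩, rfl⟩)
  refine Summable.of_nonneg_of_le (fun k => hτ.weight_nonneg (half_pos h1).le k) (fun k => ?_)
    (summable_geometric_of_lt_one (r := 1 / 2) (by norm_num) (by norm_num))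
  rw [weight, div_le_iff₀ (hτ.prod_pos k)]
  have h2 : τ 1 ^ k ≤ ∏ i ∈ Finset.Icc 1 k, τ i := by
    calc τ 1 ^ k = ∏ i ∈ Finset.Icc 1 k, τ 1 := by simp
      _ ≤ _ := Finset.prod_le_prod (fun _ _ => h1.le)
        fun i hi => hτ.mono (Finset.mem_Icc.1 hi).1
  calc (τ 1 / 2) ^ k = (1 / 2) ^ k * τ 1 ^ k := by rw [← mul_pow]; ring
    _ ≤ _ := by gcongr

theorem one_le_Z {a : ℝ} (ha : 0 ≤ a) (hs : Summable (weight τ a)) : 1 ≤ Z τ a := by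
  have := hs.le_tsum 0 fun k _ => hτ.weight_nonneg ha k
  simpa [weight, Z] using this

omit hτ in
theorem R_eq (τ : ℕ → ℝ) (a : ℝ) : R τ a = (∑' k : ℕ, (k : ℝ) * weight τ a k) / Z τ a := by
  rw [R, ← tsum_div_const]
  simp [nu, mul_div_assoc]

theorem continuousOn_R {b : ℝ} (hb : 0 < b) (hb' : (b : EReal) < aStar τ) :
    ContinuousOn (R τ) (Set.Icc 0 b) := by
  have hc (k : ℕ) : Continuous fun a => weight τ a k := by unfold weight; fun_prop
  have h1 : ContinuousOn (fun a => ∑' k : ℕ, (k : ℝ) * weight τ a k) (Set.Icc 0 b) := by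
    refine continuousOn_tsum (fun k => ((hc k).const_mul _).continuousOn)
      (hτ.summable_mean hb hb') fun k a ha => ?_
    have := hτ.weight_nonneg ha.1 k
    rw [Real.norm_of_nonneg (by positivity)]
    exact mul_le_mul_of_nonneg_left (hτ.weight_mono ha.1 ha.2 k) (by positivity)
  have h2 : ContinuousOn (Z τ) (Set.Icc 0 b) := by
    refine continuousOn_tsum (fun k => (hc k).continuousOn)
      (hτ.summable_weight hb hb') fun k a ha => ?_
    rw [Real.norm_of_nonneg (hτ.weight_nonneg ha.1 k)]
    exact hτ.weight_mono ha.1 ha.2 k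
  rw [funext (R_eq τ)]
  refine h1.div h2 fun a ha => ?_
  have hs : Summable (weight τ a) := Summable.of_nonneg_of_le (hτ.weight_nonneg ha.1)
    (hτ.weight_mono ha.1 ha.2) (hτ.summable_weight hb hb')
  exact (one_pos.trans_le (hτ.one_le_Z ha.1 hs)).ne'

/-- Intermediate values between `R 0 = 0` and a point near `a*` where `R` exceeds `nbar`. Any
preimage of `nbar` will do, so monotonicity of `R` is not needed. -/
theorem Phi_spec {nbar : ℝ} (h0 : 0 < nbar) (h1 : (nbar : EReal) < RStar τ) :
    (0 < Phi τ nbar ∧ (Phi τ nbar : EReal) < aStar τ) ∧ R τ (Phi τ nbar) = nbar := by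
  have hR0 : R τ 0 = 0 := by
    rw [R_eq]
    have : ∀ k : ℕ, (k : ℝ) * weight τ 0 k = 0 := fun k => by
      rcases k with _ | k <;> simp [weight]
    simp [this]
  -- `RStar` is a limsup; being below it yields points arbitrarily close to `a*` with `R > nbar`,
  -- and one of them in `(0, a*)` suffices.
  have hf := Filter.frequently_lt_of_lt_limsup (by isBoundedDefault) h1
  obtain ⟨x, hx, hx0, hx1⟩ :=
    (hf.and_eventually (Ioo_mem_nhdsLT hτ.aStar_pos)).exists
  have hxe : ((x.toReal : ℝ) : EReal) = x :=
    EReal.coe_toReal (hx1.trans_le le_top).ne (bot_le.trans_lt hx0).ne'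
  set b := x.toReal
  rw [← hxe] at hx0 hx1
  have hb0 : 0 < b := by exact_mod_cast hx0
  have hb : nbar < R τ b := EReal.coe_lt_coe_iff.1 hx
  obtain ⟨a, ha, hRa⟩ := intermediate_value_Icc hb0.le (hτ.continuousOn_R hb0 hx1)
    ⟨by rw [hR0]; exact h0.le, hb.le⟩
  have ha0 : 0 < a := by
    refine lt_of_le_of_ne ha.1 fun h => ?_
    rw [← h, hR0] at hRa
    exact h0.ne hRa
  have hmem : ∃ a ∈ {a : ℝ | 0 < a ∧ (a : EReal) < aStar τ}, R τ a = nbar :=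
    ⟨a, ⟨ha0, lt_of_le_of_lt (by exact_mod_cast ha.2) hx1⟩, hRa⟩
  exact ⟨Function.invFunOn_mem hmem, Function.invFunOn_eq hmem⟩

section
variable {nbar : ℝ} (h0 : 0 < nbar) (h1 : (nbar : EReal) < RStar τ)
include h0 h1

theorem Z_Phi_pos : 0 < Z τ (Phi τ nbar) := by
  obtain ⟨⟨ha, ha'⟩, -⟩ := hτ.Phi_spec h0 h1
  exact one_pos.trans_le (hτ.one_le_Z ha.le (hτ.summable_weight ha ha'))

omit h0 h1 in
theorem nu_succ (k : ℕ) : τ (k + 1) * nu τ (Phi τ nbar) (k + 1) =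
    Phi τ nbar * nu τ (Phi τ nbar) k := by
  rw [nu, nu, ← mul_div_assoc, hτ.weight_succ, mul_div_assoc]

theorem summable_nu_moment (q : ℕ) :
    Summable fun k : ℕ => ((k : ℝ) + 1) ^ q * nu τ (Phi τ nbar) k := by
  obtain ⟨⟨ha, ha'⟩, -⟩ := hτ.Phi_spec h0 h1
  have := (hτ.summable_moment ha ha' q).div_const (Z τ (Phi τ nbar))
  simpa only [nu, mul_div_assoc] using this

theorem nu_pos (k : ℕ) : 0 < nu τ (Phi τ nbar) k :=
  div_pos (hτ.weight_pos (hτ.Phi_spec h0 h1).1.1 k) (hτ.Z_Phi_pos h0 h1)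

theorem isLaw_nu : IsLaw (nu τ (Phi τ nbar)) nbar (alpha τ nbar) := by
  obtain ⟨⟨ha, ha'⟩, hR⟩ := hτ.Phi_spec h0 h1
  refine ⟨hτ.nu_pos h0 h1, ?_, ?_, ?_⟩
  · have := (hτ.summable_weight ha ha').hasSum.div_const (Z τ (Phi τ nbar))
    rwa [← Z, div_self (hτ.Z_Phi_pos h0 h1).ne'] at this
  · have hs : Summable fun k : ℕ => (k : ℝ) * nu τ (Phi τ nbar) k := by
      have := (hτ.summable_mean ha ha').div_const (Z τ (Phi τ nbar))
      simpa only [nu, mul_div_assoc] using this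
    have := hs.hasSum
    rwa [← R, hR] at this
  · refine Summable.hasSum ?_
    refine Summable.of_nonneg_of_le
      (fun k => mul_nonneg (sq_nonneg _) (hτ.nu_pos h0 h1 k).le) (fun k => ?_)
      ((hτ.summable_nu_moment h0 h1 2).mul_left ((1 + nbar) ^ 2))
    rw [← mul_assoc, ← mul_pow]
    refine mul_le_mul_of_nonneg_right (sq_le_sq' ?_ ?_) (hτ.nu_pos h0 h1 k).le
    · nlinarith [(Nat.cast_nonneg k : (0 : ℝ) ≤ k), mul_nonneg h0.le (Nat.cast_nonneg k : (0 : ℝ) ≤ k)]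
    · nlinarith [(Nat.cast_nonneg k : (0 : ℝ) ≤ k), mul_nonneg h0.le (Nat.cast_nonneg k : (0 : ℝ) ≤ k)]

-- The identity `E[g(n) τ(n)] = a E[g(n+1)]`: shift the index by `nu_succ`; the term `k = 0`
-- vanishes because `τ 0 = 0`.
omit h0 h1 in
theorem hasSum_rate_mul {g : ℕ → ℝ} {s : ℝ}
    (hg : HasSum (fun k => g (k + 1) * nu τ (Phi τ nbar) k) s) :
    HasSum (fun k => g k * τ k * nu τ (Phi τ nbar) k) (Phi τ nbar * s) := by
  rw [← hasSum_nat_add_iff' 1]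
  have := hg.mul_left (Phi τ nbar)
  simp only [Finset.range_one, Finset.sum_singleton, hτ.zero, mul_zero, zero_mul, sub_zero]
  refine this.congr_fun fun k => ?_
  rw [mul_assoc, hτ.nu_succ]
  ring

theorem tauBar_eq : tauBar τ nbar = Phi τ nbar := by
  have h := (hτ.isLaw_nu h0 h1).hasSum_one
  have := hτ.hasSum_rate_mul (g := fun _ => 1) (s := 1) (by simpa using h)
  rw [tauBar]
  simpa using this.tsum_eq

/-- `E[(n - n̄) τ(n)] = a E[n + 1 - n̄] = a`, and subtracting `τ̄` changes nothing since `n - n̄` is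
centred. The drift coefficient thus becomes `a/(2α)`. -/
theorem rho_eq : rho τ nbar = Phi τ nbar := by
  have hl := hτ.isLaw_nu h0 h1
  have h2 := hτ.hasSum_rate_mul (g := fun k => (k : ℝ) - nbar) (s := 1) (by
    have := (hl.hasSum_mean.add hl.hasSum_one).sub (hl.hasSum_one.mul_left nbar)
    rw [mul_one, add_sub_cancel_left] at this
    refine this.congr_fun fun k => ?_
    push_cast; ring)
  have h3 := (hl.hasSum_mean.sub (hl.hasSum_one.mul_left nbar)).mul_left (Phi τ nbar)
  have h4 := h2.sub h3
  rw [mul_one, mul_one, sub_self, mul_zero, sub_zero] at h4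
  refine Eq.trans ?_ h4.tsum_eq
  rw [rho, hτ.tauBar_eq h0 h1]
  refine tsum_congr fun k => ?_
  ring

/-- Polynomial growth of `τ` enters here: it gives the rates a second moment under `ν_a`, hence an
`L²` bound on the density. -/
theorem summable_rate_sq : Summable fun k => τ k ^ 2 * nu τ (Phi τ nbar) k := by
  obtain ⟨C, q, hC⟩ := hτ.growth
  refine Summable.of_nonneg_of_le (fun k => mul_nonneg (sq_nonneg _) (hτ.nu_pos h0 h1 k).le)
    (fun k => ?_) ((hτ.summable_nu_moment h0 h1 (q * 2)).mul_left (C ^ 2))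
  have h2 : 0 ≤ τ k := by rw [← hτ.zero]; exact hτ.mono (Nat.zero_le k)
  calc τ k ^ 2 * nu τ (Phi τ nbar) k ≤ (C * (1 + (k : ℝ)) ^ q) ^ 2 * nu τ (Phi τ nbar) k := by
        have := (hτ.nu_pos h0 h1 k).le
        gcongr
        exact hC k
    _ = _ := by rw [mul_pow, ← pow_mul, add_comm]; ring

end

omit hτ in
/-- The invariant probability is the canonical measure. -/
theorem configProb_eq {τ : ℕ → ℝ} {a : ℝ} (ha : 0 < a) (hZ : 0 < Z τ a) (N : ℕ) (nbar : ℝ) {n : Fin N → ℕ}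
    (hn : n ∈ Omega N nbar) :
    configProb τ N nbar n = (∏ j, nu τ a (n j)) / mass (nu τ a) N ⌊(N : ℝ) * nbar⌋₊ := by
  set M := ⌊(N : ℝ) * nbar⌋₊
  -- Fixing the number of particles makes `a^M / Z^N` a constant, which disappears on normalizing.
  have h1 : ∀ n' ∈ Omega N nbar, ∏ j, nu τ a (n' j) = a ^ M / Z τ a ^ N * configWeight τ n' := by
    intro n' hn'
    have hM : ∑ j, n' j = M := by simpa [Omega] using hn'
    simp only [nu, weight, configWeight]
    rw [Finset.prod_div_distrib, Finset.prod_div_distrib, Finset.prod_pow_eq_pow_sum, hM]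
    simp only [Finset.prod_const, Finset.card_univ, Fintype.card_fin]
    ring
  have hc : a ^ M / Z τ a ^ N ≠ 0 := by positivity
  rw [mass]
  change _ = _ / ∑ n' ∈ Omega N nbar, _
  rw [Finset.sum_congr rfl h1, h1 n hn, ← Finset.mul_sum, mul_div_mul_left _ _ hc, configProb]

end IsRate

end

section


/-! ### Height functions -/

theorem integral_unitInterval (f : ℝ → ℝ) :
    ∫ x : unitInterval, f x = ∫ x in (0 : ℝ)..1, f x := by
  rw [intervalIntegral.integral_of_le zero_le_one, ← integral_Icc_eq_integral_Ioc]
  exact integral_subtype_comap measurableSet_Icc f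

theorem coeFn_toE {f : unitInterval → ℝ} (hf : MemLp f 1 (volume : Measure unitInterval)) :
    (toE f : unitInterval → ℝ) =ᵐ[volume] f := by
  rw [toE, dif_pos hf]
  exact hf.coeFn_toLp

theorem integrable_of_continuous {f : unitInterval → ℝ} (hf : Continuous f) :
    Integrable f (volume : Measure unitInterval) :=
  memLp_one_iff_integrable.1 (memLp_of_continuous hf)

theorem integral_ite_floor {f : ℝ → ℝ} {N : ℕ} (hN : 0 < N) {k : ℕ} (hk : k ≤ N) :
    ∫ x : unitInterval, (if k ≤ ⌊(x : ℝ) * N⌋₊ then f x else 0) =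
      ∫ x in ((k : ℝ) / N)..1, f x := by
  have hNpos : (0 : ℝ) < N := by exact_mod_cast hN
  have h01 : (k : ℝ) / N ≤ 1 := (div_le_one hNpos).2 (by exact_mod_cast hk)
  have h00 : 0 ≤ (k : ℝ) / N := by positivity
  have e : ∀ x : unitInterval, (if k ≤ ⌊(x : ℝ) * N⌋₊ then f x else 0) =
      Set.indicator (Set.Ici ((k : ℝ) / N)) f x := by
    intro x
    have : k ≤ ⌊(x : ℝ) * N⌋₊ ↔ (x : ℝ) ∈ Set.Ici ((k : ℝ) / N) := by
      rw [Nat.le_floor_iff (mul_nonneg x.2.1 hNpos.le), Set.mem_Ici, div_le_iff₀ hNpos]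
    simp only [this, Set.indicator]
    congr
  simp_rw [e]
  rw [integral_unitInterval, intervalIntegral.integral_of_le zero_le_one,
    intervalIntegral.integral_of_le h01, ← integral_Icc_eq_integral_Ioc,
    ← integral_Icc_eq_integral_Ioc, setIntegral_indicator measurableSet_Ici]
  congr 2
  ext x
  simp only [Set.mem_inter_iff, Set.mem_Icc, Set.mem_Ici]
  constructor
  · rintro ⟨⟨_, h⟩, h'⟩; exact ⟨h', h⟩
  · rintro ⟨h, h'⟩; exact ⟨⟨h00.trans h, h'⟩, h⟩

theorem measurable_floor_mul (N : ℕ) : Measurable fun x : unitInterval => ⌊(x : ℝ) * N⌋₊ :=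
  Nat.measurable_floor.comp (measurable_subtype_coe.mul_const _)

/-- Summation by parts: a particle at site `k + 1` raises the height on `[(k+1)/N, 1]`, so its
coefficient is a tail integral of `f`. The pairing becomes a linear statistic of the occupation
numbers. -/
theorem pairing_heightE {N : ℕ} (hN : 0 < N) (nbar : ℝ) (n : Fin N → ℕ) {f : ℝ → ℝ}
    (hf : Continuous f) : pairing (heightE N nbar n) f =
      ∑ k : Fin N, (∫ x in (((k : ℕ) + 1 : ℕ) / N : ℝ)..1, f x) / √N * ((n k : ℝ) - nbar) := by
  have hfi : Integrable (fun x : unitInterval => f x) :=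
    integrable_of_continuous (hf.comp continuous_subtype_val)
  have h1 : pairing (heightE N nbar n) f = ∫ x : unitInterval, ∑ k : Fin N,
      (1 / √(N : ℝ) * ((n k : ℝ) - nbar)) * if (k : ℕ) + 1 ≤ ⌊(x : ℝ) * N⌋₊ then f x else 0 := by
    refine integral_congr_ae ?_
    filter_upwards [coeFn_toE (memLp_height N nbar n)] with x hx
    rw [heightE, hx, height, Finset.mul_sum, Finset.sum_mul]
    refine Finset.sum_congr rfl fun k _ => ?_
    split_ifs <;> ring
  rw [h1, integral_finsetSum]
  · refine Finset.sum_congr rfl fun k _ => ?_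
    rw [integral_const_mul, integral_ite_floor hN (by omega)]
    ring
  · intro k _
    refine Integrable.const_mul ?_ _
    have := hfi.indicator (measurable_floor_mul N (measurableSet_Ici (a := (k : ℕ) + 1)))
    refine this.congr (ae_of_all _ fun x => ?_)
    simp [Set.indicator]

/-- Pairing with derivatives of polynomials gives `∑ P(y_k)(n_k - n'_k) = 0` for every `P`, the term
in `P(1)` dropping because the totals agree; Lagrange interpolation at the `y_k` then separates the
sites. The common total is essential: the last site affects the height only at `x = 1`. -/
theorem injOn_heightE (N : ℕ) (nbar : ℝ) :
    Set.InjOn (heightE N nbar) (Omega N nbar : Set (Fin N → ℕ)) := by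
  rcases Nat.eq_zero_or_pos N with rfl | hN
  · intro n _ n' _ _
    exact Subsingleton.elim _ _
  intro n hn n' hn' h
  have hNpos : (0 : ℝ) < N := by exact_mod_cast hN
  have hsq : 0 < √(N : ℝ) := Real.sqrt_pos.2 hNpos
  have hsum : ∑ j, n j = ∑ j, n' j := by
    have h1 : ∑ j, n j = ⌊(N : ℝ) * nbar⌋₊ := by simpa [Omega] using hn
    have h2 : ∑ j, n' j = ⌊(N : ℝ) * nbar⌋₊ := by simpa [Omega] using hn'
    rw [h1, h2]
  have hsum' : ∑ j, ((n j : ℝ) - n' j) = 0 := by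
    rw [Finset.sum_sub_distrib, sub_eq_zero]
    exact_mod_cast hsum
  set y : Fin N → ℝ := fun k => ((k : ℕ) + 1 : ℕ) / N with hy
  have hyinj : Function.Injective y := by
    intro k l hkl
    simp only [hy] at hkl
    rw [div_left_inj' hNpos.ne', Nat.cast_inj] at hkl
    exact Fin.ext (by omega)
  have key (P : Polynomial ℝ) : ∑ k, P.eval (y k) * ((n k : ℝ) - n' k) = 0 := by
    have hf : Continuous fun x => P.derivative.eval x := P.derivative.continuous
    have h2 := congrArg (fun u => pairing u fun x => P.derivative.eval x) h
    simp only [pairing_heightE hN nbar _ hf] at h2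
    rw [← sub_eq_zero, ← Finset.sum_sub_distrib] at h2
    have h3 (k : Fin N) : ∫ x in (y k)..1, P.derivative.eval x = P.eval 1 - P.eval (y k) :=
      intervalIntegral.integral_eq_sub_of_hasDerivAt (fun x _ => P.hasDerivAt x)
        (hf.intervalIntegrable _ _)
    simp only [hy] at h3
    simp_rw [h3] at h2
    have h4 : ∑ k, P.eval (y k) * ((n k : ℝ) - n' k) = P.eval 1 * ∑ k, ((n k : ℝ) - n' k) -
        √N * ∑ k : Fin N, ((P.eval 1 - P.eval (y k)) / √N * ((n k : ℝ) - nbar) -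
          (P.eval 1 - P.eval (y k)) / √N * ((n' k : ℝ) - nbar)) := by
      rw [Finset.mul_sum, Finset.mul_sum, ← Finset.sum_sub_distrib]
      refine Finset.sum_congr rfl fun k _ => ?_
      field_simp
      ring
    rw [h4, hsum', h2]
    ring
  ext k
  have h5 := key (Lagrange.basis Finset.univ y k)
  rw [Finset.sum_eq_single k] at h5
  · rw [Lagrange.eval_basis_self hyinj.injOn (Finset.mem_univ k), one_mul, sub_eq_zero] at h5
    exact_mod_cast h5
  · intro l _ hl
    rw [Lagrange.eval_basis_of_ne hl.symm (Finset.mem_univ l), zero_mul]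
  · simp

theorem mN_eq_map {τ : ℕ → ℝ} {a : ℝ} (ha : 0 < a) (hZ : 0 < Z τ a) (nbar : ℝ) (N : ℕ) :
    mN τ nbar N = (canon (nu τ a) N ⌊(N : ℝ) * nbar⌋₊).map (heightE N nbar) := by
  ext s hs
  rw [Measure.map_apply (measurable_of_countable _) hs, mN, canon]
  simp only [Measure.coe_finsetSum, Finset.sum_apply, Measure.smul_apply, smul_eq_mul]
  refine Finset.sum_congr rfl fun n hn => ?_
  rw [IsRate.configProb_eq ha hZ N nbar hn, Measure.dirac_apply' _ hs,
    Measure.dirac_apply' _ (measurable_of_countable (heightE N nbar) hs)]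
  rfl

theorem pairing_move {N : ℕ} (g : Fin N → ℝ) (nbar : ℝ) (n : Fin N → ℕ) {i j : Fin N}
    (hij : i ≠ j) (hi : n i ≠ 0) :
    ∑ k, g k * ((move n i j k : ℝ) - nbar) = ∑ k, g k * ((n k : ℝ) - nbar) + (g j - g i) := by
  have e : ∀ k, g k * ((move n i j k : ℝ) - nbar) = g k * ((n k : ℝ) - nbar) +
      ((if k = j then g k else 0) - if k = i then g k else 0) := by
    intro k
    have h1 : ((n i - 1 : ℕ) : ℝ) = n i - 1 := by
      rw [Nat.cast_sub (by omega)]; simp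
    by_cases hkj : k = j
    · subst hkj
      simp [move, hij.symm]
      ring
    · by_cases hki : k = i
      · subst hki
        simp [move, hkj, h1]
        ring
      · simp [move, hkj, hki]
  simp_rw [e]
  rw [Finset.sum_add_distrib, Finset.sum_sub_distrib]
  simp

/-- The coefficient of `τ (n i)` in the generator applied to a character. -/
def jumpCoeff (N : ℕ) (γ : Fin N → ℝ) (i : Fin N) : ℂ :=
  ∑ j : Fin N, if (i : ℕ) + 1 = j ∨ (j : ℕ) + 1 = i then
    (((N : ℝ) ^ 2 / 2 : ℝ) : ℂ) * (Complex.exp (Complex.I * ((γ j - γ i : ℝ) : ℂ)) - 1) else 0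

/-- A jump multiplies the exponential of a linear functional by a factor independent of the
configuration. After division by `ψ_φ` only the rates `τ (n i)` remain random, and they enter
linearly. -/
theorem discreteDensity_heightE {τ : ℕ → ℝ} (hτ : τ 0 = 0) {N : ℕ} (hN : 0 < N) (nbar : ℝ)
    {φ : ℝ → ℝ} (hφ : Continuous φ) {n : Fin N → ℕ} (hn : n ∈ Omega N nbar) :
    discreteDensity τ nbar N φ (heightE N nbar n) = ∑ i, (τ (n i) : ℂ) *
      jumpCoeff N (fun k => (∫ x in (((k : ℕ) + 1 : ℕ) / N : ℝ)..1, φ x) / √N) i := by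
  have hinv : Function.invFunOn (heightE N nbar) (Omega N nbar : Set (Fin N → ℕ))
      (heightE N nbar n) = n := (injOn_heightE N nbar).leftInvOn_invFunOn hn
  rw [discreteDensity, generator, hinv, configGenerator, Finset.sum_div]
  refine Finset.sum_congr rfl fun i _ => ?_
  rw [jumpCoeff, Finset.sum_div, Finset.mul_sum]
  refine Finset.sum_congr rfl fun j _ => ?_
  split_ifs with hij
  swap
  · simp
  -- At an empty site the truncated `n i - 1` is meaningless, but the rate is `τ 0 = 0`.
  by_cases hi : n i = 0
  · simp [hi, hτ]
  have hne : i ≠ j := by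
    rintro rfl
    omega
  have h1 : psi φ (heightE N nbar (move n i j)) = psi φ (heightE N nbar n) *
      Complex.exp (Complex.I * (((∫ x in (((j : ℕ) + 1 : ℕ) / N : ℝ)..1, φ x) / √N -
        (∫ x in (((i : ℕ) + 1 : ℕ) / N : ℝ)..1, φ x) / √N : ℝ) : ℂ)) := by
    rw [psi, psi, ← Complex.exp_add, ← mul_add, ← Complex.ofReal_add,
      pairing_heightE hN nbar _ hφ, pairing_heightE hN nbar _ hφ, pairing_move _ nbar n hne hi]
  have h2 : psi φ (heightE N nbar n) ≠ 0 := Complex.exp_ne_zero _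
  rw [h1]
  push_cast
  field_simp

end

section


/-! ### Riemann sums -/

theorem sum_fin_ite {N m : ℕ} (hm : m ≤ N) (g : ℕ → ℝ) :
    ∑ k : Fin N, (if (k : ℕ) + 1 ≤ m then g k else 0) = ∑ k ∈ Finset.range m, g k := by
  rw [Fin.sum_univ_eq_sum_range fun k => if k + 1 ≤ m then g k else 0, ← Finset.sum_filter]
  congr 1
  ext k
  simp only [Finset.mem_filter, Finset.mem_range]
  omega

theorem abs_integral_sub_le {f : ℝ → ℝ} (hf : Continuous f) {a b c e : ℝ} (hab : a ≤ b)
    (h : ∀ x ∈ Set.Icc a b, |f x - c| ≤ e) : |(∫ x in a..b, f x) - c * (b - a)| ≤ e * (b - a) := by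
  have h1 : (∫ x in a..b, f x) - c * (b - a) = ∫ x in a..b, (f x - c) := by
    rw [intervalIntegral.integral_sub (hf.intervalIntegrable _ _) (by simp)]
    simp [mul_comm]
  rw [h1, ← Real.norm_eq_abs]
  have := intervalIntegral.norm_integral_le_of_norm_le_const (a := a) (b := b)
    (f := fun x => f x - c) (C := e) (fun x hx => by
      rw [Set.uIoc_of_le hab] at hx
      exact h x ⟨hx.1.le, hx.2⟩)
  rwa [abs_of_nonneg (sub_nonneg.2 hab)] at this

/-- The at most `N` full cells each contribute an error `K/N²`, and the incomplete cell before `t`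
at most `K/N`. -/
theorem tendsto_riemann {f : ℝ → ℝ} {K : ℝ} (hK : 0 ≤ K) (hf : Continuous f)
    (hb : ∀ x, |f x| ≤ K) (hl : ∀ x y, |f x - f y| ≤ K * |x - y|) (t : unitInterval) :
    Tendsto (fun N : ℕ => (∑ k : Fin N, (if (k : ℕ) + 1 ≤ ⌊(t : ℝ) * N⌋₊ then
      f (((k : ℕ) + 1 : ℕ) / N) else 0)) / N) atTop (𝓝 (∫ x in (0 : ℝ)..t, f x)) := by
  have hlim : Tendsto (fun N : ℕ => 2 * K / (N : ℝ)) atTop (𝓝 0) :=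
    tendsto_const_div_atTop_nhds_zero_nat _
  refine tendsto_iff_norm_sub_tendsto_zero.2 (squeeze_zero' (.of_forall fun _ => norm_nonneg _)
    ?_ hlim)
  filter_upwards [eventually_gt_atTop 0] with N hN
  have hNpos : (0 : ℝ) < N := by exact_mod_cast hN
  set m := ⌊(t : ℝ) * N⌋₊
  have ht0 : 0 ≤ (t : ℝ) * N := mul_nonneg t.2.1 hNpos.le
  have hm1 : (m : ℝ) ≤ t * N := Nat.floor_le ht0
  have hm2 : (t : ℝ) * N < m + 1 := Nat.lt_floor_add_one _
  have hmN : m ≤ N := by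
    have : (m : ℝ) ≤ N := hm1.trans (mul_le_of_le_one_left hNpos.le t.2.2)
    exact_mod_cast this
  rw [sum_fin_ite hmN fun k => f ((k + 1 : ℕ) / N)]
  have h1 : ∫ x in (0 : ℝ)..t, f x = (∑ k ∈ Finset.range m,
      ∫ x in ((k : ℕ) / N : ℝ)..((k + 1 : ℕ) / N : ℝ), f x) + ∫ x in (m / N : ℝ)..t, f x := by
    rw [intervalIntegral.sum_integral_adjacent_intervals (a := fun k : ℕ => (k : ℝ) / N)
      fun k _ => hf.intervalIntegrable _ _, Nat.cast_zero, zero_div,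
      intervalIntegral.integral_add_adjacent_intervals (hf.intervalIntegrable _ _)
        (hf.intervalIntegrable _ _)]
  rw [h1, Finset.sum_div, ← sub_sub, ← Finset.sum_sub_distrib]
  have h2 : ‖∑ k ∈ Finset.range m, (f ((k + 1 : ℕ) / N) / N -
      ∫ x in ((k : ℕ) / N : ℝ)..((k + 1 : ℕ) / N : ℝ), f x)‖ ≤ K / N := by
    refine (norm_sum_le_of_le _ (fun k _ => (?_ : _ ≤ K / N * (1 / N)))).trans ?_
    · have hlen : ((k + 1 : ℕ) / N : ℝ) - (k : ℕ) / N = 1 / N := by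
        push_cast; ring
      have h3 := abs_integral_sub_le hf (a := ((k : ℕ) / N : ℝ)) (b := ((k + 1 : ℕ) / N : ℝ))
        (c := f ((k + 1 : ℕ) / N)) (e := K / N) (by rw [← sub_nonneg, hlen]; positivity)
        (fun x hx => by
          refine (hl _ _).trans ?_
          rw [div_eq_mul_one_div K]
          refine mul_le_mul_of_nonneg_left (abs_le.2 ⟨?_, ?_⟩) hK
          · linarith [hx.1]
          · linarith [hx.2, hx.1])
      rw [hlen] at h3
      rw [norm_sub_rev, Real.norm_eq_abs]
      rwa [mul_one_div] at h3
    · rw [Finset.sum_const, Finset.card_range, nsmul_eq_mul]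
      have : (m : ℝ) ≤ N := by exact_mod_cast hmN
      calc (m : ℝ) * (K / N * (1 / N)) ≤ N * (K / N * (1 / N)) := by gcongr
        _ = K / N := by field_simp
  have h3 : ‖∫ x in (m / N : ℝ)..t, f x‖ ≤ K / N := by
    have h4 := intervalIntegral.norm_integral_le_of_norm_le_const (a := (m / N : ℝ)) (b := (t : ℝ))
      (f := f) (C := K) fun x _ => hb x
    refine h4.trans ?_
    rw [div_eq_mul_one_div K]
    refine mul_le_mul_of_nonneg_left ?_ hK
    rw [abs_of_nonneg (by rw [sub_nonneg, div_le_iff₀ hNpos]; exact hm1), le_div_iff₀ hNpos, sub_mul,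
      div_mul_cancel₀ _ hNpos.ne']
    linarith
  calc _ ≤ K / N + K / N := (norm_sub_le _ _).trans (add_le_add h2 h3)
    _ = 2 * K / N := by ring

theorem tendsto_riemann_univ {f : ℝ → ℝ} {K : ℝ} (hK : 0 ≤ K) (hf : Continuous f)
    (hb : ∀ x, |f x| ≤ K) (hl : ∀ x y, |f x - f y| ≤ K * |x - y|) :
    Tendsto (fun N : ℕ => (∑ k : Fin N, f (((k : ℕ) + 1 : ℕ) / N)) / N) atTop
      (𝓝 (∫ x in (0 : ℝ)..1, f x)) := by
  refine (tendsto_riemann hK hf hb hl 1).congr fun N => ?_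
  congr 1
  refine Finset.sum_congr rfl fun k _ => ?_
  rw [if_pos]
  simp

theorem tendsto_riemann_one (t : unitInterval) :
    Tendsto (fun N : ℕ => (∑ k : Fin N, (if (k : ℕ) + 1 ≤ ⌊(t : ℝ) * N⌋₊ then (1 : ℝ) else 0)) / N)
      atTop (𝓝 t) := by
  have := tendsto_riemann (f := fun _ => 1) (K := 1) zero_le_one continuous_const (by simp)
    (by simp) t
  simpa using this

/-! ### Test functions -/

/-- A common bound for a test function, its derivative, and their Lipschitz constants. -/
structure IsTest (φ : ℝ → ℝ) (C : ℝ) : Prop where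
  diff : ContDiff ℝ 2 φ
  supp : tsupport φ ⊆ Set.Ioo 0 1
  bound_pos : 1 ≤ C
  bound : ∀ x, |φ x| ≤ C
  lip : ∀ x y, |φ x - φ y| ≤ C * |x - y|
  bound' : ∀ x, |deriv φ x| ≤ C
  lip' : ∀ x y, |deriv φ x - deriv φ y| ≤ C * |x - y|

theorem exists_isTest {φ : ℝ → ℝ} (hφ : ContDiff ℝ 2 φ) (hs : tsupport φ ⊆ Set.Ioo 0 1) :
    ∃ C, IsTest φ C := by
  have hc : HasCompactSupport φ := HasCompactSupport.of_support_subset_isCompact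
    (isCompact_Icc (a := (0 : ℝ)) (b := 1))
    ((subset_tsupport φ).trans (hs.trans Set.Ioo_subset_Icc_self))
  have hd : ContDiff ℝ 1 (deriv φ) := hφ.deriv' (n := 1)
  obtain ⟨C0, h0⟩ := hc.exists_bound_of_continuous hφ.continuous
  obtain ⟨C1, h1⟩ := hc.deriv.exists_bound_of_continuous hd.continuous
  obtain ⟨K0, hK0⟩ := (hφ.of_le one_le_two).lipschitzWith_of_hasCompactSupport hc one_ne_zero
  obtain ⟨K1, hK1⟩ := hd.lipschitzWith_of_hasCompactSupport hc.deriv one_ne_zero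
  refine ⟨max 1 (max (max C0 C1) (max K0 K1)), hφ, hs, le_max_left _ _, fun x => ?_, fun x y => ?_,
    fun x => ?_, fun x y => ?_⟩
  · refine (h0 x).trans ?_
    simp
  · have := hK0.dist_le_mul x y
    rw [Real.dist_eq, Real.dist_eq] at this
    refine this.trans (mul_le_mul_of_nonneg_right ?_ (abs_nonneg _))
    simp
  · refine (h1 x).trans ?_
    simp
  · have := hK1.dist_le_mul x y
    rw [Real.dist_eq, Real.dist_eq] at this
    refine this.trans (mul_le_mul_of_nonneg_right ?_ (abs_nonneg _))
    simp

theorem norm_exp_sub_le {x : ℝ} (hx : |x| ≤ 1) :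
    ‖Complex.exp (Complex.I * (x : ℂ)) - 1 - (Complex.I * x - x ^ 2 / 2)‖ ≤ |x| ^ 3 := by
  have h1 : ‖Complex.I * (x : ℂ)‖ = |x| := by simp
  have := Complex.exp_bound (x := Complex.I * x) (by rw [h1]; exact hx) (n := 3) (by norm_num)
  rw [h1] at this
  have e : Complex.exp (Complex.I * (x : ℂ)) - 1 - (Complex.I * x - x ^ 2 / 2) =
      Complex.exp (Complex.I * x) - ∑ m ∈ Finset.range 3, (Complex.I * (x : ℂ)) ^ m / m.factorial := by
    simp [Finset.sum_range_succ, mul_pow]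
    ring
  rw [e]
  refine this.trans (mul_le_of_le_one_right (by positivity) ?_)
  norm_num [Nat.factorial]

theorem norm_exp_sub_le' (x : ℝ) :
    ‖Complex.exp (Complex.I * (x : ℂ)) - 1‖ ≤ |x| := by
  simpa using Real.norm_exp_I_mul_ofReal_sub_one_le (x := x)

/-- The cell averages of a test function. -/
def cellAvg (φ : ℝ → ℝ) (N k : ℕ) : ℝ := N * ∫ x in ((k : ℕ) / N : ℝ)..((k + 1 : ℕ) / N : ℝ), φ x

namespace IsTest
variable {φ : ℝ → ℝ} {C : ℝ} (hφ : IsTest φ C)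
include hφ

theorem continuous : Continuous φ := hφ.diff.continuous

theorem nonneg : 0 ≤ C := zero_le_one.trans hφ.bound_pos

theorem contDiff_deriv : ContDiff ℝ 1 (deriv φ) := hφ.diff.deriv' (n := 1)

theorem hasDerivAt (x : ℝ) : HasDerivAt φ (deriv φ x) x :=
  (hφ.diff.differentiable (by norm_num) x).hasDerivAt

theorem eq_zero_of_one_le {x : ℝ} (hx : 1 ≤ x) : φ x = 0 :=
  image_eq_zero_of_notMem_tsupport fun h => not_lt.2 hx (hφ.supp h).2

theorem eq_zero_of_le_zero {x : ℝ} (hx : x ≤ 0) : φ x = 0 :=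
  image_eq_zero_of_notMem_tsupport fun h => not_lt.2 hx (hφ.supp h).1

theorem cellAvg_sub_le {N : ℕ} (hN : 0 < N) (k : ℕ) :
    |cellAvg φ N k - φ ((k + 1 : ℕ) / N)| ≤ C / N := by
  have hNpos : (0 : ℝ) < N := by exact_mod_cast hN
  have hlen : ((k + 1 : ℕ) / N : ℝ) - (k : ℕ) / N = 1 / N := by
    push_cast; ring
  have h3 := abs_integral_sub_le hφ.continuous (a := ((k : ℕ) / N : ℝ)) (b := ((k + 1 : ℕ) / N : ℝ))
    (c := φ ((k + 1 : ℕ) / N)) (e := C / N) (by rw [← sub_nonneg, hlen]; positivity)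
    (fun x hx => by
      refine (hφ.lip _ _).trans ?_
      rw [div_eq_mul_one_div C]
      refine mul_le_mul_of_nonneg_left (abs_le.2 ⟨?_, ?_⟩) hφ.nonneg
      · linarith [hx.1]
      · linarith [hx.2, hx.1])
  rw [hlen] at h3
  have e : cellAvg φ N k - φ ((k + 1 : ℕ) / N) = N * ((∫ x in ((k : ℕ) / N : ℝ)..((k + 1 : ℕ) / N : ℝ),
      φ x) - φ ((k + 1 : ℕ) / N) * (1 / N)) := by
    rw [cellAvg]; field_simp
  rw [e, abs_mul, abs_of_pos hNpos]
  calc (N : ℝ) * _ ≤ N * (C / N * (1 / N)) := by gcongr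
    _ = C / N := by field_simp

theorem abs_cellAvg_le {N : ℕ} (hN : 0 < N) (k : ℕ) : |cellAvg φ N k| ≤ C := by
  have hNpos : (0 : ℝ) < N := by exact_mod_cast hN
  have hlen : ((k + 1 : ℕ) / N : ℝ) - (k : ℕ) / N = 1 / N := by
    push_cast; ring
  have h3 := abs_integral_sub_le hφ.continuous (a := ((k : ℕ) / N : ℝ)) (b := ((k + 1 : ℕ) / N : ℝ))
    (c := 0) (e := C) (by rw [← sub_nonneg, hlen]; positivity)
    (fun x _ => by rw [sub_zero]; exact hφ.bound x)
  rw [hlen, zero_mul, sub_zero] at h3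
  rw [cellAvg, abs_mul, abs_of_pos hNpos]
  calc (N : ℝ) * _ ≤ N * (C * (1 / N)) := by gcongr
    _ = C := by field_simp

/-- A difference of neighbouring cell averages is the average over one cell of `φ(x + 1/N) - φ(x)`,
itself an integral of `φ'` within `1/N` of the common endpoint; the Lipschitz bound on `φ'` then
gains the factor `1/N`. -/
theorem cellAvg_succ_sub_le {N : ℕ} (hN : 0 < N) (k : ℕ) :
    |N * (cellAvg φ N (k + 1) - cellAvg φ N k) - deriv φ ((k + 1 : ℕ) / N)| ≤ C / N := by
  have hNpos : (0 : ℝ) < N := by exact_mod_cast hN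
  have hc := hφ.continuous
  have hlen : ((k + 1 : ℕ) / N : ℝ) - (k : ℕ) / N = 1 / N := by
    push_cast; ring
  set y : ℝ := (k + 1 : ℕ) / N with hy
  have hy' : ((k : ℕ) : ℝ) / N = y - 1 / N := by linarith
  have hy2 : ((k + 1 + 1 : ℕ) : ℝ) / N = y + 1 / N := by rw [hy]; push_cast; ring
  have h1N : (0 : ℝ) < 1 / N := by positivity
  have hshift : ∫ x in y..(y + 1 / N), φ x = ∫ x in (y - 1 / N)..y, φ (x + 1 / N) := by
    rw [intervalIntegral.integral_comp_add_right (fun x => φ x), sub_add_cancel]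
  have hpt : ∀ x ∈ Set.Icc (y - 1 / N) y, |(φ (x + 1 / N) - φ x) - deriv φ y * (1 / N)|
      ≤ C / N * (1 / N) := by
    intro x hx
    have h1 := abs_integral_sub_le hφ.contDiff_deriv.continuous (a := x) (b := x + 1 / N)
      (c := deriv φ y) (e := C / N) (by linarith) (fun s hs => by
        refine (hφ.lip' _ _).trans ?_
        rw [div_eq_mul_one_div C]
        refine mul_le_mul_of_nonneg_left (abs_le.2 ⟨?_, ?_⟩) hφ.nonneg
        · linarith [hx.1, hs.1]
        · linarith [hx.2, hs.2])
    rw [intervalIntegral.integral_eq_sub_of_hasDerivAt (fun s _ => hφ.hasDerivAt s)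
      (hφ.contDiff_deriv.continuous.intervalIntegrable _ _), add_sub_cancel_left] at h1
    exact h1
  have hc2 : Continuous fun x => φ (x + 1 / N) - φ x := by fun_prop
  have h4 := abs_integral_sub_le hc2 (by linarith) hpt
  rw [intervalIntegral.integral_sub
    ((by fun_prop : Continuous fun x => φ (x + 1 / N)).intervalIntegrable _ _) (hc.intervalIntegrable _ _),
    ← hshift, sub_sub_cancel] at h4
  have e : N * (cellAvg φ N (k + 1) - cellAvg φ N k) - deriv φ y = N * N *
      (((∫ x in y..(y + 1 / N), φ x) - ∫ x in (y - 1 / N)..y, φ x) -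
        deriv φ y * (1 / N) * (1 / N)) := by
    rw [cellAvg, cellAvg, hy', ← hy, hy2]; field_simp
  rw [e, abs_mul, abs_of_pos (by positivity)]
  calc (N : ℝ) * N * _ ≤ N * N * (C / N * (1 / N) * (1 / N)) := by gcongr
    _ = C / N := by field_simp

/-- Cell `N` lies to the right of 1, beyond the support. With cell `0` below, this removes the
boundary terms due to the missing neighbours of the end sites. -/
theorem cellAvg_self {N : ℕ} (hN : 0 < N) : cellAvg φ N N = 0 := by
  have hNpos : (0 : ℝ) < N := by exact_mod_cast hN
  have : ∫ x in ((N : ℕ) / N : ℝ)..((N + 1 : ℕ) / N : ℝ), φ x = 0 := by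
    rw [intervalIntegral.integral_congr (g := fun _ => 0), intervalIntegral.integral_zero]
    intro x hx
    rw [div_self hNpos.ne', Set.uIcc_of_le (by rw [one_le_div hNpos]; push_cast; linarith)] at hx
    exact hφ.eq_zero_of_one_le hx.1
  rw [cellAvg, this, mul_zero]

/-- The support stays at positive distance from 0, so the first cell misses it once `N` is large. -/
theorem eventually_cellAvg_zero : ∀ᶠ N : ℕ in atTop, cellAvg φ N 0 = 0 := by
  have h0 : (0 : ℝ) ∉ tsupport φ := fun h => lt_irrefl _ (hφ.supp h).1
  have h1 : ∀ᶠ x in 𝓝 (0 : ℝ), φ x = 0 := by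
    filter_upwards [(isClosed_tsupport φ).isOpen_compl.mem_nhds h0] with x hx
    exact image_eq_zero_of_notMem_tsupport hx
  obtain ⟨r, hr, hball⟩ := Metric.eventually_nhds_iff.1 h1
  have h2 : Tendsto (fun N : ℕ => 1 / (N : ℝ)) atTop (𝓝 0) := tendsto_one_div_atTop_nhds_zero_nat
  filter_upwards [h2.eventually_lt_const hr] with N hN
  have : ∫ x in ((0 : ℕ) / N : ℝ)..((0 + 1 : ℕ) / N : ℝ), φ x = 0 := by
    rw [intervalIntegral.integral_congr (g := fun _ => 0), intervalIntegral.integral_zero]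
    intro x hx
    rw [Nat.cast_zero, zero_div, zero_add, Nat.cast_one, Set.uIcc_of_le (by positivity)] at hx
    refine hball ?_
    rw [Real.dist_eq, sub_zero, abs_of_nonneg hx.1]
    exact hx.2.trans_lt hN
  rw [cellAvg, this, mul_zero]

end IsTest

end

/-! ### Expansion of the coefficients of the rates in the density -/

section


/-- The coefficient of `τ (n i)` in the density `𝓛_N ψ_φ / ψ_φ`. -/
def rateCoeff (φ : ℝ → ℝ) (N : ℕ) (i : Fin N) : ℂ :=
  jumpCoeff N (fun k => (∫ x in (((k : ℕ) + 1 : ℕ) / N : ℝ)..1, φ x) / √N) i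

/-- Jumps to the right and to the left change the pairing by a cell integral. An end site lacks one
neighbour, but the corresponding term here is `exp 0 - 1 = 0`, so one formula serves all sites. -/
theorem rateCoeff_eq {φ : ℝ → ℝ} (hφ : Continuous φ) {N : ℕ} (hN : 0 < N)
    (h0 : cellAvg φ N 0 = 0) (h1 : cellAvg φ N N = 0) (i : Fin N) :
    rateCoeff φ N i = ((N : ℝ) ^ 2 / 2 : ℝ) *
      ((Complex.exp (Complex.I * ((-(cellAvg φ N (i + 1) / (N * √N)) : ℝ) : ℂ)) - 1) +
        (Complex.exp (Complex.I * ((cellAvg φ N i / (N * √N) : ℝ) : ℂ)) - 1)) := by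
  have hNpos : (0 : ℝ) < N := by exact_mod_cast hN
  have hs : 0 < √(N : ℝ) := Real.sqrt_pos.2 hNpos
  have hstep (k : ℕ) : (∫ x in ((k + 1 + 1 : ℕ) / N : ℝ)..1, φ x) / √N -
      (∫ x in ((k + 1 : ℕ) / N : ℝ)..1, φ x) / √N = -(cellAvg φ N (k + 1) / (N * √N)) := by
    rw [cellAvg, ← intervalIntegral.integral_add_adjacent_intervals (a := ((k + 1 : ℕ) / N : ℝ))
      (b := ((k + 1 + 1 : ℕ) / N : ℝ)) (c := 1) (hφ.intervalIntegrable _ _)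
      (hφ.intervalIntegrable _ _)]
    field_simp
    ring
  rw [rateCoeff, jumpCoeff]
  have e1 := Fin.sum_univ_eq_sum_range (fun j : ℕ => if (i : ℕ) + 1 = j ∨ j + 1 = i then
    (((N : ℝ) ^ 2 / 2 : ℝ) : ℂ) * (Complex.exp (Complex.I *
      (((∫ x in ((j + 1 : ℕ) / N : ℝ)..1, φ x) / √N -
        (∫ x in (((i : ℕ) + 1 : ℕ) / N : ℝ)..1, φ x) / √N : ℝ) : ℂ)) - 1) else 0) N
  rw [e1]
  have hi := i.2
  generalize (i : ℕ) = k at hi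
  have e2 (j : ℕ) (f : ℂ) : (if k + 1 = j ∨ j + 1 = k then f else 0) =
      (if k + 1 = j then f else 0) + (if j + 1 = k then f else 0) := by
    split_ifs <;> first | omega | simp_all
  simp_rw [e2]
  rw [Finset.sum_add_distrib, mul_add]
  congr 1
  · rw [Finset.sum_ite_eq]
    split_ifs with h
    · rw [hstep]
    · have : k + 1 = N := by
        rw [Finset.mem_range] at h; omega
      rw [this, h1]; simp
  · rcases k with _ | k
    · rw [h0]; simp
    · simp_rw [add_left_inj]
      rw [Finset.sum_ite_eq', if_pos (by rw [Finset.mem_range]; omega), ← neg_sub (_ / √(N : ℝ)) (_ / √(N : ℝ)), hstep, neg_neg]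

namespace IsTest
variable {φ : ℝ → ℝ} {C : ℝ} (hφ : IsTest φ C)
include hφ

/-- Second-order expansion of the two exponentials: the linear terms combine into a discrete
gradient of `φ`, the quadratic ones into `φ²`. The error `N^{-3/2}` per site is still small after
summation over `N` sites. -/
theorem norm_rateCoeff_sub_le {N : ℕ} (hN : C ≤ N) (h0 : cellAvg φ N 0 = 0) (i : Fin N) :
    ‖rateCoeff φ N i - (-(Complex.I / 2) * ((deriv φ (((i : ℕ) + 1 : ℕ) / N) / √N : ℝ) : ℂ) -
      ((φ (((i : ℕ) + 1 : ℕ) / N) ^ 2 / (2 * N) : ℝ) : ℂ))‖ ≤ 4 * C ^ 3 / (N * √N) := by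
  have hC := hφ.bound_pos
  have hNpos : (0 : ℝ) < N := by linarith
  have hN1 : (1 : ℝ) ≤ N := by linarith
  have hN' : 0 < N := by exact_mod_cast hNpos
  -- With `N = s²` all powers of `√N` become polynomial identities in `s`.
  obtain ⟨s, hs, hsN⟩ : ∃ s : ℝ, 0 < s ∧ (N : ℝ) = s ^ 2 :=
    ⟨√N, Real.sqrt_pos.2 hNpos, (Real.sq_sqrt hNpos.le).symm⟩
  have hss : √(N : ℝ) = s := by rw [hsN, Real.sqrt_sq hs.le]
  have hs1 : 1 ≤ s := by nlinarith
  rw [rateCoeff_eq hφ.continuous hN' h0 (hφ.cellAvg_self hN') i]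
  have a1 := hφ.cellAvg_succ_sub_le hN' i
  have a2 := hφ.cellAvg_sub_le hN' i
  have a3 := hφ.cellAvg_sub_le hN' (i + 1)
  have a4 := hφ.abs_cellAvg_le hN' i
  have a5 := hφ.abs_cellAvg_le hN' (i + 1)
  have a6 := hφ.bound (((i : ℕ) + 1 : ℕ) / N)
  have a7 := hφ.lip (((i : ℕ) + 1 + 1 : ℕ) / N) (((i : ℕ) + 1 : ℕ) / N)
  have hx : (((i : ℕ) + 1 + 1 : ℕ) / N - ((i : ℕ) + 1 : ℕ) / N : ℝ) = 1 / N := by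
    push_cast; ring
  rw [hx, abs_of_pos (by positivity : (0 : ℝ) < 1 / N), mul_one_div] at a7
  set f := φ (((i : ℕ) + 1 : ℕ) / N)
  set f' := φ (((i : ℕ) + 1 + 1 : ℕ) / N)
  set d := deriv φ (((i : ℕ) + 1 : ℕ) / N)
  set v := cellAvg φ N i
  set v' := cellAvg φ N (i + 1)
  rw [hss, hsN]
  rw [hsN] at a1 a2 a3 a7
  have hsmall (w : ℝ) (hw : |w| ≤ C) : |w / (s ^ 2 * s)| ≤ C / s ^ 3 := by
    rw [abs_div, abs_of_pos (by positivity : 0 < s ^ 2 * s), pow_succ s 2]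
    gcongr
  have hC1 : C / s ^ 3 ≤ 1 := by
    rw [div_le_one (by positivity)]
    calc C ≤ s ^ 2 := hsN ▸ hN
      _ ≤ s ^ 3 := pow_le_pow_right₀ hs1 (by norm_num)
  have b1 := norm_exp_sub_le (x := v / (s ^ 2 * s)) ((hsmall v a4).trans hC1)
  have b2 := norm_exp_sub_le (x := -(v' / (s ^ 2 * s))) (by
    rw [abs_neg]; exact (hsmall v' a5).trans hC1)
  have b1' := b1.trans (pow_le_pow_left₀ (abs_nonneg _) (hsmall v a4) 3)
  have b2' := b2.trans (pow_le_pow_left₀ (abs_nonneg _) ((abs_neg _).trans_le (hsmall v' a5)) 3)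
  set E1 := Complex.exp (Complex.I * ((v / (s ^ 2 * s) : ℝ) : ℂ))
  set E2 := Complex.exp (Complex.I * ((-(v' / (s ^ 2 * s)) : ℝ) : ℂ))
  have hsC : (s : ℂ) ≠ 0 := by exact_mod_cast hs.ne'
  have key : (((s ^ 2) ^ 2 / 2 : ℝ) : ℂ) * ((E2 - 1) + (E1 - 1)) -
      (-(Complex.I / 2) * ((d / s : ℝ) : ℂ) - ((f ^ 2 / (2 * s ^ 2) : ℝ) : ℂ)) =
      (((s ^ 2) ^ 2 / 2 : ℝ) : ℂ) * (E2 - 1 - (Complex.I * ((-(v' / (s ^ 2 * s)) : ℝ) : ℂ) -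
        ((-(v' / (s ^ 2 * s)) : ℝ) : ℂ) ^ 2 / 2)) +
      (((s ^ 2) ^ 2 / 2 : ℝ) : ℂ) * (E1 - 1 - (Complex.I * ((v / (s ^ 2 * s) : ℝ) : ℂ) -
        ((v / (s ^ 2 * s) : ℝ) : ℂ) ^ 2 / 2)) +
      ((-(Complex.I / 2) * (((s ^ 2 * (v' - v) - d) / s : ℝ) : ℂ)) +
       (((f ^ 2 - v ^ 2 + (f ^ 2 - v' ^ 2)) / (4 * s ^ 2) : ℝ) : ℂ)) := by
    push_cast
    field_simp
    ring
  rw [key]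
  have c1 : ‖(((s ^ 2) ^ 2 / 2 : ℝ) : ℂ)‖ = (s ^ 2) ^ 2 / 2 := by
    rw [Complex.norm_real, Real.norm_eq_abs, abs_of_nonneg (by positivity)]
  have c2 : ‖-(Complex.I / 2) * (((s ^ 2 * (v' - v) - d) / s : ℝ) : ℂ)‖ ≤ C / s ^ 2 / s / 2 := by
    rw [norm_mul, norm_neg, norm_div, Complex.norm_I, Complex.norm_real, Real.norm_eq_abs, abs_div,
      abs_of_pos hs]
    simp only [Complex.norm_ofNat]
    calc 1 / 2 * (|s ^ 2 * (v' - v) - d| / s) ≤ 1 / 2 * (C / s ^ 2 / s) := by gcongr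
      _ = C / s ^ 2 / s / 2 := by ring
  have hCs : 0 ≤ C / s ^ 2 := by positivity
  have sqb (w : ℝ) (hw : |w| ≤ C) (e : ℝ) (he : |w - f| ≤ e) : |f ^ 2 - w ^ 2| ≤ 2 * C * e := by
    have : f ^ 2 - w ^ 2 = -((f + w) * (w - f)) := by ring
    rw [this, abs_neg, abs_mul]
    have := abs_add_le f w
    gcongr
    linarith
  have c3 : ‖(((f ^ 2 - v ^ 2 + (f ^ 2 - v' ^ 2)) / (4 * s ^ 2) : ℝ) : ℂ)‖ ≤
      (2 * C * (C / s ^ 2) + 2 * C * (C / s ^ 2 + C / s ^ 2)) / (4 * s ^ 2) := by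
    rw [Complex.norm_real, Real.norm_eq_abs, abs_div, abs_of_pos (by positivity : 0 < 4 * s ^ 2)]
    gcongr
    refine (abs_add_le _ _).trans (add_le_add (sqb v a4 _ a2) (sqb v' a5 _ ?_))
    exact (abs_sub_le v' f' f).trans (add_le_add a3 a7)
  calc _ ≤ (s ^ 2) ^ 2 / 2 * (C / s ^ 3) ^ 3 + (s ^ 2) ^ 2 / 2 * (C / s ^ 3) ^ 3 +
        (C / s ^ 2 / s / 2 + (2 * C * (C / s ^ 2) + 2 * C * (C / s ^ 2 + C / s ^ 2)) / (4 * s ^ 2)) := by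
        refine (norm_add_le _ _).trans (add_le_add ((norm_add_le _ _).trans (add_le_add ?_ ?_))
          ((norm_add_le _ _).trans (add_le_add c2 c3)))
        · rw [norm_mul, c1]; gcongr
        · rw [norm_mul, c1]; gcongr
    _ = (C ^ 3 * (1 / s ^ 2) + C / 2 + 3 / 2 * C ^ 2 * (1 / s)) / (s ^ 2 * s) := by
        field_simp; ring
    -- `C ≥ 1` and `s ≥ 1` reduce every term to a multiple of `C ^ 3`; the total 3 is rounded up to
    -- 4.
    _ ≤ (C ^ 3 * 1 + C ^ 3 / 2 + 3 / 2 * C ^ 3 * 1) / (s ^ 2 * s) := by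
        have d1 : 1 / s ^ 2 ≤ 1 := by
          rw [div_le_one (by positivity)]; exact one_le_pow₀ hs1
        have d2 : 1 / s ≤ 1 := by rw [div_le_one hs]; exact hs1
        have d3 : C ≤ C ^ 3 := le_self_pow₀ hC (by norm_num)
        have d4 : C ^ 2 ≤ C ^ 3 := pow_le_pow_right₀ hC (by norm_num)
        gcongr
    _ ≤ 4 * C ^ 3 / (s ^ 2 * s) := by
        gcongr
        have : 0 < C ^ 3 := by positivity
        linarith

theorem norm_rateCoeff_le {N : ℕ} (hN : C ≤ N) (h0 : cellAvg φ N 0 = 0) (i : Fin N) :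
    ‖rateCoeff φ N i‖ ≤ 5 * C ^ 3 / √N := by
  have hC := hφ.bound_pos
  have hNpos : (0 : ℝ) < N := by linarith
  have hN1 : (1 : ℝ) ≤ N := by linarith
  have hs1 : 1 ≤ √(N : ℝ) := Real.one_le_sqrt.2 hN1
  have h := hφ.norm_rateCoeff_sub_le hN h0 i
  have a1 : ‖-(Complex.I / 2) * ((deriv φ (((i : ℕ) + 1 : ℕ) / N) / √N : ℝ) : ℂ)‖ ≤ C / √N / 2 := by
    rw [norm_mul, norm_neg, norm_div, Complex.norm_I, Complex.norm_real, Real.norm_eq_abs, abs_div,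
      abs_of_pos (by positivity : 0 < √(N : ℝ))]
    simp only [Complex.norm_ofNat]
    have := hφ.bound' (((i : ℕ) + 1 : ℕ) / N)
    calc 1 / 2 * (|deriv φ (((i : ℕ) + 1 : ℕ) / N)| / √N) ≤ 1 / 2 * (C / √N) := by gcongr
      _ = _ := by ring
  have a2 : ‖((φ (((i : ℕ) + 1 : ℕ) / N) ^ 2 / (2 * N) : ℝ) : ℂ)‖ ≤ C ^ 2 / (2 * √N) := by
    rw [Complex.norm_real, Real.norm_eq_abs, abs_of_nonneg (by positivity), ← sq_abs]
    have := hφ.bound (((i : ℕ) + 1 : ℕ) / N)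
    gcongr
    exact Real.sqrt_le_iff.2 ⟨hNpos.le, le_self_pow₀ hN1 (by norm_num)⟩
  have a3 : 4 * C ^ 3 / (N * √N) ≤ 4 * C ^ 3 / √N := by
    gcongr
    exact le_mul_of_one_le_left (by positivity) hN1
  have := norm_le_norm_sub_add (rateCoeff φ N i)
    (-(Complex.I / 2) * ((deriv φ (((i : ℕ) + 1 : ℕ) / N) / √N : ℝ) : ℂ) -
      ((φ (((i : ℕ) + 1 : ℕ) / N) ^ 2 / (2 * N) : ℝ) : ℂ))
  have h2 := norm_sub_le (-(Complex.I / 2) * ((deriv φ (((i : ℕ) + 1 : ℕ) / N) / √N : ℝ) : ℂ))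
    ((φ (((i : ℕ) + 1 : ℕ) / N) ^ 2 / (2 * N) : ℝ) : ℂ)
  calc _ ≤ 4 * C ^ 3 / √N + (C / √N / 2 + C ^ 2 / (2 * √N)) := by linarith
    _ = (4 * C ^ 3 + C / 2 + C ^ 2 / 2) / √N := by field_simp; ring
    _ ≤ _ := by
        have d3 : C ≤ C ^ 3 := le_self_pow₀ hC (by norm_num)
        have d4 : C ^ 2 ≤ C ^ 3 := pow_le_pow_right₀ hC (by norm_num)
        gcongr
        linarith

/-- The discrete gradients telescope to zero between the two empty boundary cells, so only their `N`
errors of size `C/N` remain. This bounds the otherwise dangerous sum of the terms of order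
`N^{-1/2}`. -/
theorem abs_sum_deriv_le {N : ℕ} (hN : 0 < N) (h0 : cellAvg φ N 0 = 0) :
    |∑ i : Fin N, deriv φ (((i : ℕ) + 1 : ℕ) / N)| ≤ C := by
  have hNpos : (0 : ℝ) < N := by exact_mod_cast hN
  rw [Fin.sum_univ_eq_sum_range (fun i => deriv φ ((i + 1 : ℕ) / N)) N]
  have h1 : ∑ i ∈ Finset.range N, N * (cellAvg φ N (i + 1) - cellAvg φ N i) = 0 := by
    rw [← Finset.mul_sum, Finset.sum_range_sub, hφ.cellAvg_self hN, h0]; simp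
  rw [← sub_zero (∑ i ∈ Finset.range N, deriv φ _), ← h1, ← Finset.sum_sub_distrib]
  refine (Finset.abs_sum_le_sum_abs _ _).trans ((Finset.sum_le_sum fun i _ =>
    (abs_sub_comm _ _).trans_le (hφ.cellAvg_succ_sub_le hN i)).trans ?_)
  rw [Finset.sum_const, Finset.card_range, nsmul_eq_mul, mul_div_cancel₀ _ hNpos.ne']

theorem eventually_le : ∀ᶠ N : ℕ in atTop, 0 < N ∧ C ≤ N ∧ cellAvg φ N 0 = 0 := by
  filter_upwards [eventually_gt_atTop 0, hφ.eventually_cellAvg_zero,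
    tendsto_natCast_atTop_atTop.eventually_ge_atTop C] with N h1 h2 h3
  exact ⟨h1, h3, h2⟩

/-- The new term of order `1/N` is the product of `-(i/2) φ'/√N` with the linear part `it/√N` of the
phase: it equals `t φ'/(2N)`, real because `i² = -1`. This cross term produces the drift. -/
theorem norm_rateCoeff_mul_exp_sub_le {N : ℕ} (hN : C ≤ N) (h0 : cellAvg φ N 0 = 0) (i : Fin N)
    {t T : ℝ} (hT : 1 ≤ T) (ht : |t| ≤ T) (hTN : T ≤ √N) :
    ‖rateCoeff φ N i * Complex.exp (Complex.I * ((t / √N : ℝ) : ℂ)) -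
      (-(Complex.I / 2) * ((deriv φ (((i : ℕ) + 1 : ℕ) / N) / √N : ℝ) : ℂ) +
        ((t * deriv φ (((i : ℕ) + 1 : ℕ) / N) / N / 2 : ℝ) : ℂ) -
        ((φ (((i : ℕ) + 1 : ℕ) / N) ^ 2 / N / 2 : ℝ) : ℂ))‖ ≤ 6 * C ^ 3 * T ^ 2 / (N * √N) := by
  have hC := hφ.bound_pos
  have hNpos : (0 : ℝ) < N := by linarith
  have h := hφ.norm_rateCoeff_sub_le hN h0 i
  have a6 := hφ.bound (((i : ℕ) + 1 : ℕ) / N)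
  have a7 := hφ.bound' (((i : ℕ) + 1 : ℕ) / N)
  obtain ⟨s, hs, hsN⟩ : ∃ s : ℝ, 0 < s ∧ (N : ℝ) = s ^ 2 :=
    ⟨√N, Real.sqrt_pos.2 hNpos, (Real.sq_sqrt hNpos.le).symm⟩
  have hss : √(N : ℝ) = s := by rw [hsN, Real.sqrt_sq hs.le]
  set f := φ (((i : ℕ) + 1 : ℕ) / N)
  set d := deriv φ (((i : ℕ) + 1 : ℕ) / N)
  set z := rateCoeff φ N i
  rw [hss] at h hTN ⊢
  rw [hsN] at h ⊢
  have hx : |t / s| ≤ T / s := by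
    rw [abs_div, abs_of_pos hs]; gcongr
  have hx1 : |t / s| ≤ 1 := hx.trans ((div_le_one hs).2 hTN)
  have b1 := norm_exp_sub_le hx1
  have b2 := norm_exp_sub_le' (t / s)
  have b3 : ‖Complex.exp (Complex.I * ((t / s : ℝ) : ℂ))‖ = 1 := by
    rw [mul_comm]; exact Complex.norm_exp_ofReal_mul_I _
  have b4 : ‖Complex.exp (Complex.I * ((t / s : ℝ) : ℂ)) - 1 - Complex.I * ((t / s : ℝ) : ℂ)‖ ≤
      3 / 2 * (T / s) ^ 2 := by
    have e : Complex.exp (Complex.I * ((t / s : ℝ) : ℂ)) - 1 - Complex.I * ((t / s : ℝ) : ℂ) =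
      (Complex.exp (Complex.I * ((t / s : ℝ) : ℂ)) - 1 - (Complex.I * ((t / s : ℝ) : ℂ) -
        ((t / s : ℝ) : ℂ) ^ 2 / 2)) + (-((((t / s) ^ 2 / 2 : ℝ)) : ℂ)) := by push_cast; ring
    rw [e]
    have h1 : ‖-((((t / s) ^ 2 / 2 : ℝ)) : ℂ)‖ = |t / s| ^ 2 / 2 := by
      rw [norm_neg, Complex.norm_real, Real.norm_eq_abs, abs_of_nonneg (by positivity), sq_abs]
    have h2 : |t / s| ^ 3 ≤ |t / s| ^ 2 := pow_le_pow_of_le_one (abs_nonneg _) hx1 (by norm_num)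
    have h3 : |t / s| ^ 2 ≤ (T / s) ^ 2 := pow_le_pow_left₀ (abs_nonneg _) hx 2
    refine (norm_add_le _ _).trans ?_
    rw [h1]
    linarith
  set e := Complex.exp (Complex.I * ((t / s : ℝ) : ℂ))
  have hsC : (s : ℂ) ≠ 0 := by exact_mod_cast hs.ne'
  have key : z * e - (-(Complex.I / 2) * ((d / s : ℝ) : ℂ) + ((t * d / s ^ 2 / 2 : ℝ) : ℂ) -
      ((f ^ 2 / s ^ 2 / 2 : ℝ) : ℂ)) =
      (z - (-(Complex.I / 2) * ((d / s : ℝ) : ℂ) - ((f ^ 2 / (2 * s ^ 2) : ℝ) : ℂ))) * e +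
      (-(Complex.I / 2) * ((d / s : ℝ) : ℂ)) * (e - 1 - Complex.I * ((t / s : ℝ) : ℂ)) -
      ((f ^ 2 / (2 * s ^ 2) : ℝ) : ℂ) * (e - 1) := by
    push_cast
    field_simp
    ring_nf
    rw [Complex.I_sq]
    ring
  rw [key]
  have c1 : ‖-(Complex.I / 2) * ((d / s : ℝ) : ℂ)‖ ≤ C / s / 2 := by
    rw [norm_mul, norm_neg, norm_div, Complex.norm_I, Complex.norm_real, Real.norm_eq_abs, abs_div,
      abs_of_pos hs]
    simp only [Complex.norm_ofNat]
    calc 1 / 2 * (|d| / s) ≤ 1 / 2 * (C / s) := by gcongr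
      _ = _ := by ring
  have c2 : ‖((f ^ 2 / (2 * s ^ 2) : ℝ) : ℂ)‖ ≤ C ^ 2 / (2 * s ^ 2) := by
    rw [Complex.norm_real, Real.norm_eq_abs, abs_of_nonneg (by positivity), ← sq_abs]
    gcongr
  calc _ ≤ 4 * C ^ 3 / (s ^ 2 * s) * 1 + C / s / 2 * (3 / 2 * (T / s) ^ 2) +
        C ^ 2 / (2 * s ^ 2) * (T / s) := by
        refine (norm_sub_le _ _).trans (add_le_add ((norm_add_le _ _).trans (add_le_add ?_ ?_)) ?_)
        · rw [norm_mul, b3]; gcongr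
        · rw [norm_mul]; gcongr
        · rw [norm_mul]
          have := b2.trans hx
          gcongr
    _ = (4 * (C ^ 3 * 1) + 3 / 4 * (C * T ^ 2) + 1 / 2 * (C ^ 2 * T)) / (s ^ 2 * s) := by
        field_simp
        ring
    _ ≤ (4 * (C ^ 3 * T ^ 2) + 3 / 4 * (C ^ 3 * T ^ 2) + 1 / 2 * (C ^ 3 * T ^ 2)) / (s ^ 2 * s) := by
        have d3 : C ≤ C ^ 3 := le_self_pow₀ hC (by norm_num)
        have d4 : C ^ 2 ≤ C ^ 3 := pow_le_pow_right₀ hC (by norm_num)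
        have d5 : 1 ≤ T ^ 2 := one_le_pow₀ hT
        have d6 : T ≤ T ^ 2 := le_self_pow₀ hT (by norm_num)
        gcongr
    _ ≤ _ := by
        gcongr
        have : 0 < C ^ 3 * T ^ 2 := by positivity
        linarith

/-- The terms in `N^{-1/2} φ'` sum to `O(N^{-1/2})` by `abs_sum_deriv_le`; the cross terms and the
terms in `φ²` are Riemann sums. -/
theorem tendsto_sum_rateCoeff {θ : ∀ N : ℕ, Fin N → ℝ} {T L : ℝ} (hθ : ∀ N i, |θ N i| ≤ T)
    (hL : Tendsto (fun N : ℕ => (∑ i, θ N i * deriv φ (((i : ℕ) + 1 : ℕ) / N)) / N) atTop (𝓝 L)) :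
    Tendsto (fun N : ℕ => ∑ i, rateCoeff φ N i * Complex.exp (Complex.I * ((θ N i / √N : ℝ) : ℂ)))
      atTop (𝓝 ((L / 2 - (∫ x in (0 : ℝ)..1, φ x ^ 2) / 2 : ℝ) : ℂ)) := by
  have hC := hφ.bound_pos
  -- Enlarging the bound `T` is free, and `T ≥ 1` allows all error terms to be stated with `T ^ 2`.
  wlog hT : 1 ≤ T generalizing T
  · exact this (T := max T 1) (fun N i => (hθ N i).trans (le_max_left _ _)) (le_max_right _ _)
  have hsq : Tendsto (fun N : ℕ => (∑ i : Fin N, φ (((i : ℕ) + 1 : ℕ) / N) ^ 2) / N) atTop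
      (𝓝 (∫ x in (0 : ℝ)..1, φ x ^ 2)) := by
    refine tendsto_riemann_univ (f := fun x => φ x ^ 2) (K := 2 * C ^ 2) (by positivity)
      (hφ.continuous.pow 2) (fun x => ?_) fun x y => ?_
    · rw [abs_of_nonneg (sq_nonneg _), ← sq_abs]
      have := pow_le_pow_left₀ (abs_nonneg _) (hφ.bound x) 2
      nlinarith
    · have e : φ x ^ 2 - φ y ^ 2 = (φ x + φ y) * (φ x - φ y) := by ring
      rw [e, abs_mul]
      calc _ ≤ (2 * C) * (C * |x - y|) := by
            have := (abs_add_le (φ x) (φ y)).trans (add_le_add (hφ.bound x) (hφ.bound y))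
            gcongr
            · linarith
            · exact hφ.lip x y
        _ = _ := by ring
  have hsqrt : Tendsto (fun N : ℕ => √(N : ℝ)) atTop atTop :=
    Real.tendsto_sqrt_atTop.comp tendsto_natCast_atTop_atTop
  have hmain : Tendsto (fun N : ℕ => ((((∑ i, θ N i * deriv φ (((i : ℕ) + 1 : ℕ) / N)) / N) / 2 -
      ((∑ i : Fin N, φ (((i : ℕ) + 1 : ℕ) / N) ^ 2) / N) / 2 : ℝ) : ℂ)) atTop
      (𝓝 ((L / 2 - (∫ x in (0 : ℝ)..1, φ x ^ 2) / 2 : ℝ) : ℂ)) :=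
    (Complex.continuous_ofReal.tendsto _).comp ((hL.div_const 2).sub (hsq.div_const 2))
  have herr : Tendsto (fun N : ℕ => (∑ i, rateCoeff φ N i *
      Complex.exp (Complex.I * ((θ N i / √N : ℝ) : ℂ))) -
      ((((∑ i, θ N i * deriv φ (((i : ℕ) + 1 : ℕ) / N)) / N) / 2 -
      ((∑ i : Fin N, φ (((i : ℕ) + 1 : ℕ) / N) ^ 2) / N) / 2 : ℝ) : ℂ)) atTop (𝓝 0) := by
    have hb : Tendsto (fun N : ℕ => (6 * C ^ 3 * T ^ 2 + C) / √(N : ℝ)) atTop (𝓝 0) :=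
      tendsto_const_nhds.div_atTop hsqrt
    refine squeeze_zero_norm' ?_ hb
    filter_upwards [hφ.eventually_le, hsqrt.eventually_ge_atTop T] with N ⟨hN0, hN, h0⟩ hTN
    have hNpos : (0 : ℝ) < N := by exact_mod_cast hN0
    have hs : 0 < √(N : ℝ) := Real.sqrt_pos.2 hNpos
    have e : (∑ i, rateCoeff φ N i * Complex.exp (Complex.I * ((θ N i / √N : ℝ) : ℂ))) -
      ((((∑ i, θ N i * deriv φ (((i : ℕ) + 1 : ℕ) / N)) / N) / 2 -
      ((∑ i : Fin N, φ (((i : ℕ) + 1 : ℕ) / N) ^ 2) / N) / 2 : ℝ) : ℂ) =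
      (∑ i, (rateCoeff φ N i * Complex.exp (Complex.I * ((θ N i / √N : ℝ) : ℂ)) -
      (-(Complex.I / 2) * ((deriv φ (((i : ℕ) + 1 : ℕ) / N) / √N : ℝ) : ℂ) +
        ((θ N i * deriv φ (((i : ℕ) + 1 : ℕ) / N) / N / 2 : ℝ) : ℂ) -
        ((φ (((i : ℕ) + 1 : ℕ) / N) ^ 2 / N / 2 : ℝ) : ℂ)))) +
      (-(Complex.I / 2) * (((∑ i : Fin N, deriv φ (((i : ℕ) + 1 : ℕ) / N)) / √N : ℝ) : ℂ)) := by
      rw [Finset.sum_sub_distrib, Finset.sum_sub_distrib, Finset.sum_add_distrib, ← Finset.mul_sum,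
        ← Complex.ofReal_sum, ← Complex.ofReal_sum, ← Complex.ofReal_sum, ← Finset.sum_div,
        ← Finset.sum_div, ← Finset.sum_div, ← Finset.sum_div, ← Finset.sum_div]
      push_cast
      ring
    rw [e]
    calc _ ≤ (N : ℝ) * (6 * C ^ 3 * T ^ 2 / (N * √N)) + C / √N := by
          refine (norm_add_le _ _).trans (add_le_add ?_ ?_)
          · refine (norm_sum_le_of_le _ fun i _ =>
              hφ.norm_rateCoeff_mul_exp_sub_le hN h0 i hT (hθ N i) hTN).trans ?_
            simp
          · rw [norm_mul, norm_neg, norm_div, Complex.norm_I, Complex.norm_real, Real.norm_eq_abs,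
              abs_div, abs_of_pos hs]
            simp only [Complex.norm_ofNat]
            have := hφ.abs_sum_deriv_le hN0 h0
            calc _ ≤ 1 / 2 * (C / √N) := by gcongr
              _ ≤ C / √N := by
                have : 0 ≤ C / √(N : ℝ) := by positivity
                linarith
      _ = _ := by field_simp
  simpa using herr.add hmain

/-- The rates are not centred, so a second moment of `∑ τ(n_i) z_i` needs both `|∑ z_i|²` and `∑
|z_i|²`. The first converges (case `θ = 0` above), the second has `N` terms of size `1/N`. -/
theorem exists_rateCoeff_bound : ∃ K : ℝ, 0 ≤ K ∧ ∀ᶠ N : ℕ in atTop,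
    ‖∑ i, rateCoeff φ N i‖ ^ 2 ≤ K ∧ ∑ i, ‖rateCoeff φ N i‖ ^ 2 ≤ K := by
  have h := (hφ.tendsto_sum_rateCoeff (θ := fun _ _ => 0) (T := 0) (L := 0) (by simp)
    (by simp)).norm.pow 2
  simp only [zero_div, Complex.ofReal_zero, mul_zero, Complex.exp_zero, mul_one] at h
  obtain ⟨B, hB⟩ := h.bddAbove_range
  refine ⟨max B ((5 * C ^ 3) ^ 2), le_max_of_le_right (sq_nonneg _), ?_⟩
  filter_upwards [hφ.eventually_le] with N ⟨hN0, hN, h0⟩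
  have hNpos : (0 : ℝ) < N := by exact_mod_cast hN0
  refine ⟨le_max_of_le_left (hB ⟨N, rfl⟩), le_max_of_le_right ?_⟩
  calc ∑ i, ‖rateCoeff φ N i‖ ^ 2 ≤ ∑ _i : Fin N, (5 * C ^ 3 / √N) ^ 2 := by
        refine Finset.sum_le_sum fun i _ => ?_
        have := hφ.norm_rateCoeff_le hN h0 i
        gcongr
    _ = (5 * C ^ 3) ^ 2 := by
        rw [Finset.sum_const, Finset.card_univ, Fintype.card_fin, nsmul_eq_mul, div_pow,
          Real.sq_sqrt hNpos.le, mul_div_cancel₀ _ hNpos.ne']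

end IsTest

end

/-! ### Limits of characters multiplied by linear statistics and by rates -/

section


theorem norm_exp_sub_one_sub_le (x : ℝ) :
    ‖Complex.exp (Complex.I * (x : ℂ)) - 1 - Complex.I * x‖ ≤ 3 * x ^ 2 := by
  have hI : ‖Complex.I * (x : ℂ)‖ = |x| := by simp
  by_cases hx : |x| ≤ 1
  · have h1 := Complex.norm_exp_sub_one_sub_id_le (x := Complex.I * x) (by rwa [hI])
    rw [hI, sq_abs] at h1
    nlinarith [sq_nonneg x]
  · push Not at hx
    have h1 := norm_exp_sub_le' x
    have h2 := norm_sub_le (Complex.exp (Complex.I * (x : ℂ)) - 1) (Complex.I * x)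
    rw [hI] at h2
    rw [← sq_abs]
    nlinarith

theorem tendsto_floor_sub (m : ℝ) (hm : 0 < m) :
    Tendsto (fun N : ℕ => ((⌊(N : ℝ) * m⌋₊ : ℝ) - N * m) / √N) atTop (𝓝 0) := by
  have h1 : Tendsto (fun N : ℕ => 1 / √(N : ℝ)) atTop (𝓝 0) :=
    tendsto_const_nhds.div_atTop (Real.tendsto_sqrt_atTop.comp tendsto_natCast_atTop_atTop)
  refine squeeze_zero_norm (fun N => ?_) h1
  rw [norm_div, Real.norm_eq_abs, Real.norm_eq_abs, abs_of_nonneg (Real.sqrt_nonneg _)]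
  gcongr
  have h2 := Nat.floor_le (by positivity : 0 ≤ (N : ℝ) * m)
  have h3 := Nat.lt_floor_add_one ((N : ℝ) * m)
  rw [abs_le]; constructor <;> linarith

theorem tendsto_floor_pred_sub (m : ℝ) (hm : 0 < m) :
    Tendsto (fun N : ℕ => (((⌊(N : ℝ) * m⌋₊ - 1 : ℕ) : ℝ) - N * m) / √N) atTop (𝓝 0) := by
  have h1 : Tendsto (fun N : ℕ => 2 / √(N : ℝ)) atTop (𝓝 0) :=
    tendsto_const_nhds.div_atTop (Real.tendsto_sqrt_atTop.comp tendsto_natCast_atTop_atTop)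
  refine squeeze_zero_norm (fun N => ?_) h1
  rw [norm_div, Real.norm_eq_abs, Real.norm_eq_abs, abs_of_nonneg (Real.sqrt_nonneg _)]
  gcongr
  have h2 := Nat.floor_le (by positivity : 0 ≤ (N : ℝ) * m)
  have h3 := Nat.lt_floor_add_one ((N : ℝ) * m)
  have h4 : (⌊(N : ℝ) * m⌋₊ : ℝ) ≤ ((⌊(N : ℝ) * m⌋₊ - 1 : ℕ) : ℝ) + 1 := by
    exact_mod_cast (by omega : ⌊(N : ℝ) * m⌋₊ ≤ ⌊(N : ℝ) * m⌋₊ - 1 + 1)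
  have h5 : ((⌊(N : ℝ) * m⌋₊ - 1 : ℕ) : ℝ) ≤ (⌊(N : ℝ) * m⌋₊ : ℝ) := by
    exact_mod_cast Nat.sub_le _ _
  rw [abs_le]; constructor <;> linarith

/-- The linear statistic `∑ z_k (n_k - m)`. -/
def linStat (m : ℝ) {N : ℕ} (z : Fin N → ℝ) (n : Fin N → ℕ) : ℝ := ∑ k, z k * ((n k : ℝ) - m)

theorem chr_add (m : ℝ) {N : ℕ} (θ η : Fin N → ℝ) (n : Fin N → ℕ) :
    chr m (fun j => θ j + η j) n = chr m θ n * Complex.exp (Complex.I * (linStat m η n : ℂ)) := by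
  rw [chr, chr, linStat, ← Complex.exp_add, ← mul_add, ← Complex.ofReal_add, ← Finset.sum_add_distrib]
  simp_rw [add_mul]

namespace IsLaw
variable {p : ℕ → ℝ} {m α : ℝ} (h : IsLaw p m α)
include h

theorem exists_integral_linStat_sq_le (hm : 0 < m) :
    ∃ K : ℝ, 0 ≤ K ∧ ∀ᶠ N : ℕ in atTop, ∀ z : Fin N → ℝ,
      ∫ n, linStat m z n ^ 2 ∂(canon p N ⌊(N : ℝ) * m⌋₊) ≤ K * ∑ k, z k ^ 2 := by
  obtain ⟨e, he⟩ := h.exists_integral_coord_le _ (tendsto_floor_sub m hm)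
    (g := fun k => ((k : ℝ) - m) ^ 2) (fun _ => sq_nonneg _) h.hasSum_var.summable
  refine ⟨max (8 * e + 10) 0, le_max_right _ _, ?_⟩
  filter_upwards [he, eventually_ge_atTop 2] with N hN hN2 z
  refine (integral_sq_sum_centered_canon_le h.pos hN2 ?_ hN z).trans ?_
  · have h2 := Nat.floor_le (by positivity : 0 ≤ (N : ℝ) * m)
    have h3 := Nat.lt_floor_add_one ((N : ℝ) * m)
    rw [abs_le]; constructor <;> linarith
  · gcongr
    exact le_max_left _ _

theorem exists_integral_linStat_bounded_sq_le (hm : 0 < m) (C : ℝ) :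
    ∃ K : ℝ, 0 ≤ K ∧ ∀ᶠ N : ℕ in atTop, ∀ z : Fin N → ℝ, (∀ i, |z i| ≤ C) →
      ∫ n, linStat m (fun k => z k / √N) n ^ 2 ∂(canon p N ⌊(N : ℝ) * m⌋₊) ≤ K := by
  obtain ⟨K, hK, hb⟩ := h.exists_integral_linStat_sq_le hm
  refine ⟨K * C ^ 2, by positivity, ?_⟩
  filter_upwards [hb, eventually_gt_atTop 0] with N hN hN0 z hz
  have hNpos : (0 : ℝ) < N := by exact_mod_cast hN0
  refine (hN _).trans ?_
  gcongr
  calc ∑ k, (z k / √N) ^ 2 ≤ ∑ _k : Fin N, C ^ 2 / N := by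
        refine Finset.sum_le_sum fun k _ => ?_
        rw [div_pow, Real.sq_sqrt hNpos.le, ← sq_abs]
        have := hz k
        gcongr
    _ = C ^ 2 := by
        rw [Finset.sum_const, Finset.card_univ, Fintype.card_fin, nsmul_eq_mul,
          mul_div_cancel₀ _ hNpos.ne']

/-- The expectation is the derivative at `ε = 0`, divided by `i`, of the characteristic function
along `θ + ε η`. Limit and derivative may be exchanged because the second-order remainder is
controlled by second moments uniform in `N`. As `η` has vanishing mean, only `B` varies to first
order. -/
theorem tendsto_integral_linStat_mul_chr (hm : 0 < m) {θ η : ∀ N : ℕ, Fin N → ℝ} {C A B L Q : ℝ}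
    (hθ : ∀ N j, |θ N j| ≤ C) (hη : ∀ N j, |η N j| ≤ C)
    (hA : Tendsto (fun N : ℕ => (∑ j, θ N j) / N) atTop (𝓝 A))
    (hB : Tendsto (fun N : ℕ => (∑ j, θ N j ^ 2) / N) atTop (𝓝 B))
    (hη0 : Tendsto (fun N : ℕ => (∑ j, η N j) / N) atTop (𝓝 0))
    (hL : Tendsto (fun N : ℕ => (∑ j, θ N j * η N j) / N) atTop (𝓝 L))
    (hQ : Tendsto (fun N : ℕ => (∑ j, η N j ^ 2) / N) atTop (𝓝 Q)) :
    Tendsto (fun N : ℕ => ∫ n, (linStat m (fun j => η N j / √N) n : ℂ) *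
      chr m (fun j => θ N j / √N) n ∂(canon p N ⌊(N : ℝ) * m⌋₊)) atTop
      (𝓝 (Complex.I * α * L * (Real.exp (-(α / 2 * (B - A ^ 2))) : ℝ))) := by
  set χ : ℝ := Real.exp (-(α / 2 * (B - A ^ 2))) with hχ
  set w : ℂ := Complex.I * α * L * (χ : ℝ) with hw
  obtain ⟨K, hK, hKb⟩ := h.exists_integral_linStat_bounded_sq_le hm C
  have hlim (ε : ℝ) : Tendsto (fun N : ℕ => ∫ n, chr m (fun j => (θ N j + ε * η N j) / √N) n
      ∂(canon p N ⌊(N : ℝ) * m⌋₊)) atTop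
      (𝓝 (Real.exp (-(α / 2 * ((B + 2 * ε * L + ε ^ 2 * Q) - A ^ 2))) : ℝ)) := by
    refine h.tendsto_integral_chr _ (tendsto_floor_sub m hm) (fun N j => θ N j + ε * η N j)
      (C := C + |ε| * C) (fun N j => ?_) ?_ ?_
    · refine (abs_add_le _ _).trans (add_le_add (hθ N j) ?_)
      rw [abs_mul]
      exact mul_le_mul_of_nonneg_left (hη N j) (abs_nonneg _)
    · have := hA.add (hη0.const_mul ε)
      rw [mul_zero, add_zero] at this
      refine this.congr fun N => ?_
      rw [Finset.sum_add_distrib, ← Finset.mul_sum]; ring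
    · refine ((hB.add (hL.const_mul (2 * ε))).add (hQ.const_mul (ε ^ 2))).congr fun N => ?_
      rw [← mul_div_assoc, ← mul_div_assoc, ← add_div, ← add_div, Finset.mul_sum, Finset.mul_sum,
        ← Finset.sum_add_distrib, ← Finset.sum_add_distrib]
      congr 1
      refine Finset.sum_congr rfl fun j _ => ?_
      ring
  have hder : HasDerivAt (fun ε : ℝ => Real.exp (-(α / 2 * ((B + 2 * ε * L + ε ^ 2 * Q) - A ^ 2))))
      (-(α * L * χ)) 0 := by
    have h1 : HasDerivAt (fun ε : ℝ => -(α / 2 * ((B + 2 * ε * L + ε ^ 2 * Q) - A ^ 2))) (-(α * L)) 0 := by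
      have h2 : HasDerivAt (fun ε : ℝ => B + 2 * ε * L + ε ^ 2 * Q) (2 * L) 0 := by
        have := ((((hasDerivAt_id (0 : ℝ)).const_mul 2).mul_const L).const_add B).add
          (((hasDerivAt_id (0 : ℝ)).pow 2).mul_const Q)
        refine this.congr_deriv ?_
        simp
      refine ((h2.sub_const (A ^ 2)).const_mul (α / 2)).neg.congr_deriv ?_
      ring
    refine h1.exp.congr_deriv ?_
    simp [hχ]
    ring
  rw [Metric.tendsto_atTop']
  intro δ hδ
  have hs := (hasDerivAt_iff_tendsto_slope_zero.1 hder)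
  have hs1 := (Metric.tendsto_nhds.1 hs (δ / 3) (by positivity))
  have hs2 : ∀ᶠ ε : ℝ in 𝓝[≠] 0, 3 * K * |ε| < δ / 3 := by
    have : Tendsto (fun ε : ℝ => 3 * K * |ε|) (𝓝[≠] 0) (𝓝 0) := by
      have h1 : Continuous fun ε : ℝ => 3 * K * |ε| := by fun_prop
      simpa using (h1.tendsto 0).mono_left nhdsWithin_le_nhds
    exact this.eventually_lt_const (by positivity)
  -- One nonzero `ε` is fixed before `N` grows: the slope of the limit and the Taylor remainder are
  -- then each accurate to `|ε| δ / 3`.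
  obtain ⟨ε, ⟨hε1, hε2⟩, hε0⟩ := ((hs1.and hs2).and self_mem_nhdsWithin).exists
  have habs : 0 < |ε| := abs_pos.2 hε0
  have hd := ((hlim ε).sub (hlim 0))
  have hd1 := Metric.tendsto_nhds.1 hd (|ε| * (δ / 3)) (by positivity)
  have hfin : ∀ᶠ N : ℕ in atTop, dist (∫ n, (linStat m (fun j => η N j / √N) n : ℂ) *
      chr m (fun j => θ N j / √N) n ∂(canon p N ⌊(N : ℝ) * m⌋₊)) w < δ := by
    filter_upwards [hd1, hKb, eventually_gt_atTop 0] with N hN1 hN2 hN0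
    set μ := canon p N ⌊(N : ℝ) * m⌋₊
    set V := fun n => linStat m (fun j => η N j / √N) n
    have hV : ∫ n, V n ^ 2 ∂μ ≤ K := hN2 _ (hη N)
    set W := ∫ n, (V n : ℂ) * chr m (fun j => θ N j / √N) n ∂μ
    have e1 (n : Fin N → ℕ) : chr m (fun j => (θ N j + ε * η N j) / √N) n =
        chr m (fun j => θ N j / √N) n * Complex.exp (Complex.I * ((ε * V n : ℝ) : ℂ)) := by
      have : (fun j => (θ N j + ε * η N j) / √N) = fun j => θ N j / √N + ε * (η N j / √N) := by
        funext j; ring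
      rw [this, chr_add]
      congr 4
      simp only [V, linStat, Finset.mul_sum]
      refine Finset.sum_congr rfl fun j _ => by ring
    have e2 (n : Fin N → ℕ) : chr m (fun j => (θ N j + 0 * η N j) / √N) n =
        chr m (fun j => θ N j / √N) n := by simp
    simp_rw [e1, e2] at hN1
    -- The remainder of the exponential is at most `3 (ε V)²`, and `V` has second moment at most
    -- `K`, uniformly in `N`.
    have e3 : ‖(∫ n, chr m (fun j => θ N j / √N) n * Complex.exp (Complex.I * ((ε * V n : ℝ) : ℂ)) ∂μ) -
        (∫ n, chr m (fun j => θ N j / √N) n ∂μ) - Complex.I * ε * W‖ ≤ 3 * ε ^ 2 * K := by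
      have : Complex.I * ε * W = ∫ n, chr m (fun j => θ N j / √N) n *
          (Complex.I * ((ε * V n : ℝ) : ℂ)) ∂μ := by
        rw [← integral_const_mul]
        congr 1
        funext n
        push_cast
        ring
      rw [this, ← integral_sub (integrable_canon p _ _ _) (integrable_canon p _ _ _),
        ← integral_sub (integrable_canon p _ _ _) (integrable_canon p _ _ _)]
      refine (norm_integral_le_integral_norm _).trans ?_
      calc _ ≤ ∫ n, 3 * ε ^ 2 * V n ^ 2 ∂μ := by
            refine integral_mono (integrable_canon p _ _ _) (integrable_canon p _ _ _) fun n => ?_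
            have e : chr m (fun j => θ N j / √N) n * Complex.exp (Complex.I * ((ε * V n : ℝ) : ℂ)) -
                chr m (fun j => θ N j / √N) n - chr m (fun j => θ N j / √N) n *
                (Complex.I * ((ε * V n : ℝ) : ℂ)) = chr m (fun j => θ N j / √N) n *
                (Complex.exp (Complex.I * ((ε * V n : ℝ) : ℂ)) - 1 -
                  Complex.I * ((ε * V n : ℝ) : ℂ)) := by ring
            dsimp only
            rw [e, norm_mul, norm_chr, one_mul]
            refine (norm_exp_sub_one_sub_le _).trans_eq ?_
            ring
        _ ≤ _ := by
            rw [integral_const_mul]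
            gcongr
    rw [dist_eq_norm] at hN1 hε1 ⊢
    simp only [zero_add, smul_eq_mul] at hε1
    have hχ0 : Real.exp (-(α / 2 * (B + 2 * 0 * L + 0 ^ 2 * Q - A ^ 2))) = χ := by
      rw [hχ]; congr 1; ring
    rw [hχ0] at hN1 hε1
    set χε := Real.exp (-(α / 2 * (B + 2 * ε * L + ε ^ 2 * Q - A ^ 2)))
    have e4 : ‖((χε : ℂ) - χ) - Complex.I * ε * w‖ ≤ |ε| * (δ / 3) := by
      have : ((χε : ℂ) - χ) - Complex.I * ε * w =
          ((ε * (ε⁻¹ * (χε - χ) - -(α * L * χ)) : ℝ) : ℂ) := by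
        have hεC : (ε : ℂ) ≠ 0 := by exact_mod_cast hε0
        rw [hw]
        push_cast
        field_simp
        ring_nf
        rw [Complex.I_sq]
        ring
      rw [this, Complex.norm_real, norm_mul, Real.norm_eq_abs ε]
      gcongr
    have hIε : ‖Complex.I * (ε : ℂ)‖ = |ε| := by simp
    have : |ε| * ‖W - w‖ < |ε| * δ := by
      rw [← hIε, ← norm_mul, hIε]
      set q1 := ∫ n, chr m (fun j => θ N j / √N) n * Complex.exp (Complex.I * ((ε * V n : ℝ) : ℂ)) ∂μ
      set q0 := ∫ n, chr m (fun j => θ N j / √N) n ∂μ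
      -- Three errors: Taylor remainder at finite `N`, convergence of the two characteristic
      -- functions, and slope of the limit.
      have e5 : Complex.I * ε * (W - w) = -(q1 - q0 - Complex.I * ε * W) +
          (q1 - q0 - ((χε : ℂ) - χ)) + (((χε : ℂ) - χ) - Complex.I * ε * w) := by ring
      rw [e5]
      have e6 : 3 * ε ^ 2 * K ≤ |ε| * (δ / 3) := by
        rw [← sq_abs]; nlinarith
      refine (norm_add₃_le).trans_lt ?_
      rw [norm_neg]
      linarith
    exact lt_of_mul_lt_mul_left this habs.le
  obtain ⟨N0, hN0⟩ := eventually_atTop.1 hfin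
  exact ⟨N0, fun N hN => hN0 N hN.le⟩

section Density
variable {τ : ℕ → ℝ} {a : ℝ} {φ : ℝ → ℝ} {C : ℝ}

/-- The exact particle-removal identity reduces this to three known limits: the ratio of masses, the
sum of the coefficients with their phases, and the characteristic function with one particle fewer.
-/
theorem tendsto_integral_rate_mul_chr (hm : 0 < m) (hτ0 : τ 0 = 0)
    (hτ : ∀ k, τ (k + 1) * p (k + 1) = a * p k) (hφ : IsTest φ C)
    {θ : ∀ N : ℕ, Fin N → ℝ} {T A B L : ℝ} (hθ : ∀ N j, |θ N j| ≤ T)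
    (hA : Tendsto (fun N : ℕ => (∑ j, θ N j) / N) atTop (𝓝 A))
    (hB : Tendsto (fun N : ℕ => (∑ j, θ N j ^ 2) / N) atTop (𝓝 B))
    (hL : Tendsto (fun N : ℕ => (∑ i, θ N i * deriv φ (((i : ℕ) + 1 : ℕ) / N)) / N) atTop (𝓝 L)) :
    Tendsto (fun N : ℕ => ∫ n, (∑ i, (τ (n i) : ℂ) * rateCoeff φ N i) *
      chr m (fun j => θ N j / √N) n ∂(canon p N ⌊(N : ℝ) * m⌋₊)) atTop
      (𝓝 (a * ((L / 2 - (∫ x in (0 : ℝ)..1, φ x ^ 2) / 2 : ℝ) : ℂ) *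
        (Real.exp (-(α / 2 * (B - A ^ 2))) : ℝ))) := by
  have h1 := h.tendsto_mass_ratio _ _ (tendsto_floor_sub m hm) (tendsto_floor_pred_sub m hm)
  have h2 := h.tendsto_integral_chr _ (tendsto_floor_pred_sub m hm) θ hθ hA hB
  have h3 := hφ.tendsto_sum_rateCoeff hθ hL
  have h4 : Tendsto (fun N : ℕ => ((a * (mass p N (⌊(N : ℝ) * m⌋₊ - 1) /
      mass p N ⌊(N : ℝ) * m⌋₊) : ℝ) : ℂ)) atTop (𝓝 ((a * 1 : ℝ) : ℂ)) :=
    (Complex.continuous_ofReal.tendsto _).comp (h1.const_mul a)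
  rw [mul_one] at h4
  refine ((h4.mul h3).mul h2).congr' ?_
  have h5 : Tendsto (fun N : ℕ => (N : ℝ) * m) atTop atTop :=
    tendsto_natCast_atTop_atTop.atTop_mul_const hm
  filter_upwards [eventually_gt_atTop 0, h5.eventually_ge_atTop 1] with N hN hN1
  -- Once `N m ≥ 1` there is a particle to remove.
  obtain ⟨M, hM⟩ : ∃ M, ⌊(N : ℝ) * m⌋₊ = M + 1 :=
    ⟨⌊(N : ℝ) * m⌋₊ - 1, by have := Nat.le_floor (n := 1) (a := (N : ℝ) * m) (by simpa); omega⟩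
  rw [hM, integral_rate_mul_chr h.pos hτ0 hτ hN, Nat.add_sub_cancel, mul_div_assoc]

/-- Real and imaginary parts are real linear statistics of the exchangeable variables `τ (n i)`,
whose second moments are bounded since the one-site marginals are dominated by `p`. -/
theorem exists_integral_rate_sq_le (hm : 0 < m) (hτs : Summable fun k => τ k ^ 2 * p k)
    (hφ : IsTest φ C) :
    ∃ K : ℝ, ∀ᶠ N : ℕ in atTop, ∫ n, ‖∑ i, (τ (n i) : ℂ) * rateCoeff φ N i‖ ^ 2
      ∂(canon p N ⌊(N : ℝ) * m⌋₊) ≤ K := by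
  obtain ⟨K, hK, hKb⟩ := hφ.exists_rateCoeff_bound
  obtain ⟨e, he⟩ := h.exists_integral_coord_le _ (tendsto_floor_sub m hm)
    (g := fun k => τ k ^ 2) (fun _ => sq_nonneg _) hτs
  refine ⟨max e 0 * (3 * K), ?_⟩
  filter_upwards [hKb, he, eventually_ge_atTop 2] with N ⟨hN1, hN2⟩ hN3 hN
  have hre := integral_sq_sum_canon_le h.pos hN τ (e := max e 0)
    (fun i => (hN3 i).trans (le_max_left _ _)) (fun i => (rateCoeff φ N i).re)
  have him := integral_sq_sum_canon_le h.pos hN τ (e := max e 0)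
    (fun i => (hN3 i).trans (le_max_left _ _)) (fun i => (rateCoeff φ N i).im)
  have e1 (n : Fin N → ℕ) : ‖∑ i, (τ (n i) : ℂ) * rateCoeff φ N i‖ ^ 2 =
      (∑ i, (rateCoeff φ N i).re * τ (n i)) ^ 2 + (∑ i, (rateCoeff φ N i).im * τ (n i)) ^ 2 := by
    rw [Complex.sq_norm, Complex.normSq_apply, Complex.re_sum, Complex.im_sum]
    simp only [Complex.re_ofReal_mul, Complex.im_ofReal_mul]
    simp_rw [mul_comm (τ _)]
    ring
  simp_rw [e1]
  rw [integral_add (integrable_canon p _ _ _) (integrable_canon p _ _ _)]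
  have e2 : (∑ i, (rateCoeff φ N i).re) ^ 2 + (∑ i, (rateCoeff φ N i).im) ^ 2 ≤ K := by
    rw [Complex.sq_norm, Complex.normSq_apply, Complex.re_sum, Complex.im_sum] at hN1
    linarith
  have e3 : ∑ i, (rateCoeff φ N i).re ^ 2 + ∑ i, (rateCoeff φ N i).im ^ 2 ≤ K := by
    refine le_trans (le_of_eq ?_) hN2
    rw [← Finset.sum_add_distrib]
    refine Finset.sum_congr rfl fun i _ => ?_
    rw [Complex.sq_norm, Complex.normSq_apply]; ring
  calc _ ≤ max e 0 * (((∑ i, (rateCoeff φ N i).re) ^ 2 + (∑ i, (rateCoeff φ N i).im) ^ 2) +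
        2 * (∑ i, (rateCoeff φ N i).re ^ 2 + ∑ i, (rateCoeff φ N i).im ^ 2)) := by linarith
    _ ≤ _ := by
        refine mul_le_mul_of_nonneg_left ?_ (le_max_right _ _)
        linarith

end Density

end IsLaw

end

/-! ### Integration against densities, and Fourier test functions in finite dimension -/

section


/-- The integral of a bounded function with respect to a vector measure with a density. -/
theorem integral_withDensityᵥ {X : Type*} [MeasurableSpace X] {μ : Measure X} {g : X → ℂ}
    (hg : Integrable g μ) {F : X → ℝ} (hF : StronglyMeasurable F) {C : ℝ} (hC : ∀ x, ‖F x‖ ≤ C) :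
    (μ.withDensityᵥ g).integral F (ContinuousLinearMap.lsmul ℝ ℝ) = ∫ x, F x • g x ∂μ := by
  -- The variation is finite because `g` is integrable, so bounded functions are integrable against
  -- the vector measure.
  have hvar : (μ.withDensityᵥ g).variation = μ.withDensity fun x => ‖g x‖ₑ :=
    Measure.variation_withDensityᵥ hg
  have : IsFiniteMeasure (μ.withDensityᵥ g).variation := by
    rw [hvar]
    exact ⟨by simpa using! hg.2⟩
  have hsimple (f : SimpleFunc X ℝ) :
      (μ.withDensityᵥ g).integral f (ContinuousLinearMap.lsmul ℝ ℝ) = ∫ x, f x • g x ∂μ := by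
    have hint (f : SimpleFunc X ℝ) : Integrable f (μ.withDensityᵥ g).variation :=
      SimpleFunc.integrable_of_isFiniteMeasure f
    have hint' (f : SimpleFunc X ℝ) : Integrable (fun x => f x • g x) μ := by
      obtain ⟨c, hc⟩ := f.exists_forall_norm_le
      exact hg.bdd_smul c f.stronglyMeasurable.aestronglyMeasurable (ae_of_all _ hc)
    induction f using SimpleFunc.induction with
    | const c hs =>
      rename_i s
      have e : (⇑(SimpleFunc.piecewise s hs (SimpleFunc.const X c) (SimpleFunc.const X 0)) : X → ℝ) =
          s.indicator fun _ => c := by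
        ext x
        by_cases hx : x ∈ s <;> simp [hx]
      rw [e, VectorMeasure.integral_indicator_const c hs, withDensityᵥ_apply hg hs]
      have e2 : (fun x => s.indicator (fun _ => c) x • g x) = s.indicator fun x => c • g x := by
        ext x
        by_cases hx : x ∈ s <;> simp [hx]
      rw [e2, MeasureTheory.integral_indicator hs, MeasureTheory.integral_smul,
        ContinuousLinearMap.lsmul_apply]
    | add _ hf1 hf2 =>
      rename_i f1 f2 _
      rw [SimpleFunc.coe_add, VectorMeasure.integral_add (hint f1) (hint f2), hf1, hf2,
        ← MeasureTheory.integral_add (hint' f1) (hint' f2)]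
      congr 1
      ext x
      simp [add_mul]
  -- Uniformly bounded simple approximations: dominated convergence applies both to the vector
  -- measure and to the integral against `g`.
  set f : ℕ → SimpleFunc X ℝ := hF.approxBounded C
  have hlim (x : X) : Tendsto (fun n => f n x) atTop (𝓝 (F x)) :=
    hF.tendsto_approxBounded_of_norm_le (hC x)
  have hb (n : ℕ) (x : X) : ‖f n x‖ ≤ max C 0 :=
    (hF.norm_approxBounded_le ((norm_nonneg _).trans (hC x)) n x).trans (le_max_left _ _)
  have h1 : Tendsto (fun n => (μ.withDensityᵥ g).integral (f n) (ContinuousLinearMap.lsmul ℝ ℝ))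
      atTop (𝓝 ((μ.withDensityᵥ g).integral F (ContinuousLinearMap.lsmul ℝ ℝ))) :=
    VectorMeasure.tendsto_integral_of_dominated_convergence (fun _ => max C 0)
      (fun n => (f n).stronglyMeasurable.aestronglyMeasurable) (integrable_const _)
      (fun n => ae_of_all _ (hb n)) (ae_of_all _ hlim)
  have h2 : Tendsto (fun n => ∫ x, f n x • g x ∂μ) atTop (𝓝 (∫ x, F x • g x ∂μ)) := by
    refine MeasureTheory.tendsto_integral_of_dominated_convergence (fun x => max C 0 * ‖g x‖)
      (fun n => (f n).stronglyMeasurable.aestronglyMeasurable.smul hg.aestronglyMeasurable)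
      (hg.norm.const_mul _) (fun n => ae_of_all _ fun x => ?_)
      (ae_of_all _ fun x => (hlim x).smul_const _)
    rw [norm_smul]
    gcongr
    exact hb n x
  refine tendsto_nhds_unique h1 (h2.congr fun n => (hsimple (f n)).symm)

/-- Diagonal approximation of limits. -/
theorem tendsto_of_approx {F : Type*} [NormedAddCommGroup F] {a : ℕ → F} {b : ℕ → ℕ → F}
    {c : ℕ → F} {l : F} {δ : ℕ → ℝ} (hδ : Tendsto δ atTop (𝓝 0))
    (hab : ∀ᶠ K in atTop, ∀ᶠ N in atTop, ‖a N - b K N‖ ≤ δ K)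
    (hbc : ∀ᶠ K in atTop, Tendsto (b K) atTop (𝓝 (c K))) (hc : Tendsto c atTop (𝓝 l)) :
    Tendsto a atTop (𝓝 l) := by
  rw [Metric.tendsto_nhds]
  intro ε hε
  have h1 := hδ.eventually_lt_const (by positivity : 0 < ε / 3)
  have h2 := Metric.tendsto_nhds.1 hc (ε / 3) (by positivity)
  obtain ⟨K, ⟨⟨h3, h4⟩, h5⟩, h6⟩ := (((h1.and h2).and hab).and hbc).exists
  filter_upwards [h5, Metric.tendsto_nhds.1 h6 (ε / 3) (by positivity)] with N h7 h8
  rw [dist_eq_norm] at h4 h8 ⊢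
  have e : a N - l = (a N - b K N) + (b K N - c K) + (c K - l) := by abel
  rw [e]
  refine norm_add₃_le.trans_lt ?_
  linarith

section FiniteDimensional
variable {V : Type*} [NormedAddCommGroup V] [InnerProductSpace ℝ V] [FiniteDimensional ℝ V]
  {p : ℕ → ℝ} {M : ℕ → ℕ} {X : ∀ N : ℕ, (Fin N → ℕ) → V} {G : ∀ N : ℕ, (Fin N → ℕ) → ℂ} {K : ℝ}

theorem integral_norm_canon_le (hp : ∀ k, 0 < p k) {N M : ℕ} (hN : 0 < N) {G : (Fin N → ℕ) → ℂ}
    (hG : ∫ n, ‖G n‖ ^ 2 ∂(canon p N M) ≤ K) : ∫ n, ‖G n‖ ∂(canon p N M) ≤ 1 + K := by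
  have := isProbabilityMeasure_canon hp (M := M) (Or.inl hN)
  calc ∫ n, ‖G n‖ ∂(canon p N M) ≤ ∫ n, (1 + ‖G n‖ ^ 2) ∂(canon p N M) := by
        refine integral_mono (integrable_canon p _ _ _) (integrable_canon p _ _ _) fun n => ?_
        dsimp only
        nlinarith [sq_nonneg (‖G n‖ - 1), norm_nonneg (G n)]
    _ ≤ _ := by
        rw [integral_add (integrable_canon p _ _ _) (integrable_canon p _ _ _)]
        simpa using hG

-- Fourier inversion writes `g` as a superposition of characters with integrable weight `𝓕 g`; the
-- uniform `L¹` bound on `G` that follows from the `L²` bound dominates.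
open scoped SchwartzMap FourierTransform in
theorem tendsto_integral_schwartz (hp : ∀ k, 0 < p k)
    (hG : ∀ᶠ N in atTop, ∫ n, ‖G N n‖ ^ 2 ∂(canon p N (M N)) ≤ K)
    (hchar : ∀ ξ : V, Tendsto (fun N => ∫ n, Complex.exp (Complex.I * (inner ℝ ξ (X N n) : ℝ)) * G N n
      ∂(canon p N (M N))) atTop (𝓝 0)) (g : 𝓢(V, ℂ)) :
    Tendsto (fun N => ∫ n, g (X N n) * G N n ∂(canon p N (M N))) atTop (𝓝 0) := by
  borelize V
  have hinv (x : V) : g x = ∫ ξ, Complex.exp (Complex.I * (inner ℝ ((2 * Real.pi) • ξ) x : ℝ)) *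
      (𝓕 g) ξ := by
    have h1 : g x = (𝓕⁻ (𝓕 g)) x := by rw [FourierTransform.fourierInv_fourier_eq]
    rw [h1, SchwartzMap.fourierInv_coe, Real.fourierInv_eq']
    congr 1
    funext ξ
    rw [smul_eq_mul, inner_smul_left, mul_comm Complex.I]
    simp
  have hswap (N : ℕ) : ∫ n, g (X N n) * G N n ∂(canon p N (M N)) = ∫ ξ, (∫ n,
      Complex.exp (Complex.I * (inner ℝ ((2 * Real.pi) • ξ) (X N n) : ℝ)) * G N n ∂(canon p N (M N))) *
      (𝓕 g) ξ := by
    simp_rw [integral_canon hp]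
    have hint (n : Fin N → ℕ) : Integrable fun ξ =>
        Complex.exp (Complex.I * (inner ℝ ((2 * Real.pi) • ξ) (X N n) : ℝ)) * (𝓕 g) ξ := by
      refine (𝓕 g).integrable.bdd_mul (c := 1) (by fun_prop) (ae_of_all _ fun ξ => ?_)
      rw [mul_comm, Complex.norm_exp_ofReal_mul_I]
    simp_rw [Finset.sum_mul]
    rw [integral_finsetSum]
    · refine Finset.sum_congr rfl fun n _ => ?_
      rw [hinv, ← integral_mul_const, ← integral_smul]
      congr 1
      funext ξ
      simp only [Complex.real_smul]
      ring
    · intro n _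
      refine ((hint n).const_mul ((((∏ j, p (n j)) / mass p N (M N) : ℝ) : ℂ) * G N n)).congr
        (ae_of_all _ fun ξ => ?_)
      simp only [Complex.real_smul]
      ring
  simp_rw [hswap]
  have h0 : (0 : ℂ) = ∫ ξ : V, (0 : ℂ) * (𝓕 g) ξ := by simp
  rw [h0]
  refine tendsto_integral_filter_of_dominated_convergence (fun ξ => (1 + K) * ‖(𝓕 g) ξ‖)
    (Eventually.of_forall fun N => ?_) ?_ ((𝓕 g).integrable.norm.const_mul _)
    (ae_of_all _ fun ξ => (hchar _).mul_const _)
  · refine AEStronglyMeasurable.mul ?_ (𝓕 g).continuous.aestronglyMeasurable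
    simp_rw [integral_canon hp]
    exact (by fun_prop : Continuous _).aestronglyMeasurable
  · filter_upwards [hG, eventually_gt_atTop 0] with N hN hN0
    refine ae_of_all _ fun ξ => ?_
    rw [norm_mul]
    gcongr
    refine (norm_integral_le_integral_norm _).trans (le_trans (le_of_eq ?_)
      (integral_norm_canon_le hp hN0 hN))
    congr 1
    funext n
    rw [norm_mul, mul_comm Complex.I, Complex.norm_exp_ofReal_mul_I, one_mul]

/-- A continuity theorem for complex weights: the second moment of `X` supplies tightness and that
of `G` uniform integrability, so a bounded continuous `f` may be cut off and smoothed into a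
Schwartz function. -/
theorem tendsto_integral_of_tendsto_char (hp : ∀ k, 0 < p k)
    (hG : ∀ᶠ N in atTop, ∫ n, ‖G N n‖ ^ 2 ∂(canon p N (M N)) ≤ K)
    (hX : ∀ᶠ N in atTop, ∫ n, ‖X N n‖ ^ 2 ∂(canon p N (M N)) ≤ K)
    (hchar : ∀ ξ : V, Tendsto (fun N => ∫ n, Complex.exp (Complex.I * (inner ℝ ξ (X N n) : ℝ)) * G N n
      ∂(canon p N (M N))) atTop (𝓝 0)) {f : V → ℝ} (hf : Continuous f) {B : ℝ}
    (hB : ∀ x, |f x| ≤ B) :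
    Tendsto (fun N => ∫ n, (f (X N n) : ℂ) * G N n ∂(canon p N (M N))) atTop (𝓝 0) := by
  have hB0 : 0 ≤ B := (abs_nonneg _).trans (hB 0)
  have hcut (R : ℕ) : ∃ g : V → ℂ, ContDiff ℝ (⊤ : ℕ∞) g ∧ HasCompactSupport g ∧
      ∀ x, ‖(f x : ℂ) - g x‖ ≤ 1 / (R + 1) + B * (‖x‖ / (R + 1)) := by
    -- The cutoff is 1 on the ball of radius `R + 1` and 0 outside that of radius `R + 2`; hence `1
    -- - c ≤ ‖x‖/(R + 1)` everywhere.
    set c : V → ℝ := fun x => max 0 (min 1 (R + 2 - ‖x‖)) with hc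
    have hc0 (x : V) : 0 ≤ c x := le_max_left _ _
    have hc1 (x : V) : c x ≤ 1 := max_le zero_le_one (min_le_left _ _)
    set f₁ : V → ℂ := fun x => ((f x * c x : ℝ) : ℂ) with hf₁
    have hf₁c : Continuous f₁ := by fun_prop
    have hf₁0 (x : V) (hx : (R + 2 : ℝ) ≤ ‖x‖) : f₁ x = 0 := by
      have : c x = 0 := max_eq_left ((min_le_right _ _).trans (by linarith))
      simp [hf₁, this]
    have hsupp : HasCompactSupport f₁ := by
      refine HasCompactSupport.intro (isCompact_closedBall (0 : V) (R + 2)) fun x hx => hf₁0 x ?_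
      rw [mem_closedBall_zero_iff, not_le] at hx
      exact hx.le
    have hu := Metric.uniformContinuous_iff.1 (hsupp.uniformContinuous_of_continuous hf₁c)
      (1 / (R + 1)) (by positivity)
    obtain ⟨δ, hδ, hδ'⟩ := hu
    obtain ⟨g, hg, hgd⟩ := hf₁c.exists_contDiff_dist_le_of_forall_mem_ball_dist_le hδ
    refine ⟨g, hg, ?_, fun x => ?_⟩
    · refine HasCompactSupport.intro (isCompact_closedBall (0 : V) (R + 2 + δ)) fun x hx => ?_
      rw [mem_closedBall_zero_iff, not_le] at hx
      have h1 := hgd x 0 fun y hy => by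
        rw [hf₁0 x (by linarith), hf₁0 y, dist_self]
        rw [Metric.mem_ball, dist_eq_norm] at hy
        have := norm_sub_norm_le x (x - y)
        rw [sub_sub_cancel, norm_sub_rev] at this
        linarith
      rwa [hf₁0 x (by linarith), dist_zero_right, norm_le_zero_iff] at h1
    · have h1 := hgd x _ fun y hy => (hδ' (Metric.mem_ball.1 hy)).le
      rw [dist_eq_norm, norm_sub_rev] at h1
      have h2 : ‖(f x : ℂ) - f₁ x‖ ≤ B * (‖x‖ / (R + 1)) := by
        have e : (f x : ℂ) - f₁ x = ((f x * (1 - c x) : ℝ) : ℂ) := by simp [hf₁]; ring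
        rw [e, Complex.norm_real, norm_mul, Real.norm_eq_abs, Real.norm_eq_abs,
          abs_of_nonneg (by linarith [hc1 x] : (0 : ℝ) ≤ 1 - c x)]
        refine mul_le_mul (hB x) ?_ (by linarith [hc1 x]) hB0
        by_cases hx : ‖x‖ ≤ R + 1
        · have : c x = 1 := by
            rw [hc]
            dsimp only
            rw [min_eq_left (by linarith), max_eq_right zero_le_one]
          rw [this, sub_self]
          positivity
        · rw [le_div_iff₀ (by positivity)]
          push Not at hx
          nlinarith [hc0 x, hc1 x]
      have e : (f x : ℂ) - g x = (f₁ x - g x) + ((f x : ℂ) - f₁ x) := by ring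
      rw [e]
      exact (norm_add_le _ _).trans (add_le_add h1 h2)
  choose g hg hgs hgd using hcut
  -- Here `1 + K` bounds the mean of `‖G‖`, and `K` bounds that of `‖X‖ ‖G‖`.
  have hδ : Tendsto (fun R : ℕ => ((1 + K) + B * K) * (1 / ((R : ℝ) + 1))) atTop (𝓝 0) := by
    simpa using tendsto_one_div_add_atTop_nhds_zero_nat.const_mul ((1 + K) + B * K)
  refine tendsto_of_approx (b := fun R N => ∫ n, g R (X N n) * G N n ∂(canon p N (M N)))
    (c := fun _ => 0) hδ (Eventually.of_forall fun R => ?_) (Eventually.of_forall fun R => ?_)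
    tendsto_const_nhds
  · filter_upwards [hG, hX, eventually_gt_atTop 0] with N h1 h2 hN
    have := isProbabilityMeasure_canon hp (M := M N) (Or.inl hN)
    rw [← integral_sub (integrable_canon p _ _ _) (integrable_canon p _ _ _)]
    refine (norm_integral_le_integral_norm _).trans ?_
    calc _ ≤ ∫ n, (1 / ((R : ℝ) + 1) * ‖G N n‖ + B * (1 / ((R : ℝ) + 1)) *
          ((‖X N n‖ ^ 2 + ‖G N n‖ ^ 2) / 2)) ∂(canon p N (M N)) := by
          refine integral_mono (integrable_canon p _ _ _) (integrable_canon p _ _ _) fun n => ?_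
          dsimp only
          rw [← sub_mul, norm_mul]
          have h3 : 2 * (‖X N n‖ * ‖G N n‖) ≤ ‖X N n‖ ^ 2 + ‖G N n‖ ^ 2 := by
            nlinarith [sq_nonneg (‖X N n‖ - ‖G N n‖)]
          have h4 : 0 ≤ B * (1 / ((R : ℝ) + 1)) := by positivity
          calc _ ≤ (1 / ((R : ℝ) + 1) + B * (‖X N n‖ / (R + 1))) * ‖G N n‖ := by
                gcongr; exact hgd R _
            _ = 1 / ((R : ℝ) + 1) * ‖G N n‖ + B * (1 / ((R : ℝ) + 1)) * (‖X N n‖ * ‖G N n‖) := by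
                ring
            _ ≤ _ := by
                gcongr
                linarith
      _ ≤ _ := by
          rw [integral_add (integrable_canon p _ _ _) (integrable_canon p _ _ _), integral_const_mul,
            integral_const_mul, integral_div, integral_add (integrable_canon p _ _ _)
            (integrable_canon p _ _ _)]
          have h3 := integral_norm_canon_le hp hN h1
          calc _ ≤ 1 / ((R : ℝ) + 1) * (1 + K) + B * (1 / ((R : ℝ) + 1)) * ((K + K) / 2) := by gcongr
            _ = _ := by ring
  · exact tendsto_integral_schwartz hp hG hchar ((hgs R).toSchwartzMap (hg R))

end FiniteDimensional

end

/-! ### Finite-dimensional evaluations of the height and comparison of the two densities -/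

section


/-- The indicator of the sites to the left of `t`. -/
def leftInd (N : ℕ) (t : unitInterval) (k : Fin N) : ℝ :=
  if (k : ℕ) + 1 ≤ ⌊(t : ℝ) * N⌋₊ then 1 else 0

theorem abs_leftInd_le (N : ℕ) (t : unitInterval) (k : Fin N) : |leftInd N t k| ≤ 1 := by
  rw [leftInd]; split_ifs <;> simp

theorem height_eq_linStat (N : ℕ) (m : ℝ) (n : Fin N → ℕ) (t : unitInterval) :
    height N m n t = linStat m (fun k => leftInd N t k / √N) n := by
  rw [height, linStat, Finset.mul_sum]
  refine Finset.sum_congr rfl fun k _ => ?_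
  rw [leftInd]
  split_ifs <;> ring

/-- Initial segments are nested. This is where the `min(s, t)` of the bridge covariance comes from.
-/
theorem leftInd_mul (N : ℕ) (s t : unitInterval) (k : Fin N) :
    leftInd N s k * leftInd N t k = leftInd N (min s t) k := by
  have key {s t : unitInterval} (h : s ≤ t) : leftInd N s k * leftInd N t k = leftInd N s k := by
    have h1 : ⌊(s : ℝ) * N⌋₊ ≤ ⌊(t : ℝ) * N⌋₊ :=
      Nat.floor_mono (mul_le_mul_of_nonneg_right h (Nat.cast_nonneg _))
    simp only [leftInd]
    split_ifs with h2 h3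
    · simp
    · exact absurd (h2.trans h1) h3
    · simp
    · simp
  rcases le_total s t with h | h
  · rw [min_eq_left h, key h]
  · rw [min_eq_right h, mul_comm, key h]

variable {d : ℕ}

/-- The values of the height function at finitely many points. -/
def evalAt (N : ℕ) (m : ℝ) (t : Fin d → unitInterval) (n : Fin N → ℕ) : EuclideanSpace ℝ (Fin d) :=
  WithLp.toLp 2 fun j => height N m n (t j)

/-- The coefficients of a linear combination of values of the height function. -/
def evalCoeff (t : Fin d → unitInterval) (ξ : EuclideanSpace ℝ (Fin d)) (N : ℕ) (k : Fin N) : ℝ :=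
  ∑ j, ξ j * leftInd N (t j) k

theorem inner_evalAt (N : ℕ) (m : ℝ) (t : Fin d → unitInterval) (n : Fin N → ℕ)
    (ξ : EuclideanSpace ℝ (Fin d)) :
    inner ℝ ξ (evalAt N m t n) = linStat m (fun k => evalCoeff t ξ N k / √N) n := by
  simp only [PiLp.inner_apply, evalAt, height_eq_linStat, linStat, evalCoeff, RCLike.inner_apply,
    conj_trivial, Finset.sum_mul, Finset.sum_div]
  rw [Finset.sum_comm]
  refine Finset.sum_congr rfl fun k _ => Finset.sum_congr rfl fun j _ => ?_
  ring

theorem exp_inner_evalAt (N : ℕ) (m : ℝ) (t : Fin d → unitInterval) (n : Fin N → ℕ)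
    (ξ : EuclideanSpace ℝ (Fin d)) :
    Complex.exp (Complex.I * (inner ℝ ξ (evalAt N m t n) : ℝ)) =
      chr m (fun k => evalCoeff t ξ N k / √N) n := by
  rw [inner_evalAt, chr, linStat]

theorem abs_evalCoeff_le (t : Fin d → unitInterval) (ξ : EuclideanSpace ℝ (Fin d)) (N : ℕ)
    (k : Fin N) : |evalCoeff t ξ N k| ≤ ∑ j, |ξ j| := by
  refine (Finset.abs_sum_le_sum_abs _ _).trans (Finset.sum_le_sum fun j _ => ?_)
  rw [abs_mul]
  exact mul_le_of_le_one_right (abs_nonneg _) (abs_leftInd_le _ _ _)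

theorem tendsto_sum_leftInd (t : unitInterval) :
    Tendsto (fun N : ℕ => (∑ k, leftInd N t k) / N) atTop (𝓝 (t : ℝ)) :=
  tendsto_riemann_one t

theorem tendsto_sum_evalCoeff (t : Fin d → unitInterval) (ξ : EuclideanSpace ℝ (Fin d)) :
    Tendsto (fun N : ℕ => (∑ k, evalCoeff t ξ N k) / N) atTop (𝓝 (∑ j, ξ j * (t j : ℝ))) := by
  refine (tendsto_finsetSum Finset.univ fun j _ =>
    (tendsto_sum_leftInd (t j)).const_mul (ξ j)).congr fun N => ?_
  simp only [evalCoeff]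
  rw [Finset.sum_comm, Finset.sum_div]
  refine Finset.sum_congr rfl fun j _ => ?_
  rw [← Finset.mul_sum, mul_div_assoc]

/-- With the limit of the means, `B - A²` becomes `∑ ξ_i ξ_j (min(t_i, t_j) - t_i t_j)`, the bridge
covariance. -/
theorem tendsto_sum_evalCoeff_sq (t : Fin d → unitInterval) (ξ : EuclideanSpace ℝ (Fin d)) :
    Tendsto (fun N : ℕ => (∑ k, evalCoeff t ξ N k ^ 2) / N) atTop
      (𝓝 (∑ i, ∑ j, ξ i * ξ j * ((min (t i) (t j) : unitInterval) : ℝ))) := by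
  refine (tendsto_finsetSum Finset.univ fun i _ => tendsto_finsetSum Finset.univ fun j _ =>
    (tendsto_sum_leftInd (min (t i) (t j))).const_mul (ξ i * ξ j)).congr fun N => ?_
  have e (k : Fin N) : evalCoeff t ξ N k ^ 2 =
      ∑ i, ∑ j, ξ i * ξ j * leftInd N (min (t i) (t j)) k := by
    rw [evalCoeff, sq, Finset.sum_mul_sum]
    refine Finset.sum_congr rfl fun i _ => Finset.sum_congr rfl fun j _ => ?_
    rw [← leftInd_mul]; ring
  have e2 : ∑ k, evalCoeff t ξ N k ^ 2 =
      ∑ i, ∑ j, ∑ k, ξ i * ξ j * leftInd N (min (t i) (t j)) k := by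
    simp_rw [e]
    rw [Finset.sum_comm]
    exact Finset.sum_congr rfl fun i _ => Finset.sum_comm
  rw [e2, Finset.sum_div]
  refine Finset.sum_congr rfl fun i _ => ?_
  rw [Finset.sum_div]
  refine Finset.sum_congr rfl fun j _ => ?_
  rw [← Finset.mul_sum, mul_div_assoc]

theorem IsTest.tendsto_sum_evalCoeff_mul {φ : ℝ → ℝ} {C : ℝ} (hφ : IsTest φ C)
    (t : Fin d → unitInterval) (ξ : EuclideanSpace ℝ (Fin d)) :
    Tendsto (fun N : ℕ => (∑ k : Fin N, evalCoeff t ξ N k * deriv φ (((k : ℕ) + 1 : ℕ) / N)) / N) atTop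
      (𝓝 (∑ j, ξ j * ∫ x in (0 : ℝ)..(t j : ℝ), deriv φ x)) := by
  refine (tendsto_finsetSum Finset.univ fun j _ => (tendsto_riemann hφ.nonneg
    hφ.contDiff_deriv.continuous hφ.bound' hφ.lip' (t j)).const_mul (ξ j)).congr fun N => ?_
  simp only [evalCoeff, Finset.sum_mul]
  rw [Finset.sum_comm, Finset.sum_div]
  refine Finset.sum_congr rfl fun j _ => ?_
  rw [← mul_div_assoc, Finset.mul_sum]
  congr 1
  refine Finset.sum_congr rfl fun k _ => ?_
  rw [leftInd]
  split_ifs <;> ring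

namespace IsTest
variable {φ : ℝ → ℝ} {C : ℝ} (hφ : IsTest φ C)
include hφ

theorem deriv_eq_zero_of_one_le {x : ℝ} (hx : 1 ≤ x) : deriv φ x = 0 :=
  Function.notMem_support.1 fun h => not_lt.2 hx (hφ.supp (support_deriv_subset h)).2

/-- The integral of `φ'` is zero: the direction `φ'` satisfies the zero-mean requirement of
`tendsto_integral_linStat_mul_chr`. -/
theorem tendsto_sum_deriv :
    Tendsto (fun N : ℕ => (∑ k : Fin N, deriv φ (((k : ℕ) + 1 : ℕ) / N)) / N) atTop (𝓝 0) := by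
  have h := tendsto_riemann_univ hφ.nonneg hφ.contDiff_deriv.continuous hφ.bound' hφ.lip'
  rwa [intervalIntegral.integral_eq_sub_of_hasDerivAt (fun x _ => hφ.hasDerivAt x)
    (hφ.contDiff_deriv.continuous.intervalIntegrable _ _), hφ.eq_zero_of_one_le le_rfl,
    hφ.eq_zero_of_le_zero le_rfl, sub_zero] at h

theorem tendsto_sum_deriv_sq :
    Tendsto (fun N : ℕ => (∑ k : Fin N, deriv φ (((k : ℕ) + 1 : ℕ) / N) ^ 2) / N) atTop
      (𝓝 (∫ x in (0 : ℝ)..1, deriv φ x ^ 2)) := by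
  refine tendsto_riemann_univ (f := fun x => deriv φ x ^ 2) (K := 2 * C ^ 2) (by positivity)
    (hφ.contDiff_deriv.continuous.pow 2) (fun x => ?_) fun x y => ?_
  · rw [abs_of_nonneg (sq_nonneg _), ← sq_abs]
    have := pow_le_pow_left₀ (abs_nonneg _) (hφ.bound' x) 2
    nlinarith
  · have e : deriv φ x ^ 2 - deriv φ y ^ 2 = (deriv φ x + deriv φ y) * (deriv φ x - deriv φ y) := by
      ring
    rw [e, abs_mul]
    calc _ ≤ (2 * C) * (C * |x - y|) := by
          have := (abs_add_le (deriv φ x) (deriv φ y)).trans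
            (add_le_add (hφ.bound' x) (hφ.bound' y))
          gcongr
          · linarith [hφ.nonneg]
          · linarith
          · exact hφ.lip' x y
      _ = _ := by ring

/-- The tail integral of `φ''` from `y` is `-φ'(y)`, because `φ'` vanishes at 1. -/
theorem pairing_heightE_deriv_deriv {N : ℕ} (hN : 0 < N) (m : ℝ) (n : Fin N → ℕ) :
    pairing (heightE N m n) (deriv (deriv φ)) =
      -linStat m (fun k => deriv φ (((k : ℕ) + 1 : ℕ) / N) / √N) n := by
  have hc : Continuous (deriv (deriv φ)) := hφ.contDiff_deriv.continuous_deriv le_rfl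
  rw [pairing_heightE hN m n hc, linStat, ← Finset.sum_neg_distrib]
  refine Finset.sum_congr rfl fun k _ => ?_
  rw [intervalIntegral.integral_eq_sub_of_hasDerivAt (f := deriv φ)
    (fun x _ => (hφ.contDiff_deriv.differentiable one_ne_zero x).hasDerivAt)
    (hc.intervalIntegrable _ _), hφ.deriv_eq_zero_of_one_le le_rfl]
  ring

end IsTest

namespace IsLaw
variable {p : ℕ → ℝ} {m α : ℝ} (h : IsLaw p m α) {τ : ℕ → ℝ} {a c σ : ℝ} {φ : ℝ → ℝ} {C : ℝ}
include h

theorem exists_integral_pairing_sq_le (hm : 0 < m) (hφ : IsTest φ C) :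
    ∃ K : ℝ, 0 ≤ K ∧ ∀ᶠ N : ℕ in atTop, ∫ n, pairing (heightE N m n) (deriv (deriv φ)) ^ 2
      ∂(canon p N ⌊(N : ℝ) * m⌋₊) ≤ K := by
  obtain ⟨K, hK, hb⟩ := h.exists_integral_linStat_bounded_sq_le hm C
  refine ⟨K, hK, ?_⟩
  filter_upwards [hb, eventually_gt_atTop 0] with N hN hN0
  simp_rw [hφ.pairing_heightE_deriv_deriv hN0, neg_sq]
  exact hN _ fun i => hφ.bound' _

theorem exists_integral_evalAt_sq_le (hm : 0 < m) (t : Fin d → unitInterval) :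
    ∃ K : ℝ, 0 ≤ K ∧ ∀ᶠ N : ℕ in atTop, ∫ n, ‖evalAt N m t n‖ ^ 2
      ∂(canon p N ⌊(N : ℝ) * m⌋₊) ≤ K := by
  obtain ⟨K, hK, hb⟩ := h.exists_integral_linStat_bounded_sq_le hm 1
  refine ⟨d * K, by positivity, ?_⟩
  filter_upwards [hb] with N hN
  have e (n : Fin N → ℕ) : ‖evalAt N m t n‖ ^ 2 = ∑ j, height N m n (t j) ^ 2 := by
    rw [EuclideanSpace.norm_sq_eq]
    simp [evalAt]
  simp_rw [e]
  rw [integral_finsetSum _ fun _ _ => integrable_canon p _ _ _]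
  refine (Finset.sum_le_sum (g := fun _ => K) fun j _ => ?_).trans_eq (by simp)
  simp_rw [height_eq_linStat]
  exact hN _ (abs_leftInd_le N (t j))

theorem exists_integral_density_diff_sq_le (hm : 0 < m) (hτs : Summable fun k => τ k ^ 2 * p k)
    (hφ : IsTest φ C) :
    ∃ K : ℝ, ∀ᶠ N : ℕ in atTop, ∫ n, ‖∑ i, (τ (n i) : ℂ) * rateCoeff φ N i -
      limitDensity c σ φ (heightE N m n)‖ ^ 2 ∂(canon p N ⌊(N : ℝ) * m⌋₊) ≤ K := by
  obtain ⟨K₁, h₁⟩ := h.exists_integral_rate_sq_le hm hτs hφ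
  obtain ⟨K₂, _, h₂⟩ := h.exists_integral_pairing_sq_le hm hφ
  set b : ℝ := σ ^ 2 / 2 * ∫ x : unitInterval, φ x ^ 2 with hb
  refine ⟨3 * (K₁ + c ^ 2 * K₂ + b ^ 2), ?_⟩
  filter_upwards [h₁, h₂, eventually_gt_atTop 0] with N hN₁ hN₂ hN
  have := isProbabilityMeasure_canon h.pos (M := ⌊(N : ℝ) * m⌋₊) (Or.inl hN)
  calc _ ≤ ∫ n, 3 * (‖∑ i, (τ (n i) : ℂ) * rateCoeff φ N i‖ ^ 2 +
        c ^ 2 * pairing (heightE N m n) (deriv (deriv φ)) ^ 2 + b ^ 2)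
          ∂(canon p N ⌊(N : ℝ) * m⌋₊) := by
        refine integral_mono (integrable_canon p _ _ _) (integrable_canon p _ _ _) fun n => ?_
        dsimp only
        rw [limitDensity, ← hb, ← sub_add]
        set A := ∑ i, (τ (n i) : ℂ) * rateCoeff φ N i
        set q := pairing (heightE N m n) (deriv (deriv φ))
        have h3 := norm_add_le (A - Complex.I * c * q) (b : ℂ)
        have h4 := norm_sub_le A (Complex.I * c * q)
        have h5 : ‖Complex.I * (c : ℂ) * (q : ℂ)‖ = |c * q| := by
          rw [norm_mul, norm_mul, Complex.norm_I, one_mul, Complex.norm_real, Complex.norm_real,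
            ← norm_mul, Real.norm_eq_abs]
        have h6 : ‖(b : ℂ)‖ = |b| := by rw [Complex.norm_real, Real.norm_eq_abs]
        rw [h5] at h4
        rw [h6] at h3
        have h7 : ‖A - Complex.I * c * q + b‖ ≤ ‖A‖ + |c * q| + |b| := by linarith
        have h8 := pow_le_pow_left₀ (norm_nonneg _) h7 2
        refine h8.trans ?_
        rw [← mul_pow, ← sq_abs (c * q), ← sq_abs b]
        nlinarith [sq_nonneg (‖A‖ - |c * q|), sq_nonneg (‖A‖ - |b|), sq_nonneg (|c * q| - |b|)]
    _ ≤ _ := by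
        rw [integral_const_mul, integral_add (integrable_canon p _ _ _) (integrable_canon p _ _ _),
          integral_add (integrable_canon p _ _ _) (integrable_canon p _ _ _), integral_const_mul]
        simp only [integral_const, probReal_univ, one_smul]
        gcongr

/-- The heart of the matter: the two densities have the same limit against every character of
finitely many height values, thanks to the values of `c` and `σ`. -/
theorem tendsto_integral_char_density_diff (hm : 0 < m) (hτ0 : τ 0 = 0)
    (hτ : ∀ k, τ (k + 1) * p (k + 1) = a * p k) (hφ : IsTest φ C) (hc : c = a / (2 * α))
    (hσ : σ ^ 2 = a) (t : Fin d → unitInterval) (ξ : EuclideanSpace ℝ (Fin d)) :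
    Tendsto (fun N : ℕ => ∫ n, Complex.exp (Complex.I * (inner ℝ ξ (evalAt N m t n) : ℝ)) *
      (∑ i, (τ (n i) : ℂ) * rateCoeff φ N i - limitDensity c σ φ (heightE N m n))
      ∂(canon p N ⌊(N : ℝ) * m⌋₊)) atTop (𝓝 0) := by
  have hα := h.var_pos
  have hA := tendsto_sum_evalCoeff t ξ
  have hB := tendsto_sum_evalCoeff_sq t ξ
  have hL := hφ.tendsto_sum_evalCoeff_mul t ξ
  set A := ∑ j, ξ j * (t j : ℝ)
  set B := ∑ i, ∑ j, ξ i * ξ j * ((min (t i) (t j) : unitInterval) : ℝ)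
  set L := ∑ j, ξ j * ∫ x in (0 : ℝ)..(t j : ℝ), deriv φ x
  set χ := Real.exp (-(α / 2 * (B - A ^ 2)))
  have hbd (N : ℕ) (k : Fin N) : |evalCoeff t ξ N k| ≤ max C (∑ j, |ξ j|) :=
    (abs_evalCoeff_le t ξ N k).trans (le_max_right _ _)
  have h1 := h.tendsto_integral_rate_mul_chr hm hτ0 hτ hφ hbd hA hB hL
  have h2 := h.tendsto_integral_linStat_mul_chr hm hbd
    (η := fun N k => deriv φ (((k : ℕ) + 1 : ℕ) / N))
    (fun N k => (hφ.bound' _).trans (le_max_left _ _)) hA hB hφ.tendsto_sum_deriv hL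
    hφ.tendsto_sum_deriv_sq
  have h3 := h.tendsto_integral_chr _ (tendsto_floor_sub m hm) _ hbd hA hB
  have hint : ∫ x : unitInterval, φ x ^ 2 = ∫ x in (0 : ℝ)..1, φ x ^ 2 :=
    integral_unitInterval fun x => φ x ^ 2
  have h4 := (h1.add (h2.const_mul (Complex.I * c))).add
    (h3.const_mul ((σ ^ 2 / 2 * ∫ x : unitInterval, φ x ^ 2 : ℝ) : ℂ))
  -- The contributions in `L` are `a/2` and `-cα`, which cancel as `c = a/(2α)`; those in `∫ φ²`
  -- cancel as `σ² = a`.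
  have e : (a : ℂ) * ((L / 2 - (∫ x in (0 : ℝ)..1, φ x ^ 2) / 2 : ℝ) : ℂ) * (χ : ℝ) +
      Complex.I * c * (Complex.I * α * L * (χ : ℝ)) +
      ((σ ^ 2 / 2 * ∫ x : unitInterval, φ x ^ 2 : ℝ) : ℂ) * (χ : ℝ) = 0 := by
    have hαC : (α : ℂ) ≠ 0 := by exact_mod_cast hα.ne'
    rw [hint, hσ, hc]
    push_cast
    field_simp
    ring_nf
    rw [Complex.I_sq]
    ring
  rw [e] at h4
  refine h4.congr' ?_
  filter_upwards [eventually_gt_atTop 0] with N hN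
  rw [← integral_const_mul, ← integral_const_mul, ← integral_add (integrable_canon p _ _ _)
    (integrable_canon p _ _ _), ← integral_add (integrable_canon p _ _ _) (integrable_canon p _ _ _)]
  congr 1
  funext n
  rw [exp_inner_evalAt, limitDensity, hφ.pairing_heightE_deriv_deriv hN]
  push_cast
  ring

end IsLaw

end

section


/-! ### Step functions -/

theorem dist_toE {f g : unitInterval → ℝ} (hf : MemLp f 1 (volume : Measure unitInterval))
    (hg : MemLp g 1 (volume : Measure unitInterval)) : dist (toE f) (toE g) = ∫ x, |f x - g x| := by
  rw [dist_eq_norm, L1.norm_eq_integral_norm]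
  refine integral_congr_ae ?_
  filter_upwards [coeFn_toE hf, coeFn_toE hg, Lp.coeFn_sub (toE f) (toE g)] with x h1 h2 h3
  rw [h3, Pi.sub_apply, h1, h2, Real.norm_eq_abs]

/-- The grid points `j / (K + 1)`. -/
def gridPt (K : ℕ) (j : Fin (K + 2)) : unitInterval :=
  ⟨(j : ℕ) / ((K : ℝ) + 1), by positivity, by
    rw [div_le_one (by positivity)]
    exact_mod_cast Nat.lt_succ_iff.1 j.2⟩

/-- The index of the last grid point to the left of `x`. -/
def gridIdx (K : ℕ) (x : unitInterval) : Fin (K + 2) :=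
  ⟨⌊(x : ℝ) * ((K + 1 : ℕ) : ℝ)⌋₊, by
    -- The point `x = 1` has index `K + 1`, hence `K + 2` grid points.
    rw [Nat.floor_lt (mul_nonneg x.2.1 (Nat.cast_nonneg _))]
    calc (x : ℝ) * ((K + 1 : ℕ) : ℝ) ≤ 1 * ((K + 1 : ℕ) : ℝ) := by gcongr; exact x.2.2
      _ < ((K + 2 : ℕ) : ℝ) := by push_cast; linarith⟩

theorem measurable_gridIdx (K : ℕ) : Measurable (gridIdx K) := by
  refine measurable_to_countable' fun j => ?_
  have : gridIdx K ⁻¹' {j} = (fun x : unitInterval => ⌊(x : ℝ) * ((K + 1 : ℕ) : ℝ)⌋₊) ⁻¹' {(j : ℕ)} := by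
    ext x
    simp [gridIdx, Fin.ext_iff]
  rw [this]
  exact measurable_floor_mul (K + 1) (measurableSet_singleton _)

theorem gridPt_gridIdx_le (K : ℕ) (x : unitInterval) : (gridPt K (gridIdx K x) : ℝ) ≤ x := by
  have h := Nat.floor_le (mul_nonneg x.2.1 (Nat.cast_nonneg (K + 1)))
  simp only [gridPt, gridIdx]
  rw [div_le_iff₀ (by positivity)]
  push_cast at h ⊢
  exact h

theorem le_gridPt_gridIdx_add (K : ℕ) (x : unitInterval) :
    (x : ℝ) ≤ gridPt K (gridIdx K x) + 1 / (K + 1) := by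
  have h := (Nat.lt_floor_add_one ((x : ℝ) * ((K + 1 : ℕ) : ℝ))).le
  simp only [gridPt, gridIdx]
  rw [← add_div, le_div_iff₀ (by positivity)]
  push_cast at h ⊢
  exact h

theorem tendsto_gridPt_gridIdx (x : unitInterval) :
    Tendsto (fun K => gridPt K (gridIdx K x)) atTop (𝓝 x) := by
  rw [tendsto_subtype_rng]
  have h1 : Tendsto (fun K : ℕ => (x : ℝ) - 1 / ((K : ℝ) + 1)) atTop (𝓝 x) := by
    simpa using tendsto_one_div_add_atTop_nhds_zero_nat.const_sub (x : ℝ)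
  refine tendsto_of_tendsto_of_tendsto_of_le_of_le h1 tendsto_const_nhds (fun K => ?_) fun K =>
    gridPt_gridIdx_le K x
  dsimp only
  linarith [le_gridPt_gridIdx_add K x]

/-- The step function with given values on the cells of the grid. -/
def stepE (K : ℕ) (v : EuclideanSpace ℝ (Fin (K + 2))) : E := toE fun x => v (gridIdx K x)

theorem memLp_step (K : ℕ) (v : EuclideanSpace ℝ (Fin (K + 2))) :
    MemLp (fun x => v (gridIdx K x)) 1 (volume : Measure unitInterval) := by
  refine MemLp.of_bound (C := ‖v‖) ?_ (ae_of_all _ fun x => ?_)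
  · exact ((measurable_from_top (f := fun j => v j)).comp (measurable_gridIdx K)).aestronglyMeasurable
  · exact PiLp.norm_apply_le v _

theorem lipschitzWith_stepE (K : ℕ) : LipschitzWith 1 (stepE K) := by
  refine LipschitzWith.of_dist_le_mul fun v w => ?_
  rw [stepE, stepE, dist_toE (memLp_step K v) (memLp_step K w), NNReal.coe_one, one_mul, dist_eq_norm]
  have h1 (x : unitInterval) : |v (gridIdx K x) - w (gridIdx K x)| ≤ ‖v - w‖ := by
    have := PiLp.norm_apply_le (v - w) (gridIdx K x)
    rwa [PiLp.sub_apply, Real.norm_eq_abs] at this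
  calc ∫ x : unitInterval, |v (gridIdx K x) - w (gridIdx K x)|
      ≤ ∫ _x : unitInterval, ‖v - w‖ := by
        refine integral_mono ?_ (integrable_const _) h1
        exact ((memLp_step K v).sub (memLp_step K w)).integrable le_rfl |>.abs
    _ = ‖v - w‖ := by simp

theorem sum_leftInd_sub_sq_le {N : ℕ} {s t : unitInterval} (hst : s ≤ t) :
    ∑ k, (leftInd N t k - leftInd N s k) ^ 2 ≤ ((t : ℝ) - s) * N + 1 := by
  have e (k : Fin N) : (leftInd N t k - leftInd N s k) ^ 2 = leftInd N t k - leftInd N s k := by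
    have h1 := leftInd_mul N s t k
    rw [min_eq_left hst] at h1
    have h2 := leftInd_mul N s s k
    have h3 := leftInd_mul N t t k
    rw [min_self] at h2 h3
    linear_combination h2 + h3 - 2 * h1
  have hs (t : unitInterval) : ∑ k, leftInd N t k = ⌊(t : ℝ) * N⌋₊ := by
    have hle : ⌊(t : ℝ) * N⌋₊ ≤ N := by
      refine Nat.floor_le_of_le ?_
      exact mul_le_of_le_one_left (Nat.cast_nonneg _) t.2.2
    have := sum_fin_ite hle fun _ => (1 : ℝ)
    simpa [leftInd] using this
  simp_rw [e]
  rw [Finset.sum_sub_distrib, hs, hs]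
  have h1 := Nat.floor_le (mul_nonneg t.2.1 (Nat.cast_nonneg N))
  have h2 := Nat.lt_floor_add_one ((s : ℝ) * N)
  linarith

namespace IsLaw
variable {p : ℕ → ℝ} {m α : ℝ} (h : IsLaw p m α)
include h

/-- The height increment between a point and its grid point involves about `N/(K+1)` sites, so its
second moment is `O(1/(K+1))`. Integrating over `x` needs only pointwise moments: no tightness of
paths enters. -/
theorem exists_integral_dist_stepE_le (hm : 0 < m) :
    ∃ C : ℝ, 0 ≤ C ∧ ∀ K : ℕ, ∀ᶠ N : ℕ in atTop, ∫ n, dist (heightE N m n)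
      (stepE K (evalAt N m (gridPt K) n)) ∂(canon p N ⌊(N : ℝ) * m⌋₊) ≤ C / √((K : ℝ) + 1) := by
  obtain ⟨B, hB, hb⟩ := h.exists_integral_linStat_sq_le hm
  refine ⟨1 / 2 + B, by positivity, fun K => ?_⟩
  -- `N ≥ K + 1` absorbs the extra site caused by rounding, whence the factor 2 in the variance.
  filter_upwards [hb, eventually_gt_atTop 0, eventually_ge_atTop (K + 1)] with N hN hN0 hNK
  have := isProbabilityMeasure_canon h.pos (M := ⌊(N : ℝ) * m⌋₊) (Or.inl hN0)
  have hNpos : (0 : ℝ) < N := by exact_mod_cast hN0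
  set s := √((K : ℝ) + 1) with hs
  have hs0 : 0 < s := Real.sqrt_pos.2 (by positivity)
  have hss : s ^ 2 = K + 1 := Real.sq_sqrt (by positivity)
  have hpt (x : unitInterval) : ∫ n, |height N m n x - height N m n (gridPt K (gridIdx K x))|
      ∂(canon p N ⌊(N : ℝ) * m⌋₊) ≤ (1 / 2 + B) / s := by
    set y := gridPt K (gridIdx K x)
    have hyx : y ≤ x := gridPt_gridIdx_le K x
    have e (n : Fin N → ℕ) : height N m n x - height N m n y =
        linStat m (fun k => (leftInd N x k - leftInd N y k) / √N) n := by
      rw [height_eq_linStat, height_eq_linStat, linStat, linStat, linStat, ← Finset.sum_sub_distrib]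
      refine Finset.sum_congr rfl fun k _ => ?_
      ring
    have h2 : ∫ n, (height N m n x - height N m n y) ^ 2 ∂(canon p N ⌊(N : ℝ) * m⌋₊) ≤
        B * (2 / s ^ 2) := by
      simp_rw [e]
      refine (hN _).trans ?_
      gcongr
      simp_rw [div_pow, Real.sq_sqrt hNpos.le]
      rw [← Finset.sum_div, div_le_div_iff₀ hNpos (by positivity), hss]
      have h3 := sum_leftInd_sub_sq_le (N := N) hyx
      have h4 : (x : ℝ) - y ≤ 1 / (K + 1) := by linarith [le_gridPt_gridIdx_add K x]
      have h5 : ((K : ℝ) + 1) ≤ N := by exact_mod_cast hNK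
      calc _ ≤ (1 / ((K : ℝ) + 1) * N + 1) * (K + 1) := by
            gcongr
            exact h3.trans (by gcongr)
        _ = N + (K + 1) := by field_simp
        _ ≤ 2 * N := by linarith
    -- Young's inequality `|r| ≤ 1/(2s) + (s/2) r²`, with `s = √(K+1)` balancing the two terms.
    calc _ ≤ ∫ n, (1 / (2 * s) + s / 2 * (height N m n x - height N m n y) ^ 2)
          ∂(canon p N ⌊(N : ℝ) * m⌋₊) := by
          refine integral_mono (integrable_canon p _ _ _) (integrable_canon p _ _ _) fun n => ?_
          dsimp only
          set r := height N m n x - height N m n y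
          rw [← sq_abs]
          have : 1 / (2 * s) + s / 2 * |r| ^ 2 - |r| = (1 - s * |r|) ^ 2 / (2 * s) := by
            field_simp; ring
          have : 0 ≤ (1 - s * |r|) ^ 2 / (2 * s) := by positivity
          linarith
      _ ≤ 1 / (2 * s) + s / 2 * (B * (2 / s ^ 2)) := by
          rw [integral_add (integrable_canon p _ _ _) (integrable_canon p _ _ _), integral_const_mul]
          simp only [integral_const, probReal_univ, one_smul]
          gcongr
      _ = (1 / 2 + B) / s := by field_simp
  have e (n : Fin N → ℕ) : dist (heightE N m n) (stepE K (evalAt N m (gridPt K) n)) =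
      ∫ x, |height N m n x - height N m n (gridPt K (gridIdx K x))| := by
    rw [heightE, stepE, dist_toE (memLp_height N m n) (memLp_step K _)]
    rfl
  have hint (n : Fin N → ℕ) : Integrable fun x : unitInterval =>
      |height N m n x - height N m n (gridPt K (gridIdx K x))| :=
    (((memLp_height N m n).sub (memLp_step K (evalAt N m (gridPt K) n))).integrable le_rfl).abs
  simp_rw [e, integral_canon h.pos, ← integral_smul]
  have hint2 (n : Fin N → ℕ) : Integrable fun x : unitInterval =>
      ((∏ j, p (n j)) / mass p N ⌊(N : ℝ) * m⌋₊) •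
        |height N m n x - height N m n (gridPt K (gridIdx K x))| := (hint n).const_mul _
  rw [← integral_finsetSum _ fun n _ => hint2 n]
  have hle (x : unitInterval) : (∑ n ∈ Finset.piAntidiag (Finset.univ : Finset (Fin N)) ⌊(N : ℝ) * m⌋₊,
      ((∏ j, p (n j)) / mass p N ⌊(N : ℝ) * m⌋₊) •
        |height N m n x - height N m n (gridPt K (gridIdx K x))|) ≤ (1 / 2 + B) / s := by
    have := hpt x
    rwa [integral_canon h.pos] at this
  calc _ ≤ ∫ _x : unitInterval, (1 / 2 + B) / s := by
        refine integral_mono ?_ (integrable_const _) hle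
        exact integrable_finsetSum _ fun n _ => hint2 n
    _ = _ := by simp

/-- Convergence of finite-dimensional distributions of a weighted height function implies
convergence of the integrals of Lipschitz functions. -/
theorem tendsto_integral_lipschitz_mul (hm : 0 < m) {G : ∀ N : ℕ, (Fin N → ℕ) → ℂ} {B : ℝ}
    (hG : ∀ᶠ N in atTop, ∫ n, ‖G N n‖ ^ 2 ∂(canon p N ⌊(N : ℝ) * m⌋₊) ≤ B)
    (hchar : ∀ (K : ℕ) (ξ : EuclideanSpace ℝ (Fin (K + 2))), Tendsto (fun N : ℕ =>
      ∫ n, Complex.exp (Complex.I * (inner ℝ ξ (evalAt N m (gridPt K) n) : ℝ)) * G N n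
      ∂(canon p N ⌊(N : ℝ) * m⌋₊)) atTop (𝓝 0))
    {F : E → ℝ} {L : NNReal} (hF : LipschitzWith L F) {b : ℝ} (hb : ∀ u, |F u| ≤ b) :
    Tendsto (fun N : ℕ => ∫ n, (F (heightE N m n) : ℂ) * G N n ∂(canon p N ⌊(N : ℝ) * m⌋₊)) atTop
      (𝓝 0) := by
  obtain ⟨C, hC, hCb⟩ := h.exists_integral_dist_stepE_le hm
  have hb0 : 0 ≤ b := (abs_nonneg _).trans (hb 0)
  have hsq : Tendsto (fun K : ℕ => √((K : ℝ) + 1)) atTop atTop :=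
    Real.tendsto_sqrt_atTop.comp (tendsto_natCast_atTop_atTop.atTop_add tendsto_const_nhds)
  have hsq2 : Tendsto (fun K : ℕ => √√((K : ℝ) + 1)) atTop atTop :=
    Real.tendsto_sqrt_atTop.comp hsq
  have hδ : Tendsto (fun K : ℕ => (B + 2 * b * L * C) / √√((K : ℝ) + 1)) atTop (𝓝 0) :=
    tendsto_const_nhds.div_atTop hsq2
  refine tendsto_of_approx (b := fun K N => ∫ n, (F (stepE K (evalAt N m (gridPt K) n)) : ℂ) * G N n
    ∂(canon p N ⌊(N : ℝ) * m⌋₊)) (c := fun _ => 0) hδ (Eventually.of_forall fun K => ?_)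
    (Eventually.of_forall fun K => ?_) tendsto_const_nhds
  · filter_upwards [hG, hCb K] with N h1 h2
    rw [← integral_sub (integrable_canon p _ _ _) (integrable_canon p _ _ _)]
    refine (norm_integral_le_integral_norm _).trans ?_
    -- The mean distance is `C/s²`, and `|ΔF|² ≤ 2bL · dist`. Young's inequality with weight `s`
    -- balances `‖G‖²/s` against `s |ΔF|²`, each of order `1/s`.
    set s := √√((K : ℝ) + 1) with hs
    have hs0 : 0 < s := Real.sqrt_pos.2 (Real.sqrt_pos.2 (by positivity))
    have hss : √((K : ℝ) + 1) = s ^ 2 := (Real.sq_sqrt (Real.sqrt_nonneg _)).symm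
    rw [hss] at h2
    calc _ ≤ ∫ n, (1 / s * ‖G N n‖ ^ 2 + s * (2 * b * L) *
          dist (heightE N m n) (stepE K (evalAt N m (gridPt K) n))) ∂(canon p N ⌊(N : ℝ) * m⌋₊) := by
          refine integral_mono (integrable_canon p _ _ _) (integrable_canon p _ _ _) fun n => ?_
          dsimp only
          set u := heightE N m n
          set v := stepE K (evalAt N m (gridPt K) n)
          rw [← sub_mul, ← Complex.ofReal_sub, norm_mul, Complex.norm_real, Real.norm_eq_abs]
          have h3 : |F u - F v| ≤ L * dist u v := by
            have := hF.dist_le_mul u v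
            rwa [Real.dist_eq] at this
          have h4 : |F u - F v| ≤ 2 * b := by
            have := abs_sub (F u) (F v)
            linarith [hb u, hb v]
          have h5 : |F u - F v| ^ 2 ≤ 2 * b * L * dist u v := by
            rw [sq, mul_assoc]
            gcongr
          have h6 : |F u - F v| * ‖G N n‖ ≤ 1 / s * ‖G N n‖ ^ 2 + s * |F u - F v| ^ 2 := by
            have e : 1 / s * ‖G N n‖ ^ 2 + s * |F u - F v| ^ 2 - |F u - F v| * ‖G N n‖ =
              ((‖G N n‖ - s * |F u - F v|) ^ 2 + ‖G N n‖ * (s * |F u - F v|)) / s := by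
              field_simp; ring
            have : 0 ≤ ((‖G N n‖ - s * |F u - F v|) ^ 2 + ‖G N n‖ * (s * |F u - F v|)) / s := by
              positivity
            linarith
          calc _ ≤ 1 / s * ‖G N n‖ ^ 2 + s * |F u - F v| ^ 2 := h6
            _ ≤ 1 / s * ‖G N n‖ ^ 2 + s * (2 * b * L * dist u v) := by gcongr
            _ = _ := by ring
      _ ≤ 1 / s * B + s * (2 * b * L) * (C / s ^ 2) := by
          rw [integral_add (integrable_canon p _ _ _) (integrable_canon p _ _ _), integral_const_mul,
            integral_const_mul]
          gcongr
      _ = _ := by field_simp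
  · obtain ⟨B', _, hB'⟩ := h.exists_integral_evalAt_sq_le hm (gridPt K)
    refine tendsto_integral_of_tendsto_char h.pos (K := max B B') ?_ ?_ (hchar K)
      (f := fun v => F (stepE K v)) (hF.continuous.comp (lipschitzWith_stepE K).continuous)
      (fun v => hb _)
    · filter_upwards [hG] with N h1 using h1.trans (le_max_left _ _)
    · filter_upwards [hB'] with N h1 using h1.trans (le_max_right _ _)

end IsLaw

/-! ### Lipschitz approximation from below -/

section InfConvolution
variable {X : Type*} [PseudoMetricSpace X]

/-- The largest `k`-Lipschitz minorant. -/
def infConv (F : X → ℝ) (k : ℕ) (u : X) : ℝ := ⨅ v, (F v + k * dist u v)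

variable {F : X → ℝ} {b : ℝ} (hb : ∀ u, |F u| ≤ b)
include hb

theorem bddBelow_infConv (k : ℕ) (u : X) : BddBelow (Set.range fun v => F v + k * dist u v) := by
  refine ⟨-b, ?_⟩
  rintro _ ⟨v, rfl⟩
  have := (abs_le.1 (hb v)).1
  have h2 : 0 ≤ (k : ℝ) * dist u v := by positivity
  dsimp only
  linarith

theorem infConv_le (k : ℕ) (u : X) : infConv F k u ≤ F u := by
  have := ciInf_le (bddBelow_infConv hb k u) u
  rwa [dist_self, mul_zero, add_zero] at this

theorem abs_infConv_le (k : ℕ) (u : X) : |infConv F k u| ≤ b := by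
  have : Nonempty X := ⟨u⟩
  rw [abs_le]
  refine ⟨le_ciInf fun v => ?_, (infConv_le hb k u).trans (abs_le.1 (hb u)).2⟩
  have := (abs_le.1 (hb v)).1
  have h2 : 0 ≤ (k : ℝ) * dist u v := by positivity
  linarith

theorem lipschitzWith_infConv (k : ℕ) : LipschitzWith k (infConv F k) := by
  refine LipschitzWith.of_le_add_mul _ fun u w => ?_
  have : Nonempty X := ⟨u⟩
  rw [← sub_le_iff_le_add]
  refine le_ciInf fun v => ?_
  have h1 := ciInf_le (bddBelow_infConv hb k u) v
  have h2 := dist_triangle u w v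
  have h3 : (k : ℝ) * dist u v ≤ k * (dist u w + dist w v) := by gcongr
  rw [NNReal.coe_natCast]
  rw [infConv]
  linarith

/-- For `k δ ≥ 2b`, points at distance at least `δ` are too costly to compete in the infimum; at
closer points continuity controls `F`. -/
theorem tendsto_infConv (hF : Continuous F) (u : X) :
    Tendsto (fun k => infConv F k u) atTop (𝓝 (F u)) := by
  have : Nonempty X := ⟨u⟩
  rw [Metric.tendsto_nhds]
  intro ε hε
  obtain ⟨δ, hδ, hball⟩ := Metric.continuous_iff.1 hF u (ε / 2) (by positivity)
  filter_upwards [(tendsto_natCast_atTop_atTop (R := ℝ)).eventually_ge_atTop (2 * b / δ)] with k hk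
  rw [div_le_iff₀ hδ] at hk
  have h1 : F u - ε / 2 ≤ infConv F k u := by
    refine le_ciInf fun v => ?_
    by_cases hv : dist v u < δ
    · have := hball v hv
      rw [Real.dist_eq] at this
      have h2 := (abs_lt.1 this).1
      have h3 : 0 ≤ (k : ℝ) * dist u v := by positivity
      linarith
    · rw [not_lt, dist_comm] at hv
      have h2 := (abs_le.1 (hb v)).1
      have h3 := (abs_le.1 (hb u)).2
      have h4 : (k : ℝ) * δ ≤ k * dist u v := by gcongr
      linarith
  rw [Real.dist_eq, abs_lt]
  have := infConv_le hb k u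
  constructor <;> linarith

end InfConvolution

end

section


/-! ### The Brownian bridge -/

variable {Ω : Type*} [MeasurableSpace Ω] {Y : unitInterval → Ω → ℝ} {P : Measure Ω}

/-- Values of a multiple of a process at finitely many points. -/
def scaledEval {d : ℕ} (s : ℝ) (Y : unitInterval → Ω → ℝ) (t : Fin d → unitInterval) (ω : Ω) :
    EuclideanSpace ℝ (Fin d) := WithLp.toLp 2 fun j => s * Y (t j) ω

/-- The law on `E` of a multiple of a process. -/
def scaledLaw (s : ℝ) (Y : unitInterval → Ω → ℝ) (P : Measure Ω) : Measure E :=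
  P.map fun ω => toE fun t => s * Y t ω

namespace IsBrownianBridge
variable (hY : IsBrownianBridge Y P)
include hY

theorem hasGaussianLaw_scaledEval {d : ℕ} (s : ℝ) (t : Fin d → unitInterval) :
    HasGaussianLaw (scaledEval s Y t) P := by
  have h1 := (hY.gaussian.comp_right t).hasGaussianLaw Finset.univ
  let L : ({x // x ∈ (Finset.univ : Finset (Fin d))} → ℝ) →ₗ[ℝ] EuclideanSpace ℝ (Fin d) :=
    { toFun := fun x => WithLp.toLp 2 fun j => s * x ⟨j, Finset.mem_univ j⟩
      map_add' := fun x y => by ext j; simp [mul_add]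
      map_smul' := fun r x => by ext j; simp; ring }
  exact h1.map_fun (LinearMap.toContinuousLinearMap L)

/-- Since `min · max` is the product of the two times, the bridge covariance equals `min(s,t) - st`,
which gives the same form `B - A²` as the conditioned law. -/
theorem charFun_scaledEval {d : ℕ} (s : ℝ) (t : Fin d → unitInterval)
    (ξ : EuclideanSpace ℝ (Fin d)) :
    charFun (P.map (scaledEval s Y t)) ξ = (Real.exp (-(s ^ 2 / 2 *
      ((∑ i, ∑ j, ξ i * ξ j * ((min (t i) (t j) : unitInterval) : ℝ)) -
        (∑ j, ξ j * (t j : ℝ)) ^ 2))) : ℝ) := by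
  have hprob := hY.gaussian.isProbabilityMeasure
  have hL2 (t : unitInterval) : MemLp (Y t) 2 P := (hY.gaussian.hasGaussianLaw_eval t).memLp_two
  rw [(hY.hasGaussianLaw_scaledEval s t).charFun_map_eq]
  have e (ω : Ω) : inner ℝ ξ (scaledEval s Y t ω) = ∑ j, (ξ j * s) * Y (t j) ω := by
    simp only [PiLp.inner_apply, scaledEval, RCLike.inner_apply, conj_trivial]
    exact Finset.sum_congr rfl fun j _ => by ring
  simp_rw [e]
  have h1 : ∫ ω, ∑ j, (ξ j * s) * Y (t j) ω ∂P = 0 := by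
    rw [integral_finsetSum _ fun j _ => ((hL2 (t j)).integrable one_le_two).const_mul _]
    refine Finset.sum_eq_zero fun j _ => ?_
    rw [integral_const_mul, hY.centered, mul_zero]
  have hL2' (j : Fin d) : MemLp (fun ω => (ξ j * s) * Y (t j) ω) 2 P := (hL2 (t j)).const_mul _
  have h2 : Var[fun ω => ∑ j, (ξ j * s) * Y (t j) ω; P] = s ^ 2 *
      ((∑ i, ∑ j, ξ i * ξ j * ((min (t i) (t j) : unitInterval) : ℝ)) -
        (∑ j, ξ j * (t j : ℝ)) ^ 2) := by
    rw [← covariance_self (memLp_finsetSum _ fun j _ => hL2' j).aemeasurable,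
      covariance_fun_sum_fun_sum hL2' hL2', sq (∑ j, ξ j * (t j : ℝ)), Finset.sum_mul_sum,
      ← Finset.sum_sub_distrib, Finset.mul_sum]
    refine Finset.sum_congr rfl fun i _ => ?_
    rw [← Finset.sum_sub_distrib, Finset.mul_sum]
    refine Finset.sum_congr rfl fun j _ => ?_
    rw [covariance_const_mul_left, covariance_const_mul_right, hY.covariance]
    have h3 : ((min (t i) (t j) : unitInterval) : ℝ) = min (t i : ℝ) (t j) :=
      (Subtype.mono_coe _).map_min
    have h4 := min_mul_max (t i : ℝ) (t j)
    rw [h3]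
    linear_combination (-(ξ i * s * (ξ j * s))) * h4
  rw [h1, h2]
  push_cast
  congr 1
  ring

/-- For a continuous path the sampled values converge at every point, and boundedness on `[0,1]`
gives convergence in `L¹`. -/
theorem tendsto_stepE_scaledEval (s : ℝ) : ∀ᵐ ω ∂P, Tendsto
    (fun K => stepE K (scaledEval s Y (gridPt K) ω)) atTop (𝓝 (toE fun t => s * Y t ω)) := by
  filter_upwards [hY.continuous] with ω hω
  have hc : Continuous fun t => s * Y t ω := hω.const_mul s
  set f : unitInterval → ℝ := fun t => s * Y t ω with hf
  rw [tendsto_iff_dist_tendsto_zero]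
  have e (K : ℕ) : dist (stepE K (scaledEval s Y (gridPt K) ω)) (toE f) =
      ∫ x, |f (gridPt K (gridIdx K x)) - f x| := by
    rw [stepE, dist_toE (memLp_step K _) (memLp_of_continuous hc)]
    rfl
  simp_rw [e]
  obtain ⟨C, hC⟩ : ∃ C, ∀ x, ‖f x‖ ≤ C := by
    obtain ⟨C, hC⟩ := isCompact_univ.exists_bound_of_continuousOn hc.continuousOn
    exact ⟨C, fun x => hC x trivial⟩
  have h0 : (0 : ℝ) = ∫ _x : unitInterval, (0 : ℝ) := by simp
  rw [h0]
  refine tendsto_integral_of_dominated_convergence (fun _ => C + C) (fun K => ?_)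
    (integrable_const _) (fun K => ae_of_all _ fun x => ?_) (ae_of_all _ fun x => ?_)
  · exact (((memLp_step K (scaledEval s Y (gridPt K) ω)).sub (memLp_of_continuous hc)).integrable
      le_rfl).abs.aestronglyMeasurable
  · rw [Real.norm_eq_abs, abs_abs, ← Real.norm_eq_abs]
    exact (norm_sub_le _ _).trans (add_le_add (hC _) (hC _))
  · have := ((hc.tendsto x).comp (tendsto_gridPt_gridIdx x)).sub_const (f x)
    rw [sub_self] at this
    simpa using this.abs

/-- An almost sure limit of measurable step functions. Without this, the image measure would take
the default value zero. -/
theorem aemeasurable_toE (s : ℝ) : AEMeasurable (fun ω => toE fun t => s * Y t ω) P :=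
  aemeasurable_of_tendsto_metrizable_ae atTop (fun K =>
    (lipschitzWith_stepE K).continuous.measurable.comp_aemeasurable
      (hY.hasGaussianLaw_scaledEval s (gridPt K)).aemeasurable) (hY.tendsto_stepE_scaledEval s)

theorem isProbabilityMeasure_scaledLaw (s : ℝ) : IsProbabilityMeasure (scaledLaw s Y P) :=
  have := hY.gaussian.isProbabilityMeasure
  Measure.isProbabilityMeasure_map (hY.aemeasurable_toE s)

theorem tendsto_integral_stepE (s : ℝ) {F : E → ℝ} (hF : Continuous F) {b : ℝ} (hb : ∀ u, |F u| ≤ b) :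
    Tendsto (fun K => ∫ ω, F (stepE K (scaledEval s Y (gridPt K) ω)) ∂P) atTop
      (𝓝 (∫ u, F u ∂(scaledLaw s Y P))) := by
  have := hY.gaussian.isProbabilityMeasure
  rw [scaledLaw, integral_map (hY.aemeasurable_toE s) hF.measurable.aestronglyMeasurable]
  refine tendsto_integral_of_dominated_convergence (fun _ => b) (fun K => ?_) (integrable_const _)
    (fun K => ae_of_all _ fun ω => hb _) ?_
  · exact ((hF.comp (lipschitzWith_stepE K).continuous).measurable.comp_aemeasurable
      (hY.hasGaussianLaw_scaledEval s (gridPt K)).aemeasurable).aestronglyMeasurable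
  · filter_upwards [hY.tendsto_stepE_scaledEval s] with ω hω using (hF.tendsto _).comp hω

end IsBrownianBridge

namespace IsLaw
variable {p : ℕ → ℝ} {m α : ℝ} (h : IsLaw p m α)
include h

theorem isProbabilityMeasure_canon_floor (N : ℕ) :
    IsProbabilityMeasure (canon p N ⌊(N : ℝ) * m⌋₊) := by
  refine isProbabilityMeasure_canon h.pos ?_
  rcases Nat.eq_zero_or_pos N with rfl | hN
  · simp
  · exact Or.inl hN

theorem tendsto_integral_evalAt (hm : 0 < m) (hY : IsBrownianBridge Y P) {s : ℝ} (hs : s ^ 2 = α)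
    {d : ℕ} (t : Fin d → unitInterval) {f : EuclideanSpace ℝ (Fin d) → ℝ} (hf : Continuous f)
    {b : ℝ} (hb : ∀ v, |f v| ≤ b) :
    Tendsto (fun N : ℕ => ∫ n, f (evalAt N m t n) ∂(canon p N ⌊(N : ℝ) * m⌋₊)) atTop
      (𝓝 (∫ ω, f (scaledEval s Y t ω) ∂P)) := by
  have hP := hY.gaussian.isProbabilityMeasure
  have hN := h.isProbabilityMeasure_canon_floor
  have hmeas (N : ℕ) : Measurable (evalAt N m t) := Measurable.of_discrete
  have hYm := (hY.hasGaussianLaw_scaledEval s t).aemeasurable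
  let μs : ℕ → ProbabilityMeasure (EuclideanSpace ℝ (Fin d)) := fun N =>
    ⟨(canon p N ⌊(N : ℝ) * m⌋₊).map (evalAt N m t),
      Measure.isProbabilityMeasure_map (hmeas N).aemeasurable⟩
  let μ : ProbabilityMeasure (EuclideanSpace ℝ (Fin d)) :=
    ⟨P.map (scaledEval s Y t), Measure.isProbabilityMeasure_map hYm⟩
  have hlim : Tendsto μs atTop (𝓝 μ) := by
    rw [ProbabilityMeasure.tendsto_iff_tendsto_charFun]
    intro ξ
    have h1 := h.tendsto_integral_chr _ (tendsto_floor_sub m hm) _ (abs_evalCoeff_le t ξ)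
      (tendsto_sum_evalCoeff t ξ) (tendsto_sum_evalCoeff_sq t ξ)
    change Tendsto (fun N : ℕ => charFun ((canon p N ⌊(N : ℝ) * m⌋₊).map (evalAt N m t)) ξ) atTop
      (𝓝 (charFun (P.map (scaledEval s Y t)) ξ))
    rw [hY.charFun_scaledEval, hs]
    refine h1.congr fun N => ?_
    rw [charFun_apply, integral_map (hmeas N).aemeasurable (by fun_prop)]
    congr 1
    funext n
    rw [← exp_inner_evalAt, mul_comm, real_inner_comm]
  have h2 := ProbabilityMeasure.tendsto_iff_forall_integral_tendsto.1 hlim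
    (BoundedContinuousFunction.ofNormedAddCommGroup f hf b hb)
  change Tendsto (fun N : ℕ => ∫ v, f v ∂((canon p N ⌊(N : ℝ) * m⌋₊).map (evalAt N m t))) atTop
    (𝓝 (∫ v, f v ∂(P.map (scaledEval s Y t)))) at h2
  rw [integral_map hYm hf.measurable.aestronglyMeasurable] at h2
  refine h2.congr fun N => ?_
  rw [integral_map (hmeas N).aemeasurable hf.measurable.aestronglyMeasurable]

/-- Lipschitz test functions determine weak convergence, and the step-function error is uniform in
`N`; finite-dimensional convergence therefore suffices. -/
theorem tendsto_integral_heightE (hm : 0 < m) (hY : IsBrownianBridge Y P) {s : ℝ} (hs : s ^ 2 = α)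
    {F : E → ℝ} (hF : Continuous F) {b : ℝ} (hb : ∀ u, |F u| ≤ b) :
    Tendsto (fun N : ℕ => ∫ n, F (heightE N m n) ∂(canon p N ⌊(N : ℝ) * m⌋₊)) atTop
      (𝓝 (∫ u, F u ∂(scaledLaw s Y P))) := by
  have hP := hY.isProbabilityMeasure_scaledLaw s
  have hN := h.isProbabilityMeasure_canon_floor
  have hmeas (N : ℕ) : Measurable (heightE N m) := Measurable.of_discrete
  let μs : ℕ → ProbabilityMeasure E := fun N =>
    ⟨(canon p N ⌊(N : ℝ) * m⌋₊).map (heightE N m),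
      Measure.isProbabilityMeasure_map (hmeas N).aemeasurable⟩
  let μ : ProbabilityMeasure E := ⟨scaledLaw s Y P, hP⟩
  obtain ⟨C, hC, hCb⟩ := h.exists_integral_dist_stepE_le hm
  have hlim : Tendsto μs atTop (𝓝 μ) := by
    rw [tendsto_iff_forall_lipschitz_integral_tendsto]
    rintro F ⟨B, hB⟩ ⟨L, hL⟩
    have hbF (u : E) : |F u| ≤ |F 0| + B := by
      have h1 := hB u 0
      rw [Real.dist_eq] at h1
      have h2 := abs_sub_abs_le_abs_sub (F u) (F 0)
      linarith
    change Tendsto (fun N : ℕ => ∫ u, F u ∂((canon p N ⌊(N : ℝ) * m⌋₊).map (heightE N m))) atTop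
      (𝓝 (∫ u, F u ∂(scaledLaw s Y P)))
    have e (N : ℕ) := integral_map (μ := canon p N ⌊(N : ℝ) * m⌋₊) (hmeas N).aemeasurable
      hL.continuous.measurable.aestronglyMeasurable
    simp_rw [e]
    have hδ : Tendsto (fun K : ℕ => L * C / √((K : ℝ) + 1)) atTop (𝓝 0) :=
      tendsto_const_nhds.div_atTop (Real.tendsto_sqrt_atTop.comp
        (tendsto_natCast_atTop_atTop.atTop_add tendsto_const_nhds))
    refine tendsto_of_approx (b := fun K N => ∫ n, F (stepE K (evalAt N m (gridPt K) n))
      ∂(canon p N ⌊(N : ℝ) * m⌋₊)) hδ (Eventually.of_forall fun K => ?_)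
      (Eventually.of_forall fun K => h.tendsto_integral_evalAt hm hY hs (gridPt K)
        (hL.continuous.comp (lipschitzWith_stepE K).continuous) (fun v => hbF _))
      (hY.tendsto_integral_stepE s hL.continuous hbF)
    filter_upwards [hCb K] with N hN
    rw [← integral_sub (integrable_canon p _ _ _) (integrable_canon p _ _ _)]
    refine (norm_integral_le_integral_norm _).trans ?_
    calc _ ≤ ∫ n, L * dist (heightE N m n) (stepE K (evalAt N m (gridPt K) n))
          ∂(canon p N ⌊(N : ℝ) * m⌋₊) :=
          integral_mono (integrable_canon p _ _ _) (integrable_canon p _ _ _) fun n =>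
            hL.dist_le_mul _ _
      _ ≤ _ := by
          rw [integral_const_mul, mul_div_assoc]
          gcongr
  have h2 := ProbabilityMeasure.tendsto_iff_forall_integral_tendsto.1 hlim
    (BoundedContinuousFunction.ofNormedAddCommGroup F hF b hb)
  change Tendsto (fun N : ℕ => ∫ u, F u ∂((canon p N ⌊(N : ℝ) * m⌋₊).map (heightE N m))) atTop
    (𝓝 (∫ u, F u ∂(scaledLaw s Y P))) at h2
  refine h2.congr fun N => ?_
  rw [integral_map (hmeas N).aemeasurable hF.measurable.aestronglyMeasurable]

end IsLaw

end

/-! ### Bounded continuous test functions, the unbounded limit density, and conclusion -/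

section


theorem abs_pairing_sub_le {f : ℝ → ℝ} {C : ℝ} (hf : Continuous f) (hC : ∀ x, |f x| ≤ C) (u v : E) :
    |pairing u f - pairing v f| ≤ C * dist u v := by
  have hb (u : E) : Integrable fun x : unitInterval => u x * f x := by
    refine (L1.integrable_coeFn u).mul_bdd (c := C) ?_ (ae_of_all _ fun x => hC x)
    exact (hf.comp continuous_subtype_val).aestronglyMeasurable
  rw [pairing, pairing, ← integral_sub (hb u) (hb v), L1.dist_eq_integral_dist, ← integral_const_mul]
  refine (abs_integral_le_integral_abs).trans ?_
  refine integral_mono ((hb u).sub (hb v)).abs ?_ fun x => ?_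
  · exact ((L1.integrable_coeFn u).sub (L1.integrable_coeFn v)).norm.const_mul C |>.congr
      (ae_of_all _ fun x => by simp [dist_eq_norm])
  · dsimp only
    rw [← sub_mul, abs_mul, mul_comm, Real.dist_eq]
    gcongr
    exact hC x

theorem continuous_pairing {f : ℝ → ℝ} {C : ℝ} (hf : Continuous f) (hC : ∀ x, |f x| ≤ C) :
    Continuous fun u : E => pairing u f := by
  have hC0 : 0 ≤ C := (abs_nonneg _).trans (hC 0)
  refine (LipschitzWith.of_dist_le_mul (K := ⟨C, hC0⟩) fun u v => ?_).continuous
  exact abs_pairing_sub_le hf hC u v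

/-- The truncation of a real number to `[-R, R]`. -/
def trunc (R x : ℝ) : ℝ := max (-R) (min R x)

theorem continuous_trunc (R : ℝ) : Continuous (trunc R) := by
  unfold trunc; fun_prop

theorem abs_trunc_le {R : ℝ} (hR : 0 ≤ R) (x : ℝ) : |trunc R x| ≤ R := by
  rw [trunc, abs_le]
  exact ⟨le_max_left _ _, max_le (by linarith) (min_le_left _ _)⟩

theorem abs_sub_trunc_le {R : ℝ} (hR : 0 < R) (x : ℝ) : |x - trunc R x| ≤ x ^ 2 / R := by
  rw [le_div_iff₀ hR, trunc]
  rcases le_or_gt x (-R) with h1 | h1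
  · rw [min_eq_right (by linarith), max_eq_left h1, abs_of_nonpos (by linarith)]
    nlinarith
  · rcases le_or_gt x R with h2 | h2
    · rw [min_eq_right h2, max_eq_right h1.le, sub_self, abs_zero, zero_mul]
      positivity
    · rw [min_eq_left h2.le, max_eq_right (by linarith), abs_of_pos (by linarith)]
      nlinarith

/-- Monotone convergence. The truncations `min (q²) k` are bounded, hence can be reached by weak
convergence. -/
theorem integrable_sq_of_integral_min_le {X : Type*} [MeasurableSpace X] {μ : Measure X}
    [IsFiniteMeasure μ] {q : X → ℝ} (hq : Measurable q) {B : ℝ}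
    (hB : ∀ k : ℕ, ∫ x, min (q x ^ 2) k ∂μ ≤ B) :
    Integrable (fun x => q x ^ 2) μ ∧ ∫ x, q x ^ 2 ∂μ ≤ B := by
  have hB0 : 0 ≤ B := le_trans (integral_nonneg fun x => le_min (sq_nonneg _) (by simp)) (hB 0)
  have hle (k : ℕ) : ∫⁻ x, ENNReal.ofReal (min (q x ^ 2) k) ∂μ ≤ ENNReal.ofReal B := by
    rw [← ofReal_integral_eq_lintegral_ofReal]
    · exact ENNReal.ofReal_le_ofReal (hB k)
    · refine Integrable.of_bound (C := k) (by fun_prop) (ae_of_all _ fun x => ?_)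
      rw [Real.norm_eq_abs, abs_of_nonneg (le_min (sq_nonneg _) (Nat.cast_nonneg _))]
      exact min_le_right _ _
    · exact ae_of_all _ fun x => le_min (sq_nonneg _) (Nat.cast_nonneg _)
  have hlim : Tendsto (fun k : ℕ => ∫⁻ x, ENNReal.ofReal (min (q x ^ 2) k) ∂μ) atTop
      (𝓝 (∫⁻ x, ENNReal.ofReal (q x ^ 2) ∂μ)) := by
    refine lintegral_tendsto_of_tendsto_of_monotone (fun k => by fun_prop)
      (ae_of_all _ fun x i j hij => ?_) (ae_of_all _ fun x => ?_)
    · exact ENNReal.ofReal_le_ofReal (min_le_min_left _ (by exact_mod_cast hij))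
    · refine tendsto_const_nhds.congr' ?_
      filter_upwards [(tendsto_natCast_atTop_atTop (R := ℝ)).eventually_ge_atTop (q x ^ 2)] with k hk
      rw [min_eq_left hk]
  have h1 : ∫⁻ x, ENNReal.ofReal (q x ^ 2) ∂μ ≤ ENNReal.ofReal B := le_of_tendsto' hlim hle
  have h2 : Integrable (fun x => q x ^ 2) μ := by
    refine ⟨(hq.pow_const 2).aestronglyMeasurable, ?_⟩
    rw [hasFiniteIntegral_iff_ofReal (ae_of_all _ fun x => sq_nonneg _)]
    exact h1.trans_lt ENNReal.ofReal_lt_top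
  refine ⟨h2, ?_⟩
  rw [integral_eq_lintegral_of_nonneg_ae (ae_of_all _ fun x => sq_nonneg _) h2.1]
  exact ENNReal.toReal_le_of_le_ofReal hB0 h1

namespace IsLaw
variable {Ω : Type*} [MeasurableSpace Ω] {Y : unitInterval → Ω → ℝ} {P : Measure Ω}
  {p : ℕ → ℝ} {m α : ℝ} (h : IsLaw p m α)
include h

/-- `F` need not be uniformly approximable by Lipschitz functions. Its minorants `F_k` are close to
it in `L¹` of the limit law, and weak convergence applied to `|F - F_k|` transfers this to large
`N`; the second moment of `G` does the rest. -/
theorem tendsto_integral_bounded_mul (hm : 0 < m) (hY : IsBrownianBridge Y P) {s : ℝ}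
    (hs : s ^ 2 = α) {G : ∀ N : ℕ, (Fin N → ℕ) → ℂ} {B : ℝ}
    (hG : ∀ᶠ N in atTop, ∫ n, ‖G N n‖ ^ 2 ∂(canon p N ⌊(N : ℝ) * m⌋₊) ≤ B)
    (hchar : ∀ (K : ℕ) (ξ : EuclideanSpace ℝ (Fin (K + 2))), Tendsto (fun N : ℕ =>
      ∫ n, Complex.exp (Complex.I * (inner ℝ ξ (evalAt N m (gridPt K) n) : ℝ)) * G N n
      ∂(canon p N ⌊(N : ℝ) * m⌋₊)) atTop (𝓝 0))
    {F : E → ℝ} (hF : Continuous F) {b : ℝ} (hb : ∀ u, |F u| ≤ b) :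
    Tendsto (fun N : ℕ => ∫ n, (F (heightE N m n) : ℂ) * G N n ∂(canon p N ⌊(N : ℝ) * m⌋₊)) atTop
      (𝓝 0) := by
  have hP := hY.isProbabilityMeasure_scaledLaw s
  have hb0 : 0 ≤ b := (abs_nonneg _).trans (hb 0)
  have hFk (k : ℕ) : Continuous (infConv F k) := (lipschitzWith_infConv hb k).continuous
  have hdiff (k : ℕ) (u : E) : |F u - infConv F k u| ≤ 2 * b := by
    have := abs_sub (F u) (infConv F k u)
    linarith [hb u, abs_infConv_le hb k u]
  -- The added `1/(k+1)` makes `r k` positive and strictly larger than the limiting `L¹` error.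
  set r : ℕ → ℝ := fun k => (∫ u, |F u - infConv F k u| ∂(scaledLaw s Y P)) + 1 / ((k : ℝ) + 1)
    with hr
  have hr0 (k : ℕ) : 0 < r k := by
    have : 0 ≤ ∫ u, |F u - infConv F k u| ∂(scaledLaw s Y P) := integral_nonneg fun _ => abs_nonneg _
    positivity
  have hrlim : Tendsto r atTop (𝓝 0) := by
    have h1 : Tendsto (fun k => ∫ u, |F u - infConv F k u| ∂(scaledLaw s Y P)) atTop
        (𝓝 (∫ _u : E, (0 : ℝ) ∂(scaledLaw s Y P))) := by
      refine tendsto_integral_of_dominated_convergence (fun _ => 2 * b)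
        (fun k => (hF.sub (hFk k)).abs.measurable.aestronglyMeasurable) (integrable_const _)
        (fun k => ae_of_all _ fun u => ?_) (ae_of_all _ fun u => ?_)
      · rw [Real.norm_eq_abs, abs_abs]; exact hdiff k u
      · have := ((tendsto_infConv hb hF u).const_sub (F u)).abs
        rwa [sub_self, abs_zero] at this
    have := h1.add tendsto_one_div_add_atTop_nhds_zero_nat
    rwa [integral_zero, add_zero] at this
  have hδ : Tendsto (fun k => (B + 2 * b) * √(r k)) atTop (𝓝 0) := by
    have := (Real.continuous_sqrt.tendsto 0).comp hrlim
    rw [Real.sqrt_zero] at this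
    simpa using this.const_mul (B + 2 * b)
  refine tendsto_of_approx (b := fun k N => ∫ n, (infConv F k (heightE N m n) : ℂ) * G N n
    ∂(canon p N ⌊(N : ℝ) * m⌋₊)) (c := fun _ => 0) hδ (Eventually.of_forall fun k => ?_)
    (Eventually.of_forall fun k => h.tendsto_integral_lipschitz_mul hm hG hchar
      (lipschitzWith_infConv hb k) (abs_infConv_le hb k)) tendsto_const_nhds
  have h1 := h.tendsto_integral_heightE hm hY hs (hF.sub (hFk k)).abs (b := 2 * b)
    (fun u => by rw [abs_abs]; exact hdiff k u)
  have h2 := h1.eventually_lt_const (u := r k) (by rw [hr]; simp; positivity)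
  filter_upwards [hG, h2] with N h3 h4
  rw [← integral_sub (integrable_canon p _ _ _) (integrable_canon p _ _ _)]
  refine (norm_integral_le_integral_norm _).trans ?_
  -- Young's inequality with weight `√(r k)`, so that both resulting terms are of order `√(r k)`.
  set w := √(r k) with hw
  have hw0 : 0 < w := Real.sqrt_pos.2 (hr0 k)
  have hww : r k = w ^ 2 := (Real.sq_sqrt (hr0 k).le).symm
  rw [hww] at h4
  calc _ ≤ ∫ n, (w * ‖G N n‖ ^ 2 + 1 / w * (2 * b) *
        |F (heightE N m n) - infConv F k (heightE N m n)|) ∂(canon p N ⌊(N : ℝ) * m⌋₊) := by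
        refine integral_mono (integrable_canon p _ _ _) (integrable_canon p _ _ _) fun n => ?_
        dsimp only
        set u := heightE N m n
        rw [← sub_mul, ← Complex.ofReal_sub, norm_mul, Complex.norm_real, Real.norm_eq_abs]
        have h5 : |F u - infConv F k u| ^ 2 ≤ 2 * b * |F u - infConv F k u| := by
          rw [sq]
          exact mul_le_mul_of_nonneg_right (hdiff k u) (abs_nonneg _)
        set x := |F u - infConv F k u|
        have hx : 0 ≤ x := abs_nonneg _
        have e : w * ‖G N n‖ ^ 2 + 1 / w * x ^ 2 - x * ‖G N n‖ =
            ((w * ‖G N n‖ - x) ^ 2 + x * (w * ‖G N n‖)) / w := by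
          field_simp; ring
        have h6 : 0 ≤ ((w * ‖G N n‖ - x) ^ 2 + x * (w * ‖G N n‖)) / w := by positivity
        calc _ ≤ w * ‖G N n‖ ^ 2 + 1 / w * x ^ 2 := by linarith
          _ ≤ w * ‖G N n‖ ^ 2 + 1 / w * (2 * b * x) := by gcongr
          _ = _ := by ring
    _ ≤ w * B + 1 / w * (2 * b) * w ^ 2 := by
        rw [integral_add (integrable_canon p _ _ _) (integrable_canon p _ _ _), integral_const_mul,
          integral_const_mul]
        gcongr
        exact h4.le
    _ = _ := by field_simp

variable {φ : ℝ → ℝ} {C : ℝ}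

/-- The second moment bound under the discrete laws passes to the limit law through bounded
truncations. -/
theorem integrable_pairing_sq (hm : 0 < m) (hφ : IsTest φ C) {D : ℝ}
    (hD : ∀ x, |deriv (deriv φ) x| ≤ D) (hY : IsBrownianBridge Y P) {s : ℝ} (hs : s ^ 2 = α) :
    Integrable (fun u => pairing u (deriv (deriv φ)) ^ 2) (scaledLaw s Y P) := by
  have hP := hY.isProbabilityMeasure_scaledLaw s
  have hc : Continuous (deriv (deriv φ)) := hφ.contDiff_deriv.continuous_deriv le_rfl
  have hq := continuous_pairing hc hD
  obtain ⟨K, hK, hKb⟩ := h.exists_integral_pairing_sq_le hm hφ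
  refine (integrable_sq_of_integral_min_le (B := K) hq.measurable fun k => ?_).1
  have h1 := h.tendsto_integral_heightE hm hY hs (F := fun u => min (pairing u (deriv (deriv φ)) ^ 2) k)
    (b := k) (by fun_prop) fun u => by
      rw [abs_of_nonneg (le_min (sq_nonneg _) (Nat.cast_nonneg _))]
      exact min_le_right _ _
  refine le_of_tendsto h1 ?_
  filter_upwards [hKb] with N hN
  exact (integral_mono (integrable_canon p _ _ _) (integrable_canon p _ _ _)
    fun n => min_le_left _ _).trans hN

theorem integrable_pairing (hm : 0 < m) (hφ : IsTest φ C) {D : ℝ}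
    (hD : ∀ x, |deriv (deriv φ) x| ≤ D) (hY : IsBrownianBridge Y P) {s : ℝ} (hs : s ^ 2 = α) :
    Integrable (fun u => pairing u (deriv (deriv φ))) (scaledLaw s Y P) := by
  have hP := hY.isProbabilityMeasure_scaledLaw s
  have hc : Continuous (deriv (deriv φ)) := hφ.contDiff_deriv.continuous_deriv le_rfl
  have hq := continuous_pairing hc hD
  exact ((memLp_two_iff_integrable_sq hq.measurable.aestronglyMeasurable).2
    (h.integrable_pairing_sq hm hφ hD hY hs)).integrable one_le_two

/-- Weak convergence handles the truncated pairing; uniform second moments make the truncation error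
`O(1/(k+1))` under the discrete laws and under the limit law. -/
theorem tendsto_integral_mul_pairing (hm : 0 < m) (hφ : IsTest φ C) {D : ℝ}
    (hD : ∀ x, |deriv (deriv φ) x| ≤ D) (hY : IsBrownianBridge Y P) {s : ℝ} (hs : s ^ 2 = α)
    {F : E → ℝ} (hF : Continuous F) {b : ℝ} (hb : ∀ u, |F u| ≤ b) :
    Tendsto (fun N : ℕ => ∫ n, F (heightE N m n) * pairing (heightE N m n) (deriv (deriv φ))
      ∂(canon p N ⌊(N : ℝ) * m⌋₊)) atTop
      (𝓝 (∫ u, F u * pairing u (deriv (deriv φ)) ∂(scaledLaw s Y P))) := by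
  have hP := hY.isProbabilityMeasure_scaledLaw s
  have hc : Continuous (deriv (deriv φ)) := hφ.contDiff_deriv.continuous_deriv le_rfl
  have hq := continuous_pairing hc hD
  have hb0 : 0 ≤ b := (abs_nonneg _).trans (hb 0)
  have hsq := h.integrable_pairing_sq hm hφ hD hY hs
  have hint := h.integrable_pairing hm hφ hD hY hs
  obtain ⟨K, hK, hKb⟩ := h.exists_integral_pairing_sq_le hm hφ
  set q : E → ℝ := fun u => pairing u (deriv (deriv φ)) with hqdef
  have hpt (k : ℕ) (u : E) : |F u * q u - F u * trunc (k + 1) (q u)| ≤ b * (1 / ((k : ℝ) + 1)) * q u ^ 2 := by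
    rw [← mul_sub, abs_mul]
    calc _ ≤ b * (q u ^ 2 / (k + 1)) := by
          gcongr
          · exact hb u
          · exact abs_sub_trunc_le (by positivity) _
      _ = _ := by ring
  have hbd (k : ℕ) (u : E) : |F u * trunc (k + 1) (q u)| ≤ b * (k + 1) := by
    rw [abs_mul]
    gcongr
    · exact hb u
    · exact abs_trunc_le (by positivity) _
  have hcont (k : ℕ) : Continuous fun u => F u * trunc (k + 1) (q u) :=
    hF.mul ((continuous_trunc _).comp hq)
  have hδ (c : ℝ) : Tendsto (fun k : ℕ => b * (1 / ((k : ℝ) + 1)) * c) atTop (𝓝 0) := by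
    simpa using (tendsto_one_div_add_atTop_nhds_zero_nat.const_mul b).mul_const c
  refine tendsto_of_approx (b := fun k N => ∫ n, F (heightE N m n) * trunc (k + 1) (q (heightE N m n))
    ∂(canon p N ⌊(N : ℝ) * m⌋₊))
    (c := fun k => ∫ u, F u * trunc (k + 1) (q u) ∂(scaledLaw s Y P)) (hδ K)
    (Eventually.of_forall fun k => ?_)
    (Eventually.of_forall fun k => h.tendsto_integral_heightE hm hY hs (hcont k) (hbd k)) ?_
  · filter_upwards [hKb] with N hN
    rw [← integral_sub (integrable_canon p _ _ _) (integrable_canon p _ _ _)]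
    refine (norm_integral_le_integral_norm _).trans ?_
    calc _ ≤ ∫ n, b * (1 / ((k : ℝ) + 1)) * q (heightE N m n) ^ 2 ∂(canon p N ⌊(N : ℝ) * m⌋₊) :=
          integral_mono (integrable_canon p _ _ _) (integrable_canon p _ _ _) fun n => hpt k _
      _ ≤ _ := by
          rw [integral_const_mul]
          gcongr
  · rw [tendsto_iff_norm_sub_tendsto_zero]
    refine squeeze_zero (fun _ => norm_nonneg _) (fun k => ?_) (hδ (∫ u, q u ^ 2 ∂(scaledLaw s Y P)))
    have hi1 : Integrable (fun u => F u * q u) (scaledLaw s Y P) :=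
      hint.bdd_mul (c := b) hF.measurable.aestronglyMeasurable (ae_of_all _ hb)
    have hi2 : Integrable (fun u => F u * trunc (k + 1) (q u)) (scaledLaw s Y P) :=
      Integrable.of_bound (hcont k).measurable.aestronglyMeasurable (b * (k + 1))
        (ae_of_all _ (hbd k))
    rw [norm_sub_rev, ← integral_sub hi1 hi2, ← integral_const_mul]
    exact (norm_integral_le_integral_norm _).trans
      (integral_mono (hi1.sub hi2).norm (hsq.const_mul _) fun u => hpt k u)

variable {c σ : ℝ}

theorem integrable_limitDensity (hm : 0 < m) (hφ : IsTest φ C) {D : ℝ}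
    (hD : ∀ x, |deriv (deriv φ) x| ≤ D) (hY : IsBrownianBridge Y P) {s : ℝ} (hs : s ^ 2 = α) :
    Integrable (limitDensity c σ φ) (scaledLaw s Y P) :=
  have := hY.isProbabilityMeasure_scaledLaw s
  ((h.integrable_pairing hm hφ hD hY hs).ofReal.const_mul _).sub (integrable_const _)

theorem tendsto_integral_mul_limitDensity (hm : 0 < m) (hφ : IsTest φ C) {D : ℝ}
    (hD : ∀ x, |deriv (deriv φ) x| ≤ D) (hY : IsBrownianBridge Y P) {s : ℝ} (hs : s ^ 2 = α)
    {F : E → ℝ} (hF : Continuous F) {b : ℝ} (hb : ∀ u, |F u| ≤ b) :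
    Tendsto (fun N : ℕ => ∫ n, (F (heightE N m n) : ℂ) * limitDensity c σ φ (heightE N m n)
      ∂(canon p N ⌊(N : ℝ) * m⌋₊)) atTop
      (𝓝 (∫ u, (F u : ℂ) * limitDensity c σ φ u ∂(scaledLaw s Y P))) := by
  have hP := hY.isProbabilityMeasure_scaledLaw s
  have h1 := h.tendsto_integral_mul_pairing hm hφ hD hY hs hF hb
  have h2 := h.tendsto_integral_heightE hm hY hs hF hb
  set e : ℂ := ((σ ^ 2 / 2 * ∫ x : unitInterval, φ x ^ 2 : ℝ) : ℂ) with he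
  have h3 := (((Complex.continuous_ofReal.tendsto _).comp h1).const_mul (Complex.I * c)).sub
    (((Complex.continuous_ofReal.tendsto _).comp h2).mul_const e)
  have hpt (u : E) : (F u : ℂ) * limitDensity c σ φ u =
      Complex.I * c * ((F u * pairing u (deriv (deriv φ)) : ℝ) : ℂ) - (F u : ℂ) * e := by
    rw [limitDensity, ← he]
    push_cast
    ring
  simp_rw [hpt]
  have hi1 : Integrable (fun u => F u * pairing u (deriv (deriv φ))) (scaledLaw s Y P) :=
    (h.integrable_pairing hm hφ hD hY hs).bdd_mul (c := b) hF.measurable.aestronglyMeasurable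
      (ae_of_all _ hb)
  have hi2 : Integrable F (scaledLaw s Y P) :=
    Integrable.of_bound hF.measurable.aestronglyMeasurable b (ae_of_all _ hb)
  rw [integral_sub (hi1.ofReal.const_mul _) (hi2.ofReal.mul_const _), integral_const_mul,
    integral_mul_const, integral_complex_ofReal, integral_complex_ofReal]
  refine h3.congr fun N => ?_
  rw [integral_sub (integrable_canon p _ _ _) (integrable_canon p _ _ _), integral_const_mul,
    integral_mul_const, integral_complex_ofReal, integral_complex_ofReal]
  rfl

end IsLaw

/-! ### The invariant measures -/

theorem integrable_mN (τ : ℕ → ℝ) (nbar : ℝ) (N : ℕ) (g : E → ℂ) : Integrable g (mN τ nbar N) := by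
  refine integrable_finsetSum_measure.2 fun n _ => ?_
  exact (integrable_dirac (by simp)).smul_measure ENNReal.ofReal_ne_top

/-- The convergence of the complex measures, with all the integrability that it presupposes. -/
theorem weakConv_SigmaN (τ : ℕ → ℝ) (hτ : IsRate τ)
    (nbar : ℝ) (hnbar : 0 < nbar) (hnbar' : (nbar : EReal) < RStar τ)
    (c σ : ℝ) (hc : c = rho τ nbar / (2 * alpha τ nbar))
    (hσ : σ = √(tauBar τ nbar))
    {Ω : Type*} [MeasurableSpace Ω] (P : Measure Ω) (Y : unitInterval → Ω → ℝ)
    (hY : IsBrownianBridge Y P)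
    (φ : ℝ → ℝ) (hφ : ContDiff ℝ 2 φ) (hφ_supp : tsupport φ ⊆ Set.Ioo 0 1) :
    (∀ N : ℕ, Integrable (discreteDensity τ nbar N φ)
      (mN τ nbar N)) ∧
    Integrable (limitDensity c σ φ) (bridgeLaw Y P c σ) ∧
    WeakConv (SigmaN τ nbar φ)
      (SigmaLimit (bridgeLaw Y P c σ) c σ φ) := by
  obtain ⟨C, hT⟩ := exists_isTest hφ hφ_supp
  have hcs : HasCompactSupport φ := HasCompactSupport.of_support_subset_isCompact
    (isCompact_Icc (a := (0 : ℝ)) (b := 1))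
    ((subset_tsupport φ).trans (hφ_supp.trans Set.Ioo_subset_Icc_self))
  obtain ⟨D, hD⟩ := hcs.deriv.deriv.exists_bound_of_continuous
    (hT.contDiff_deriv.continuous_deriv le_rfl)
  have hlaw := hτ.isLaw_nu hnbar hnbar'
  have hZ := hτ.Z_Phi_pos hnbar hnbar'
  obtain ⟨⟨ha, _⟩, _⟩ := hτ.Phi_spec hnbar hnbar'
  have hα := hlaw.var_pos
  rw [hτ.rho_eq hnbar hnbar'] at hc
  rw [hτ.tauBar_eq hnbar hnbar'] at hσ
  set a := Phi τ nbar
  have hσ2 : σ ^ 2 = a := by rw [hσ, Real.sq_sqrt ha.le]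
  -- Consistency of the parameters: `σ² = a` and `2c = a/α`, so the bridge is scaled by `√α`.
  have hs : √(σ ^ 2 / (2 * c)) ^ 2 = alpha τ nbar := by
    rw [hσ2, hc, show a / (2 * (a / (2 * alpha τ nbar))) = alpha τ nbar by field_simp,
      Real.sq_sqrt hα.le]
  have hint := hlaw.integrable_limitDensity (c := c) (σ := σ) hnbar hT hD hY hs
  refine ⟨fun N => integrable_mN τ nbar N _, hint, fun F => ?_⟩
  have hFb (u : E) : |F u| ≤ ‖F‖ := F.norm_coe_le_norm u
  -- The discrete density is split as (difference) + (limit density): the first part tends to zero,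
  -- the second to the required integral.
  have hlim := (hlaw.tendsto_integral_bounded_mul hnbar hY hs
    (hlaw.exists_integral_density_diff_sq_le (c := c) (σ := σ) hnbar
      (hτ.summable_rate_sq hnbar hnbar') hT).choose_spec
    (fun K ξ => hlaw.tendsto_integral_char_density_diff hnbar hτ.zero hτ.nu_succ hT hc hσ2
      (gridPt K) ξ) F.continuous hFb).add
    (hlaw.tendsto_integral_mul_limitDensity (c := c) (σ := σ) hnbar hT hD hY hs F.continuous hFb)
  rw [zero_add] at hlim
  rw [show bridgeLaw Y P c σ = scaledLaw (√(σ ^ 2 / (2 * c))) Y P from rfl, SigmaLimit, integral_withDensityᵥ hint F.continuous.stronglyMeasurable F.norm_coe_le_norm]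
  simp_rw [Complex.real_smul]
  refine hlim.congr' ?_
  filter_upwards [eventually_gt_atTop 0] with N hN
  rw [SigmaN, integral_withDensityᵥ (integrable_mN τ nbar N _) F.continuous.stronglyMeasurable
    F.norm_coe_le_norm]
  have hmeas : AEStronglyMeasurable (fun u => F u • discreteDensity τ nbar N φ u)
      ((canon (nu τ a) N ⌊(N : ℝ) * nbar⌋₊).map (heightE N nbar)) := by
    rw [← mN_eq_map ha hZ]
    exact (integrable_mN τ nbar N _).1
  rw [mN_eq_map ha hZ, integral_map Measurable.of_discrete.aemeasurable hmeas,
    ← integral_add (integrable_canon _ _ _ _) (integrable_canon _ _ _ _)]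
  refine integral_congr_ae ?_
  filter_upwards [ae_canon (p := nu τ a) (N := N) (M := ⌊(N : ℝ) * nbar⌋₊)] with n hn
  replace hn : ∑ j, n j = ⌊(N : ℝ) * nbar⌋₊ := hn
  rw [discreteDensity_heightE hτ.zero hN nbar hφ.continuous (by simpa [Omega] using hn), Complex.real_smul, ← mul_add]
  congr 1
  rw [sub_add_cancel]
  rfl

end

end

end ZeroRange

theorem mainTheorem7 (τ : ℕ → ℝ) (hτ : ZeroRange.IsRate τ)
    (nbar : ℝ) (hnbar : 0 < nbar) (hnbar' : (nbar : EReal) < ZeroRange.RStar τ)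
    (c σ : ℝ) (hc : c = ZeroRange.rho τ nbar / (2 * ZeroRange.alpha τ nbar))
    (hσ : σ = √(ZeroRange.tauBar τ nbar))
    {Ω : Type*} [MeasurableSpace Ω] (P : MeasureTheory.Measure Ω) (Y : unitInterval → Ω → ℝ)
    (hY : ZeroRange.IsBrownianBridge Y P)
    (φ : ℝ → ℝ) (hφ : ContDiff ℝ 2 φ) (hφ_supp : tsupport φ ⊆ Set.Ioo 0 1) :
    (∀ N : ℕ, MeasureTheory.Integrable (ZeroRange.discreteDensity τ nbar N φ)
      (ZeroRange.mN τ nbar N)) ∧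
    MeasureTheory.Integrable (ZeroRange.limitDensity c σ φ) (ZeroRange.bridgeLaw Y P c σ) ∧
    ZeroRange.WeakConv (ZeroRange.SigmaN τ nbar φ)
      (ZeroRange.SigmaLimit (ZeroRange.bridgeLaw Y P c σ) c σ φ) :=
  ZeroRange.weakConv_SigmaN τ hτ nbar hnbar hnbar' c σ hc hσ P Y hY φ hφ hφ_supp
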